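/- **Setting.** A tropical curve $\Gamma$ is a connected finite metric graph with a fixed model $G$ (vertex set $V$, edge set $E$, loops and multiple edges allowed, edge lengths $l(e)>0$) and a genus function $h:V\to\mathbb Z_{\ge 0}$. Fix an orientation of every edge $e$, which identifies $e$ with $[0,l(e)]$. A rational function on $\Gamma$ is a continuous function $f:\Gamma\to\mathbb R$ that is piecewise affine with integral slopes on every edge; $(f)=\sum_p \operatorname{ord}_p(f)\,p$, where $\operatorname{ord}_p(f)$ is the sum of the outgoing slopes of $f$ at $p$. Let $D$ be a divisor of degree $n\ge 0$ on $\Gamma$ and put $$S(D)=\{(f,p_1,\dots,p_n)\in \mathrm{Rat}(\Gamma)\times\Gamma^n : D+(f)=p_1+\dots+p_n\},$$ $$R(D)=\{f\in \mathrm{Rat}(\Gamma) : D+(f)\ge 0\},\qquad |D|=\{D'\ge 0 : D'=D+(f)\text{ for some } f\in \mathrm{Rat}(\Gamma)\}.$$ $\mathrm{Rat}(\Gamma)$ has the topology of uniform convergence, $S(D)$ and $R(D)$ have the subspace topologies, and $|D|$ has the quotient topology from $R(D)$. A *polyhedral complex structure* on a space $X$ consists of finitely many non-empty convex polyhedra $P_i$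 in a finite-dimensional real vector space and continuous injective maps $\varphi_i:P_i\to X$ such that $X$ is the disjoint union of the open cells $\varphi_i(\operatorname{relint}P_i)$, every non-empty face $F$ of a $P_i$ is mapped onto some $P_j$ by an affine map $A$ with $\varphi_j\circ A=\varphi_i$ on $F$, and a subset of $X$ is closed if its preimage in every $P_i$ is closed. **Proposition.** (1) $S(D)$ has the structure of a polyhedral complex. Its open cells are the non-empty ones among the sets of points of $S(D)$ with given discrete data of the following form: (i) a partition of $\{p_1,\dots,p_n\}$ into sets $P_v$ ($v\in V$) and $P_e$ ($e\in E$) that tells at which vertex or in the interior of which edge every $p_i$ lies; (ii) on every $P_e$ the order of the points along $e$, a total order in which ties (coinciding points) are allowed; (iii) for every $e$ the outgoing slope $m_e\in\mathbb Z$ of $f$ at the starting point of $e$; such that for every vertex $v$ $$\#P_v=D(v)+\sum_{e\text{ outward at }v}m_e+\sum_{e\text{ inward at }v}-\bigl(\#P_e+m_e-D(e^\circ)\bigr),$$ where $D(e^\circ)$ is the degree of the part of $D$ supported in the interior of $e$ (so $D(e^\circ)=0$ if $D$ is supported on $V$). Coordinates on the closed cell are the values $f(v)$, $v\in V$, and the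 distances $x_i$ of the points $p_i\in P_e$ from the starting point of $e$ (with $x_i=0$ for the points in the sets $P_v$). In these coordinates the open cell is given by $0<x_i<l(e)$ for $p_i\in P_e$, by the prescribed order with ties of the $x_i$, $p_i\in P_e$, and, for every edge $e$ from $v$ to $v'$, by $$f(v')=f(v)+m_e\,l(e)+\sum_{p_i\in P_e}\bigl(l(e)-x_i\bigr)-\sum_{p\in e^\circ}D(p)\bigl(l(e)-d(p)\bigr),$$ where $d(p)$ is the distance of $p$ from the starting point of $e$; the closed cell is given by the corresponding weak inequalities and the same equations. Discrete data occur for some point of $S(D)$ if and only if they satisfy the vertex condition and this system has a solution. Every cell is a face of a cell with the same data (i) and (iii) whose orders (ii) refine the given ones and have no ties. (2) The map $S(D)\to R(D)$, $(f,p_1,\dots,p_n)\mapsto f$, is a topological quotient map whose fibres are the orbits of the symmetric group $S_n$ permuting the points, and $R(D)\to|D|$, $f\mapsto D+(f)$, is a topological quotient map whose fibres are the orbits of $\mathbb R$ acting by adding constants. The polyhedral structure descends along both maps: $R(D)$ and $|D|$ carry polyhedral complex structures with cells indexed by the $S_n$-orbits of cells of $S(D)$, such that each closed cell of $S(D)$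 is mapped onto the corresponding closed cell of $R(D)$, and each closed cell of $R(D)$ onto the corresponding closed cell of $|D|$, by maps that are affine in the charts. -/

import Mathlib

open Set Filter Topology

noncomputable section

/-! ### Polyhedra and polyhedral complexes -/

/-- A convex polyhedron: a finite intersection of closed half-spaces. -/
def IsPolyhedron {W : Type*} [AddCommGroup W] [Module ℝ W] (P : Set W) : Prop :=
  ∃ (k : ℕ) (a : Fin k → W →ₗ[ℝ] ℝ) (b : Fin k → ℝ), P = {y | ∀ i, a i y ≤ b i}

/-- A (finite, abstract) polyhedral complex structure on a topological space `X`: finitely many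
non-empty convex polyhedra `P i`, and embeddings `φ i : P i → X`, such that `X` is the disjoint
union of the open cells (the images of the relative interiors), every face of a polyhedron is
identified by an affine map with another polyhedron of the family, and `X` carries the topology
glued from the polyhedra. Only the values of `φ i` on `P i` matter. -/
structure IsPolyhedralComplex {ι W X : Type*} [AddCommGroup W] [Module ℝ W] [TopologicalSpace W]
    [TopologicalSpace X] (P : ι → Set W) (φ : ι → W → X) : Prop where
  finite : Finite ι
  isPolyhedron : ∀ i, IsPolyhedron (P i)
  nonempty : ∀ i, (P i).Nonempty
  continuousOn : ∀ i, ContinuousOn (φ i) (P i)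
  injOn : ∀ i, InjOn (φ i) (P i)
  partition : ∀ x : X, ∃! i, x ∈ φ i '' intrinsicInterior ℝ (P i)
  face : ∀ i (F : Set W), IsExposed ℝ (P i) F → F.Nonempty →
    ∃ (j : ι) (A : W →ᵃ[ℝ] W), A '' F = P j ∧ ∀ y ∈ F, φ j (A y) = φ i y
  isClosed : ∀ C : Set X, (∀ i, IsClosed (P i ∩ φ i ⁻¹' C)) → IsClosed C

/-- The polyhedral complex `(P, φ)` on `X` descends along `q : X → Y` to `(P', ψ)` on `Y`: every
cell `i` of `X` is mapped by `q` onto the cell `r i` of `Y`, the map is affine in the charts, and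
every cell of `Y` arises in this way. -/
structure DescendsAlong {ι κ W W' X Y : Type*} [AddCommGroup W] [Module ℝ W]
    [AddCommGroup W'] [Module ℝ W'] (q : X → Y) (r : ι → κ)
    (P : ι → Set W) (φ : ι → W → X) (P' : κ → Set W') (ψ : κ → W' → Y) : Prop where
  surjective : Function.Surjective r
  affine : ∀ i, ∃ A : W →ᵃ[ℝ] W', A '' P i = P' (r i) ∧ ∀ y ∈ P i, ψ (r i) (A y) = q (φ i y)

/-! ### Tropical curves -/

/-- A tropical curve, given by a model with vertex set `V` and edge set `E` (loops and multiple
edges allowed): a connected graph with oriented edges, positive edge lengths and a genus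
function on the vertices. -/
structure TropicalCurve (V E : Type*) where
  src : E → V
  tgt : E → V
  len : E → ℝ
  len_pos : ∀ e, 0 < len e
  genus : V → ℕ
  nonempty : Nonempty V
  connected : ∀ u v, Relation.EqvGen (fun a b => ∃ e, src e = a ∧ tgt e = b) u v

/-- The slope of `g` at `0` in positive direction, for `g` that is affine with integral slope on
some interval `[0, ε]`. -/
def germSlope (g : ℝ → ℝ) : ℤ :=
  open Classical in
  if h : ∃ m : ℤ, ∀ᶠ t in 𝓝[>] (0 : ℝ), g t = g 0 + m * t then h.choose else 0

theorem germSlope_eq {g : ℝ → ℝ} {m : ℤ} (h : ∀ᶠ t in 𝓝[>] (0 : ℝ), g t = g 0 + m * t) :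
    germSlope g = m := by
  have hex : ∃ m : ℤ, ∀ᶠ t in 𝓝[>] (0 : ℝ), g t = g 0 + m * t := ⟨m, h⟩
  have h2 : germSlope g = hex.choose := by
    unfold germSlope
    rw [dif_pos hex]
  rw [h2]
  have h3 := hex.choose_spec
  obtain ⟨t, ⟨ht1, ht2⟩, ht0⟩ := ((h.and h3).and self_mem_nhdsWithin).exists
  have ht0 : (0 : ℝ) < t := ht0
  have h4 : ((hex.choose : ℤ) : ℝ) * t = (m : ℝ) * t := by linarith
  exact_mod_cast mul_right_cancel₀ ht0.ne' h4

/-- `g` is piecewise affine with integral slopes on `[0, l]`, with break points in a finite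
set `T`. -/
def IsPiecewiseIntegralAffine (l : ℝ) (g : ℝ → ℝ) : Prop :=
  ∃ T : Finset ℝ, ∀ a b : ℝ, 0 ≤ a → a < b → b ≤ l → (∀ t ∈ T, t ∉ Ioo a b) →
    ∃ m : ℤ, ∀ x ∈ Icc a b, g x = g a + m * (x - a)

namespace TropicalCurve

variable {V E : Type*} (Γ : TropicalCurve V E)

/-- The points of the metric graph: vertices, and interior points of edges, given by the distance
from the starting point of the edge. -/
inductive Pt
  | vertex (v : V) : Pt
  | inner (e : E) (t : ℝ) (ht : t ∈ Ioo 0 (Γ.len e)) : Pt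

variable {Γ}

/-- The point lies in the interior of the edge `e`. -/
def Pt.OnEdge (e : E) (p : Γ.Pt) : Prop := ∃ t ht, p = Pt.inner e t ht

/-- The distance of an interior point of an edge from the starting point of that edge
(and `0` for a vertex). -/
def Pt.pos : Γ.Pt → ℝ
  | .vertex _ => 0
  | .inner _ t _ => t

variable (Γ)

/-- The parametrization of the closed edge `e` by `[0, l(e)]`, continued by constants. -/
def edge (e : E) (t : ℝ) : Γ.Pt :=
  if h0 : t ≤ 0 then .vertex (Γ.src e)
  else if h1 : Γ.len e ≤ t then .vertex (Γ.tgt e)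
  else .inner e t ⟨not_le.1 h0, not_le.1 h1⟩

/-- The topology of the metric graph: the quotient topology for the gluing of the closed edges
along the vertices. -/
instance : TopologicalSpace Γ.Pt :=
  ⨆ e : E, TopologicalSpace.coinduced (Γ.edge e) inferInstance

/-- A continuous function whose restriction to every edge is piecewise affine with integral
slopes. -/
def IsRational (f : C(Γ.Pt, ℝ)) : Prop :=
  ∀ e, IsPiecewiseIntegralAffine (Γ.len e) (fun t => f (Γ.edge e t))

/-- The rational functions, with the topology of uniform convergence (the compact-open topology
on the compact space `Γ`). -/
abbrev Rat : Type _ := {f : C(Γ.Pt, ℝ) // Γ.IsRational f}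

/-- Divisors: finite formal integral combinations of points. -/
abbrev Divisor : Type _ := Γ.Pt →₀ ℤ

variable {Γ}

/-- The degree of a divisor. -/
def degree (D : Γ.Divisor) : ℤ := D.sum fun _ a => a

/-- The slope of `f` along the oriented edge `e` at its starting point. -/
def startSlope (f : Γ.Rat) (e : E) : ℤ := germSlope fun t => f.1 (Γ.edge e t)

/-- The outgoing slope of `f` at the end point of `e`, that is, against the direction of `e`. -/
def endSlope (f : Γ.Rat) (e : E) : ℤ := germSlope fun t => f.1 (Γ.edge e (Γ.len e - t))

variable [Fintype E]

open Classical in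
/-- The order of `f` at a point: the sum of the outgoing slopes. -/
def ordAt (f : Γ.Rat) : Γ.Pt → ℤ
  | .vertex v => (∑ e with Γ.src e = v, startSlope f e) + ∑ e with Γ.tgt e = v, endSlope f e
  | .inner e t _ =>
      germSlope (fun s => f.1 (Γ.edge e (t + s))) + germSlope (fun s => f.1 (Γ.edge e (t - s)))

theorem ordAt_inner_eq_zero (f : Γ.Rat) {e : E} {T : Finset ℝ}
    (hT : ∀ a b : ℝ, 0 ≤ a → a < b → b ≤ Γ.len e → (∀ t ∈ T, t ∉ Ioo a b) →
      ∃ m : ℤ, ∀ x ∈ Icc a b, f.1 (Γ.edge e x) = f.1 (Γ.edge e a) + m * (x - a))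
    {t : ℝ} (ht : t ∈ Ioo 0 (Γ.len e)) (htT : t ∉ T) :
    ordAt f (Pt.inner e t ht) = 0 := by
  have hU : Ioo 0 (Γ.len e) ∩ (T : Set ℝ)ᶜ ∈ 𝓝 t :=
    (isOpen_Ioo.inter T.finite_toSet.isClosed.isOpen_compl).mem_nhds ⟨ht, by simpa using htT⟩
  obtain ⟨ε, hε, hball⟩ := Metric.mem_nhds_iff.1 hU
  have hmem : ∀ s, |s - t| < ε → s ∈ Ioo 0 (Γ.len e) ∧ s ∉ T := fun s hs => by
    have := hball (show s ∈ Metric.ball t ε by simpa [Real.dist_eq] using hs)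
    exact ⟨this.1, by simpa using this.2⟩
  have h1 := (hmem (t - ε / 2) (by rw [abs_lt]; constructor <;> linarith)).1
  have h2 := (hmem (t + ε / 2) (by rw [abs_lt]; constructor <;> linarith)).1
  obtain ⟨m, hm⟩ := hT (t - ε / 2) (t + ε / 2) h1.1.le (by linarith) h2.2.le (by
    intro s hs hs'
    exact (hmem s (by rw [abs_lt]; constructor <;> linarith [hs'.1, hs'.2])).2 hs)
  have hmt := hm t ⟨by linarith, by linarith⟩
  have hev : ∀ᶠ s in 𝓝[>] (0 : ℝ), s ∈ Ioo 0 (ε / 2) := Ioo_mem_nhdsGT (by linarith)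
  have e1 : germSlope (fun s => f.1 (Γ.edge e (t + s))) = m := by
    apply germSlope_eq
    filter_upwards [hev] with s hs
    simp only [add_zero]
    rw [hm (t + s) ⟨by linarith [hs.1], by linarith [hs.2]⟩, hmt]
    ring
  have e2 : germSlope (fun s => f.1 (Γ.edge e (t - s))) = -m := by
    apply germSlope_eq
    filter_upwards [hev] with s hs
    simp only [sub_zero]
    rw [hm (t - s) ⟨by linarith [hs.2], by linarith [hs.1]⟩, hmt]
    push_cast
    ring
  simp only [ordAt, e1, e2, add_neg_cancel]

variable [Fintype V]

theorem finite_support_ordAt (f : Γ.Rat) : (Function.support (ordAt f)).Finite := by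
  choose T hT using f.2
  have hfin : (range (Pt.vertex : V → Γ.Pt) ∪ ⋃ e : E, Γ.edge e '' (T e : Set ℝ)).Finite :=
    (finite_range _).union (finite_iUnion fun e => (T e).finite_toSet.image _)
  refine hfin.subset ?_
  rintro (v | ⟨e, t, ht⟩) hp
  · exact Or.inl ⟨v, rfl⟩
  · refine Or.inr (mem_iUnion.2 ⟨e, t, ?_, ?_⟩)
    · by_contra htT
      exact hp (ordAt_inner_eq_zero f (hT e) ht (by simpa using htT))
    · simp [edge, not_le.2 ht.1, not_le.2 ht.2]

/-- The principal divisor `(f)` of a rational function. -/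
def principal (f : Γ.Rat) : Γ.Divisor := Finsupp.ofSupportFinite (ordAt f) (finite_support_ordAt f)

/-- Equivalence of divisors. -/
def LinEquiv (D D' : Γ.Divisor) : Prop := ∃ f : Γ.Rat, D + principal f = D'

/-- The set `R(D)`, with its topology as a space of functions. -/
def R (D : Γ.Divisor) : Set Γ.Rat := {f | 0 ≤ D + principal f}

/-- The set `S(D)`, topologized as a subspace of `Rat(Γ) × Γⁿ`. -/
def S (D : Γ.Divisor) (n : ℕ) : Set (Γ.Rat × (Fin n → Γ.Pt)) :=
  {x | D + principal x.1 = ∑ i, Finsupp.single (x.2 i) 1}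

/-- The linear system `|D|`. -/
def LinearSystem (D : Γ.Divisor) : Type _ := {D' : Γ.Divisor // 0 ≤ D' ∧ LinEquiv D D'}

/-- The map `S(D) → R(D)` that forgets the points. -/
def forget (D : Γ.Divisor) (n : ℕ) (x : S D n) : R D :=
  ⟨x.1.1, by
    have h : D + principal x.1.1 = ∑ i, Finsupp.single (x.1.2 i) 1 := x.2
    change 0 ≤ D + principal x.1.1
    rw [h]
    exact Finset.sum_nonneg fun i _ => Finsupp.single_nonneg.2 zero_le_one⟩

/-- The map `R(D) → |D|`, `f ↦ D + (f)`. -/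
def toDivisor (D : Γ.Divisor) (f : R D) : LinearSystem D :=
  ⟨D + principal f.1, f.2, f.1, rfl⟩

/-- The topology of `|D|` as a quotient of `R(D)`. -/
instance (D : Γ.Divisor) : TopologicalSpace (LinearSystem D) :=
  TopologicalSpace.coinduced (toDivisor D) inferInstance

/-! ### The cells of `S(D)` -/

/-- The discrete data of a cell: the edge or vertex on which every point lies, a total preorder on
the set `P_e` of points on each edge `e` (a total order in which ties, that is coinciding points,
are allowed), and the slope at the starting point of every edge. -/
@[ext]
structure CellDatum (V E : Type*) (n : ℕ) where
  loc : Fin n → V ⊕ E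
  le : Fin n → Fin n → Prop
  slope : E → ℤ
  le_edge : ∀ i j, le i j → ∃ e, loc i = Sum.inr e ∧ loc j = Sum.inr e
  le_total : ∀ i j e, loc i = Sum.inr e → loc j = Sum.inr e → le i j ∨ le j i
  le_trans : ∀ i j k, le i j → le j k → le i k

/-- The coordinates of a cell: values of the function at the vertices, and distances of the
points from the starting points of their edges. -/
abbrev Coord (V : Type*) (n : ℕ) : Type _ := (V → ℝ) × (Fin n → ℝ)

/-- The stratum of `S(D)` with given discrete data. -/
def stratum (D : Γ.Divisor) {n : ℕ} (δ : CellDatum V E n) : Set (S D n) :=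
  {x | (∀ i v, δ.loc i = Sum.inl v ↔ x.1.2 i = Pt.vertex v) ∧
    (∀ i e, δ.loc i = Sum.inr e ↔ (x.1.2 i).OnEdge e) ∧
    (∀ i j, δ.le i j ↔
      ∃ e, (x.1.2 i).OnEdge e ∧ (x.1.2 j).OnEdge e ∧ (x.1.2 i).pos ≤ (x.1.2 j).pos) ∧
    ∀ e, δ.slope e = startSlope x.1.1 e}

namespace CellDatum

variable {n : ℕ} (δ : CellDatum V E n) (D : Γ.Divisor)

/-- No ties: the preorder on every `P_e` is a total order. -/
def IsTotalOrder : Prop := ∀ i j, δ.le i j → δ.le j i → i = j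

open Classical in
/-- The balancing condition. The last sum is over the points in the interior of `e`; it vanishes
if `D` is supported at vertices. -/
def IsBalanced : Prop :=
  ∀ v : V, ((Finset.univ.filter fun i => δ.loc i = Sum.inl v).card : ℤ) =
    D (Pt.vertex v) + ∑ e with Γ.src e = v, δ.slope e +
      ∑ e with Γ.tgt e = v,
        -(((Finset.univ.filter fun i => δ.loc i = Sum.inr e).card : ℤ) + δ.slope e
          - ∑ p ∈ D.support with p.OnEdge e, D p)

open Classical in
/-- Continuity along every edge: the value at the end point is the value at the starting point
plus the total change along the edge. -/
def Continuity (y : Coord V n) : Prop :=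
  ∀ e : E, y.1 (Γ.tgt e) = y.1 (Γ.src e) + δ.slope e * Γ.len e
    + ∑ i with δ.loc i = Sum.inr e, (Γ.len e - y.2 i)
    - ∑ p ∈ D.support with p.OnEdge e, (D p : ℝ) * (Γ.len e - p.pos)

/-- The open cell in coordinates. -/
def openCell : Set (Coord V n) :=
  {y | (∀ i v, δ.loc i = Sum.inl v → y.2 i = 0) ∧
    (∀ i e, δ.loc i = Sum.inr e → 0 < y.2 i ∧ y.2 i < Γ.len e) ∧
    (∀ i j e, δ.loc i = Sum.inr e → δ.loc j = Sum.inr e → (δ.le i j ↔ y.2 i ≤ y.2 j)) ∧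
    δ.Continuity D y}

/-- The closed cell in coordinates. -/
def closedCell : Set (Coord V n) :=
  {y | (∀ i v, δ.loc i = Sum.inl v → y.2 i = 0) ∧
    (∀ i e, δ.loc i = Sum.inr e → 0 ≤ y.2 i ∧ y.2 i ≤ Γ.len e) ∧
    (∀ i j, δ.le i j → y.2 i ≤ y.2 j) ∧
    δ.Continuity D y}

/-- `y` are the coordinates of the point `x` of `S(D)`. -/
def HasCoord {D : Γ.Divisor} (x : S D n) (y : Coord V n) : Prop :=
  (∀ v, x.1.1.1 (Pt.vertex v) = y.1 v) ∧
    (∀ i v, δ.loc i = Sum.inl v → x.1.2 i = Pt.vertex v) ∧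
    ∀ i e, δ.loc i = Sum.inr e → x.1.2 i = Γ.edge e (y.2 i)

/-- The data `δ'` arise from `δ` by a permutation of the labels of the points. -/
def IsPermOf (δ' δ : CellDatum V E n) : Prop :=
  ∃ σ : Equiv.Perm (Fin n), (∀ i, δ'.loc i = δ.loc (σ i)) ∧
    (∀ i j, δ'.le i j ↔ δ.le (σ i) (σ j)) ∧ δ'.slope = δ.slope

end CellDatum

/-- The index set of the cells: balanced data whose inequalities have a solution. -/
abbrev CellIndex (D : Γ.Divisor) (n : ℕ) : Type _ :=
  {δ : CellDatum V E n // δ.IsBalanced D ∧ (δ.openCell D).Nonempty}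

/-- Two cells are identified if they differ by a permutation of the labels. -/
instance cellSetoid (D : Γ.Divisor) (n : ℕ) : Setoid (CellIndex D n) where
  r c c' := c.1.IsPermOf c'.1
  iseqv :=
    { refl := fun c => ⟨1, fun _ => rfl, fun _ _ => Iff.rfl, rfl⟩
      symm := by
        rintro c c' ⟨σ, h1, h2, h3⟩
        exact ⟨σ⁻¹, fun i => by simp [h1], fun i j => by simp [h2], h3.symm⟩
      trans := by
        rintro c c' c'' ⟨σ, h1, h2, h3⟩ ⟨τ, k1, k2, k3⟩
        exact ⟨τ * σ, fun i => by simp [h1, k1], fun i j => by simp [h2, k2], h3.trans k3⟩ }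

end TropicalCurve

end

/-! If `D + (f) = p₁ + ... + pₙ`, then along an edge the slope of `f` rises by one at every `pᵢ` and
falls by `D(p)` at every `p` in the support of `D`. Initial value, initial slope and the positions
of the points therefore determine `f` on the edge by an explicit formula, `edgeFun`. For fixed
discrete data, a point of `S(D)` is thus a vector of vertex values and positions. The formulas on
the edges glue if and only if they give the right values at the far ends, which is linear in the
vector (`continuity_iff`). The glued function then has the required divisor inside the edges
automatically, and at the vertices if and only if the data are balanced (`Represents.divisor_iff`).
Conversely, `represents_datum` recovers every point of `S(D)` in this way. Hence the strata are the
open cells, and the same formula gives charts on the closed cells. At the boundary of a cell, points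
run into vertices or collide. A kink at the start of an edge is absorbed into the initial slope, and
one at the end has no effect (`IsFaceDatum.edgeFun_eq`). So a face of a closed cell is the closed
cell of the limiting data, up to forgetting coordinates (`exists_face_chart`). Ties are broken by
moving coinciding points apart without changing the sum of their positions, the only quantity that
enters the equations. Only the slopes could give infinitely many cells. They are bounded by summing
the balancing condition over a superlevel set of `f` (`abs_slope_le`). The vertex values depend
continuously on `f` and the positions are bounded, so the charts map closed sets to closed sets
(`isClosed_image_of_proper`). As there are finitely many cells, `S(D)` has the glued topology, and
`forget` is a closed map, hence a quotient map. For the descent, two families of points with the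
same sum differ by a permutation. Inside one cell the order of the points is fixed, so `f` alone
determines the coordinates (`coord_eq_of_represents`). Functions with the same divisor differ on
every edge by an affine function; the slopes of the difference form a flow that is also a gradient,
so its energy vanishes and the difference is constant. The cells of `|D|` are the slices `f(v₀) = 0`
of the cells of `R(D)`. The formal part is `IsPolyhedralComplex.descend`. -/

/-! ### Germs of piecewise affine functions -/

/-- `g` is affine with slope `m` on some interval `[0, ε]`. -/
def HasGerm (g : ℝ → ℝ) (m : ℤ) : Prop := ∀ᶠ t in 𝓝[>] (0 : ℝ), g t = g 0 + m * t

namespace HasGerm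

variable {g h : ℝ → ℝ} {m k : ℤ}

theorem eq (hg : HasGerm g m) : germSlope g = m := germSlope_eq hg

theorem unique (hg : HasGerm g m) (hg' : HasGerm g k) : m = k := hg.eq.symm.trans hg'.eq

theorem congr (hg : HasGerm g m) (h0 : h 0 = g 0) (he : ∀ᶠ t in 𝓝[>] (0 : ℝ), h t = g t) :
    HasGerm h m := by
  filter_upwards [hg, he] with t h1 h2
  rw [h2, h0, h1]

theorem add (hg : HasGerm g m) (hh : HasGerm h k) : HasGerm (fun t => g t + h t) (m + k) := by
  filter_upwards [hg, hh] with t h1 h2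
  rw [h1, h2]; push_cast; ring

theorem sub (hg : HasGerm g m) (hh : HasGerm h k) : HasGerm (fun t => g t - h t) (m - k) := by
  filter_upwards [hg, hh] with t h1 h2
  rw [h1, h2]; push_cast; ring

theorem intCast_mul (hg : HasGerm g m) (c : ℤ) : HasGerm (fun t => c * g t) (c * m) := by
  filter_upwards [hg] with t h1
  rw [h1]; push_cast; ring

theorem sum {ι : Type*} (s : Finset ι) {g : ι → ℝ → ℝ} {m : ι → ℤ}
    (h : ∀ i ∈ s, HasGerm (g i) (m i)) : HasGerm (fun t => ∑ i ∈ s, g i t) (∑ i ∈ s, m i) := by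
  filter_upwards [(Finset.eventually_all s).2 h] with t ht
  rw [Finset.sum_congr rfl ht, Finset.sum_add_distrib]
  push_cast
  rw [Finset.sum_mul]

end HasGerm

theorem hasGerm_affine_add (a : ℝ) (m : ℤ) (t : ℝ) : HasGerm (fun s => a + m * (t + s)) m := by
  filter_upwards with s
  ring

theorem hasGerm_affine_sub (a : ℝ) (m : ℤ) (t : ℝ) : HasGerm (fun s => a + m * (t - s)) (-m) := by
  filter_upwards with s
  push_cast; ring

/-- A kink at `x = t` counts for the slope to the right of `t` but not for the slope to the left
(`hasGerm_kink_sub`). This difference is the contribution of a point at `t` to the order there. -/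
theorem hasGerm_kink_add (x t : ℝ) :
    HasGerm (fun s => max 0 (t + s - x)) (if x ≤ t then 1 else 0) := by
  split_ifs with h
  · filter_upwards [self_mem_nhdsWithin] with s hs
    have hs : (0 : ℝ) < s := hs
    rw [max_eq_right (by linarith), max_eq_right (by linarith)]
    push_cast; ring
  · filter_upwards [Ioo_mem_nhdsGT (sub_pos.2 (not_le.1 h))] with s hs
    rw [max_eq_left (by linarith [hs.2]), max_eq_left (by linarith [not_le.1 h])]
    simp

theorem hasGerm_kink_sub (x t : ℝ) :
    HasGerm (fun s => max 0 (t - s - x)) (-(if x < t then 1 else 0)) := by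
  split_ifs with h
  · filter_upwards [Ioo_mem_nhdsGT (sub_pos.2 h)] with s hs
    rw [max_eq_right (by linarith [hs.2]), max_eq_right (by linarith)]
    push_cast; ring
  · filter_upwards [self_mem_nhdsWithin] with s hs
    have hs : (0 : ℝ) < s := hs
    rw [max_eq_left (by linarith [not_lt.1 h]), max_eq_left (by linarith [not_lt.1 h])]
    simp

/-! ### Piecewise affine functions -/

namespace IsPiecewiseIntegralAffine

variable {l : ℝ} {g h : ℝ → ℝ}

theorem congr (hg : IsPiecewiseIntegralAffine l g) (he : ∀ t ∈ Icc 0 l, h t = g t) :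
    IsPiecewiseIntegralAffine l h := by
  obtain ⟨T, hT⟩ := hg
  refine ⟨T, fun a b ha hab hb hd => ?_⟩
  obtain ⟨m, hm⟩ := hT a b ha hab hb hd
  refine ⟨m, fun x hx => ?_⟩
  rw [he x ⟨ha.trans hx.1, hx.2.trans hb⟩, he a ⟨ha, hab.le.trans hb⟩, hm x hx]

theorem add (hg : IsPiecewiseIntegralAffine l g) (hh : IsPiecewiseIntegralAffine l h) :
    IsPiecewiseIntegralAffine l (fun t => g t + h t) := by
  classical
  obtain ⟨T, hT⟩ := hg
  obtain ⟨U, hU⟩ := hh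
  refine ⟨T ∪ U, fun a b ha hab hb hd => ?_⟩
  obtain ⟨m, hm⟩ := hT a b ha hab hb fun t ht => hd t (Finset.mem_union_left _ ht)
  obtain ⟨k, hk⟩ := hU a b ha hab hb fun t ht => hd t (Finset.mem_union_right _ ht)
  refine ⟨m + k, fun x hx => ?_⟩
  simp only [hm x hx, hk x hx]
  push_cast; ring

theorem intCast_mul (hg : IsPiecewiseIntegralAffine l g) (c : ℤ) :
    IsPiecewiseIntegralAffine l (fun t => c * g t) := by
  obtain ⟨T, hT⟩ := hg
  refine ⟨T, fun a b ha hab hb hd => ?_⟩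
  obtain ⟨m, hm⟩ := hT a b ha hab hb hd
  refine ⟨c * m, fun x hx => ?_⟩
  simp only [hm x hx]
  push_cast; ring

theorem affine (l a : ℝ) (m : ℤ) : IsPiecewiseIntegralAffine l (fun t => a + m * t) :=
  ⟨∅, fun _ _ _ _ _ _ => ⟨m, fun _ _ => by ring⟩⟩

theorem sum {ι : Type*} (s : Finset ι) {g : ι → ℝ → ℝ}
    (h : ∀ i ∈ s, IsPiecewiseIntegralAffine l (g i)) :
    IsPiecewiseIntegralAffine l (fun t => ∑ i ∈ s, g i t) := by
  classical
  induction s using Finset.induction_on with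
  | empty => simpa using affine l 0 0
  | insert a s ha ih =>
    simp only [Finset.sum_insert ha]
    exact (h a (Finset.mem_insert_self a s)).add
      (ih fun i hi => h i (Finset.mem_insert_of_mem hi))

theorem kink (l x : ℝ) : IsPiecewiseIntegralAffine l (fun t => max 0 (t - x)) := by
  refine ⟨{x}, fun a b _ _ _ hd => ?_⟩
  have hd : ¬ (a < x ∧ x < b) := fun h => hd x (by simp) h
  rcases le_or_gt x a with h | h
  · refine ⟨1, fun t ht => ?_⟩
    beta_reduce
    rw [max_eq_right (by linarith [ht.1]), max_eq_right (by linarith)]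
    push_cast; ring
  · have hb : b ≤ x := not_lt.1 fun h' => hd ⟨h, h'⟩
    refine ⟨0, fun t ht => ?_⟩
    beta_reduce
    rw [max_eq_left (by linarith [ht.2]), max_eq_left (by linarith)]
    simp

theorem exists_hasGerm_add (hg : IsPiecewiseIntegralAffine l g) {t : ℝ} (ht : t ∈ Ico 0 l) :
    ∃ m, HasGerm (fun s => g (t + s)) m := by
  obtain ⟨T, hT⟩ := hg
  have h1 : ∀ᶠ b in 𝓝[>] t, ∀ s ∈ T, s ∉ Ioo t b := by
    refine (Finset.eventually_all T).2 fun s _ => ?_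
    rcases le_or_gt s t with h | h
    · exact Eventually.of_forall fun b hb => hb.1.not_ge h
    · filter_upwards [Ioo_mem_nhdsGT h] with b hb hs
      exact lt_asymm hb.2 hs.2
  obtain ⟨b, hb, hb'⟩ := (h1.and (Ioo_mem_nhdsGT ht.2)).exists
  obtain ⟨m, hm⟩ := hT t b ht.1 hb'.1 hb'.2.le hb
  refine ⟨m, ?_⟩
  filter_upwards [Ioo_mem_nhdsGT (sub_pos.2 hb'.1)] with s hs
  rw [hm (t + s) ⟨by linarith [hs.1], by linarith [hs.2]⟩]
  simp

theorem exists_hasGerm_sub (hg : IsPiecewiseIntegralAffine l g) {t : ℝ} (ht : t ∈ Ioc 0 l) :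
    ∃ m, HasGerm (fun s => g (t - s)) m := by
  obtain ⟨T, hT⟩ := hg
  have h1 : ∀ᶠ b in 𝓝[<] t, ∀ s ∈ T, s ∉ Ioo b t := by
    refine (Finset.eventually_all T).2 fun s _ => ?_
    rcases le_or_gt t s with h | h
    · exact Eventually.of_forall fun b hb => hb.2.not_ge h
    · filter_upwards [Ioo_mem_nhdsLT h] with b hb hs
      exact lt_asymm hb.1 hs.1
  obtain ⟨b, hb, hb'⟩ := (h1.and (Ioo_mem_nhdsLT ht.1)).exists
  obtain ⟨m, hm⟩ := hT b t hb'.1.le hb'.2 ht.2 hb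
  refine ⟨-m, ?_⟩
  filter_upwards [Ioo_mem_nhdsGT (sub_pos.2 hb'.2)] with s hs
  have h2 := hm t ⟨hb'.2.le, le_rfl⟩
  have h3 := hm (t - s) ⟨by linarith [hs.2], by linarith [hs.1]⟩
  simp only [sub_zero, h3, h2]
  push_cast; ring

end IsPiecewiseIntegralAffine

/-- A continuous function on `[0, l]` without kinks and with vanishing initial slope is constant. -/
theorem eq_of_hasGerm_zero {l : ℝ} {h : ℝ → ℝ} (hc : ContinuousOn h (Icc 0 l))
    (h0 : HasGerm h 0)
    (hi : ∀ t ∈ Ioo 0 l, ∃ m, HasGerm (fun s => h (t + s)) m ∧ HasGerm (fun s => h (t - s)) (-m)) :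
    ∀ t ∈ Icc 0 l, h t = h 0 := by
  -- The parameters up to which `h` is constant form a closed set by continuity. It remains to see
  -- that they can always be increased a little.
  let s : Set ℝ := {t | ∀ u ∈ Icc 0 t, h u = h 0}
  suffices Icc 0 l ⊆ s from fun t ht => this ht t ⟨ht.1, le_rfl⟩
  refine IsClosed.Icc_subset_of_forall_mem_nhdsWithin ?_ ?_ ?_
  · have hE : s ∩ Icc 0 l = {t ∈ Icc 0 l | ∀ u ∈ Ico 0 t, h u = h 0} := by
      ext t
      constructor
      · rintro ⟨h1, h2⟩
        exact ⟨h2, fun u hu => h1 u ⟨hu.1, hu.2.le⟩⟩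
      · rintro ⟨h1, h2⟩
        refine ⟨fun u hu => ?_, h1⟩
        rcases hu.2.lt_or_eq with h | rfl
        · exact h2 u ⟨hu.1, h⟩
        · rcases h1.1.eq_or_lt with rfl | h3
          · rfl
          have h4 : Tendsto h (𝓝[Ico 0 u] u) (𝓝 (h u)) :=
            ((hc u h1).mono fun v hv => ⟨hv.1, hv.2.le.trans h1.2⟩)
          have h5 : Tendsto h (𝓝[Ico 0 u] u) (𝓝 (h 0)) :=
            tendsto_const_nhds.congr' (by
              filter_upwards [self_mem_nhdsWithin] with v hv using (h2 v hv).symm)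
          have : (𝓝[Ico 0 u] u).NeBot := by
            rw [← mem_closure_iff_nhdsWithin_neBot, closure_Ico h3.ne]
            exact ⟨h3.le, le_rfl⟩
          exact tendsto_nhds_unique h4 h5
    rw [hE]
    have : {t ∈ Icc 0 l | ∀ u ∈ Ico 0 t, h u = h 0}
        = Icc 0 l ∩ ⋂ u ∈ {u | 0 ≤ u ∧ h u ≠ h 0}, Iic u := by
      ext t
      simp only [mem_ofPred_eq, mem_inter_iff, mem_iInter, mem_Iic, and_congr_right_iff, mem_Ico]
      intro _
      constructor
      · intro h1 u hu
        by_contra h2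
        exact hu.2 (h1 u ⟨hu.1, not_le.1 h2⟩)
      · intro h1 u hu
        by_contra h2
        exact (h1 u ⟨hu.1, h2⟩).not_gt hu.2
    rw [this]
    exact isClosed_Icc.inter (isClosed_biInter fun _ _ => isClosed_Iic)
  · intro u hu
    rw [le_antisymm hu.2 hu.1]
  · rintro x ⟨hx, hx'⟩
    have key : HasGerm (fun s => h (x + s)) 0 := by
      rcases hx'.1.eq_or_lt with rfl | hx0
      · simpa using h0
      obtain ⟨m, h1, h2⟩ := hi x ⟨hx0, hx'.2⟩
      -- To the left of `x` the function is already constant, and the absence of a kink carries the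
      -- slope zero to the right.
      have h3 : HasGerm (fun s => h (x - s)) 0 := by
        filter_upwards [Ioo_mem_nhdsGT hx0] with s hs
        simp only [sub_zero]
        rw [hx (x - s) ⟨by linarith [hs.2], by linarith [hs.1]⟩, hx x ⟨hx0.le, le_rfl⟩]
        simp
      have := h2.unique h3
      rwa [neg_eq_zero.1 this] at h1
    obtain ⟨ε, hε, hs⟩ := mem_nhdsGT_iff_exists_Ioo_subset.1 key
    have hε : (0 : ℝ) < ε := hε
    filter_upwards [Ioo_mem_nhdsGT (show x < x + ε by linarith)] with t ht u hu
    rcases le_or_gt u x with h1 | h1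
    · exact hx u ⟨hu.1, h1⟩
    · have := hs (show u - x ∈ Ioo 0 ε from ⟨by linarith, by linarith [hu.2, ht.2]⟩)
      simp only [mem_ofPred_eq, add_sub_cancel, add_zero] at this
      rw [this, hx x ⟨hx'.1, le_rfl⟩]
      simp

/-! ### The metric graph -/

namespace TropicalCurve

variable {V E : Type*} {Γ : TropicalCurve V E}

theorem edge_of_le_zero {e : E} {t : ℝ} (h : t ≤ 0) : Γ.edge e t = .vertex (Γ.src e) := by
  simp [edge, h]

theorem edge_of_len_le {e : E} {t : ℝ} (h : Γ.len e ≤ t) : Γ.edge e t = .vertex (Γ.tgt e) := by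
  simp [edge, h, not_le.2 ((Γ.len_pos e).trans_le h)]

theorem edge_zero (e : E) : Γ.edge e 0 = .vertex (Γ.src e) := edge_of_le_zero le_rfl

theorem edge_len (e : E) : Γ.edge e (Γ.len e) = .vertex (Γ.tgt e) := edge_of_len_le le_rfl

theorem edge_of_mem {e : E} {t : ℝ} (h : t ∈ Ioo 0 (Γ.len e)) : Γ.edge e t = .inner e t h := by
  simp [edge, not_le.2 h.1, not_le.2 h.2]

/-- Restriction of a parameter to the interval `[0, l(e)]`. -/
noncomputable def clamp (Γ : TropicalCurve V E) (e : E) (t : ℝ) : ℝ := max 0 (min t (Γ.len e))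

theorem continuous_clamp (e : E) : Continuous (Γ.clamp e) := by unfold clamp; fun_prop

theorem clamp_mem (e : E) (t : ℝ) : Γ.clamp e t ∈ Icc 0 (Γ.len e) :=
  ⟨le_max_left _ _, max_le (Γ.len_pos e).le (min_le_right _ _)⟩

theorem clamp_of_mem {e : E} {t : ℝ} (h : t ∈ Icc 0 (Γ.len e)) : Γ.clamp e t = t := by
  rw [clamp, min_eq_left h.2, max_eq_right h.1]

theorem edge_clamp (e : E) (t : ℝ) : Γ.edge e (Γ.clamp e t) = Γ.edge e t := by
  rcases le_or_gt t 0 with h | h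
  · rw [edge_of_le_zero h, clamp, min_eq_left (h.trans (Γ.len_pos e).le), max_eq_left h, edge_zero]
  · rcases le_or_gt (Γ.len e) t with h' | h'
    · rw [edge_of_len_le h', clamp, min_eq_right h', max_eq_right (Γ.len_pos e).le, edge_len]
    · rw [clamp_of_mem ⟨h.le, h'.le⟩]

theorem continuous_edge (e : E) : Continuous (Γ.edge e) :=
  continuous_iff_coinduced_le.2 (le_iSup (fun e => TopologicalSpace.coinduced (Γ.edge e) _) e)

theorem continuous_iff_edge {X : Type*} [TopologicalSpace X] {f : Γ.Pt → X} :
    Continuous f ↔ ∀ e, Continuous fun t => f (Γ.edge e t) := by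
  refine ⟨fun h e => h.comp (continuous_edge e), fun h => ?_⟩
  exact continuous_iSup_dom.2 fun e => continuous_coinduced_dom.2 (h e)

theorem Pt.onEdge_vertex {e : E} {v : V} : ¬ (Pt.vertex v : Γ.Pt).OnEdge e := by
  rintro ⟨t, ht, h⟩
  cases h

theorem Pt.onEdge_inner {e e' : E} {t : ℝ} {ht : t ∈ Ioo 0 (Γ.len e')} :
    (Pt.inner e' t ht : Γ.Pt).OnEdge e ↔ e' = e := by
  constructor
  · rintro ⟨s, hs, h⟩
    cases h
    rfl
  · rintro rfl
    exact ⟨t, ht, rfl⟩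

theorem Pt.OnEdge.pos_mem {e : E} {p : Γ.Pt} (h : p.OnEdge e) : p.pos ∈ Ioo 0 (Γ.len e) := by
  obtain ⟨t, ht, rfl⟩ := h
  exact ht

theorem Pt.OnEdge.edge_pos {e : E} {p : Γ.Pt} (h : p.OnEdge e) : Γ.edge e p.pos = p := by
  obtain ⟨t, ht, rfl⟩ := h
  exact edge_of_mem ht

theorem Pt.OnEdge.unique {e e' : E} {p : Γ.Pt} (h : p.OnEdge e) (h' : p.OnEdge e') : e = e' := by
  obtain ⟨t, ht, rfl⟩ := h
  exact Pt.onEdge_inner.1 h'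

theorem Pt.inner_inj {e e' : E} {t t' : ℝ} {ht : t ∈ Ioo 0 (Γ.len e)}
    {ht' : t' ∈ Ioo 0 (Γ.len e')} :
    (Pt.inner e t ht : Γ.Pt) = .inner e' t' ht' ↔ e = e' ∧ t = t' := by
  constructor
  · intro h
    cases h
    exact ⟨rfl, rfl⟩
  · rintro ⟨rfl, rfl⟩
    rfl

/-- A function on the metric graph, given on the vertices and on the edges. -/
def glue (a : V → ℝ) (g : E → ℝ → ℝ) : Γ.Pt → ℝ
  | .vertex v => a v
  | .inner e t _ => g e t

theorem glue_edge {a : V → ℝ} {g : E → ℝ → ℝ} (h0 : ∀ e, g e 0 = a (Γ.src e))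
    (h1 : ∀ e, g e (Γ.len e) = a (Γ.tgt e)) (e : E) {t : ℝ} (ht : t ∈ Icc 0 (Γ.len e)) :
    glue a g (Γ.edge e t) = g e t := by
  rcases ht.1.eq_or_lt with rfl | h
  · rw [edge_zero, h0]; rfl
  · rcases ht.2.eq_or_lt with rfl | h'
    · rw [edge_len, h1]; rfl
    · rw [edge_of_mem ⟨h, h'⟩]; rfl

theorem continuous_glue {a : V → ℝ} {g : E → ℝ → ℝ} (h0 : ∀ e, g e 0 = a (Γ.src e))
    (h1 : ∀ e, g e (Γ.len e) = a (Γ.tgt e)) (hg : ∀ e, Continuous (g e)) :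
    Continuous (glue a g : Γ.Pt → ℝ) := by
  refine continuous_iff_edge.2 fun e => ?_
  -- Beyond the ends `edge` is constant while `g e` is arbitrary, so the parameter has to be
  -- clamped.
  have : (fun t => glue a g (Γ.edge e t)) = fun t => g e (Γ.clamp e t) := by
    funext t
    rw [← edge_clamp, glue_edge h0 h1 e (clamp_mem e t)]
  rw [this]
  exact (hg e).comp (continuous_clamp e)

instance [Finite V] [Finite E] : CompactSpace Γ.Pt := by
  have : (univ : Set Γ.Pt) =
      range (Pt.vertex : V → Γ.Pt) ∪ ⋃ e, Γ.edge e '' Icc 0 (Γ.len e) := by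
    refine (eq_univ_of_forall ?_).symm
    rintro (v | ⟨e, t, ht⟩)
    · exact Or.inl ⟨v, rfl⟩
    · exact Or.inr (mem_iUnion.2 ⟨e, t, ⟨ht.1.le, ht.2.le⟩, edge_of_mem ht⟩)
  refine ⟨this ▸ ?_⟩
  exact (finite_range _).isCompact.union
    (isCompact_iUnion fun e => isCompact_Icc.image (continuous_edge e))

/-- Continuous functions separate points: `u v` is affine on edges and the indicator of `v` on
vertices, `b e` is non-zero exactly inside `e`, and there the quotient of `c e` by `b e` is the
coordinate. -/
instance : T2Space Γ.Pt := by
  classical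
  let u : V → Γ.Pt → ℝ := fun v => glue (fun w => if w = v then 1 else 0) fun e t =>
    (1 - t / Γ.len e) * (if Γ.src e = v then 1 else 0) +
      t / Γ.len e * (if Γ.tgt e = v then 1 else 0)
  let b : E → Γ.Pt → ℝ := fun e => glue (fun _ => 0) fun e' t =>
    if e' = e then t * (Γ.len e - t) else 0
  let c : E → Γ.Pt → ℝ := fun e => glue (fun _ => 0) fun e' t =>
    if e' = e then t * (t * (Γ.len e - t)) else 0
  have hl : ∀ e, Γ.len e ≠ 0 := fun e => (Γ.len_pos e).ne'
  have hu : ∀ v, Continuous (u v) := fun v =>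
    continuous_glue (fun e => by simp) (fun e => by simp [hl]) (fun e => by fun_prop)
  have hb : ∀ e, Continuous (b e) := fun e =>
    continuous_glue (fun e' => by simp) (fun e' => by
      by_cases h : e' = e <;> simp [h])
      (fun e' => by by_cases h : e' = e <;> simp only [h, if_true, if_false] <;> fun_prop)
  have hc : ∀ e, Continuous (c e) := fun e =>
    continuous_glue (fun e' => by simp) (fun e' => by
      by_cases h : e' = e <;> simp [h])
      (fun e' => by by_cases h : e' = e <;> simp only [h, if_true, if_false] <;> fun_prop)
  refine T2Space.of_injective_continuous
    (f := fun p : Γ.Pt => ((fun v => u v p), (fun e => b e p), fun e => c e p)) ?_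
    ((continuous_pi hu).prodMk ((continuous_pi hb).prodMk (continuous_pi hc)))
  intro p q hpq
  simp only [Prod.mk.injEq, funext_iff] at hpq
  obtain ⟨h1, h2, h3⟩ := hpq
  have hpos : ∀ {e t}, t ∈ Ioo 0 (Γ.len e) → t * (Γ.len e - t) ≠ 0 := fun ht =>
    (mul_pos ht.1 (sub_pos.2 ht.2)).ne'
  rcases p with v | ⟨e, t, ht⟩ <;> rcases q with w | ⟨e', t', ht'⟩
  · have := h1 v
    simp only [u, glue, if_true] at this
    by_cases h : w = v
    · rw [h]
    · simp [h] at this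
  · exact absurd (h2 e').symm (by simpa [b, glue] using hpos ht')
  · exact absurd (h2 e) (by simpa [b, glue] using hpos ht)
  · by_cases h : e' = e
    · subst h
      have h4 := h2 e'
      have h5 := h3 e'
      simp only [b, c, glue, if_true] at h4 h5
      rw [← h4] at h5
      exact Pt.inner_inj.2 ⟨rfl, mul_right_cancel₀ (hpos ht) h5⟩
    · exact absurd (h2 e) (by simpa [b, glue, h] using hpos ht)

end TropicalCurve

namespace TropicalCurve

variable {V E : Type*} {Γ : TropicalCurve V E} {n : ℕ}

/-! ### Functions with prescribed kinks -/

namespace CellDatum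

open Classical in
/-- The function on the edge `e` with the initial value and the initial slope given by the cell,
and with kinks at the points on the edge and at the support of `D`. -/
noncomputable def edgeFun (δ : CellDatum V E n) (D : Γ.Divisor) (y : Coord V n) (e : E) (t : ℝ) :
    ℝ :=
  y.1 (Γ.src e) + δ.slope e * t + ∑ i with δ.loc i = Sum.inr e, max 0 (t - y.2 i)
    - ∑ p ∈ D.support with p.OnEdge e, (D p : ℝ) * max 0 (t - p.pos)

/-- The points on the metric graph with given coordinates. -/
noncomputable def point (Γ : TropicalCurve V E) (δ : CellDatum V E n) (y : Coord V n) (i : Fin n) :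
    Γ.Pt :=
  match δ.loc i with
  | .inl v => .vertex v
  | .inr e => Γ.edge e (y.2 i)

variable {δ : CellDatum V E n} {D : Γ.Divisor} {y : Coord V n}

theorem point_of_inl {i : Fin n} {v : V} (h : δ.loc i = .inl v) : δ.point Γ y i = .vertex v := by
  simp [point, h]

theorem point_of_inr {i : Fin n} {e : E} (h : δ.loc i = .inr e) :
    δ.point Γ y i = Γ.edge e (y.2 i) := by
  simp [point, h]

/-- All coordinates of points on edges lie in the closed edges. -/
def InEdges (Γ : TropicalCurve V E) (δ : CellDatum V E n) (y : Coord V n) : Prop :=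
  ∀ i e, δ.loc i = Sum.inr e → y.2 i ∈ Icc 0 (Γ.len e)

theorem continuous_edgeFun (e : E) : Continuous (δ.edgeFun D y e) := by
  unfold edgeFun
  fun_prop

theorem isPiecewiseIntegralAffine_edgeFun (l : ℝ) (e : E) :
    IsPiecewiseIntegralAffine l (δ.edgeFun D y e) := by
  classical
  have h := ((IsPiecewiseIntegralAffine.affine l (y.1 (Γ.src e)) (δ.slope e)).add
    (.sum (Finset.univ.filter fun i => δ.loc i = Sum.inr e) fun i _ => .kink l (y.2 i))).add
    ((IsPiecewiseIntegralAffine.sum (D.support.filter fun p => p.OnEdge e)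
      fun p _ => (IsPiecewiseIntegralAffine.kink l p.pos).intCast_mul (D p)).intCast_mul (-1))
  refine h.congr fun t _ => ?_
  rw [edgeFun]
  push_cast
  ring_nf

open Classical in
theorem hasGerm_edgeFun_add (e : E) (t : ℝ) :
    HasGerm (fun s => δ.edgeFun D y e (t + s))
      (δ.slope e + ∑ i with δ.loc i = Sum.inr e, (if y.2 i ≤ t then 1 else 0)
        - ∑ p ∈ D.support with p.OnEdge e, D p * (if p.pos ≤ t then 1 else 0)) :=
  ((hasGerm_affine_add _ _ _).add (.sum _ fun i _ => hasGerm_kink_add (y.2 i) t)).sub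
    (.sum _ fun p _ => (hasGerm_kink_add p.pos t).intCast_mul (D p))

open Classical in
theorem hasGerm_edgeFun_sub (e : E) (t : ℝ) :
    HasGerm (fun s => δ.edgeFun D y e (t - s))
      (-(δ.slope e + ∑ i with δ.loc i = Sum.inr e, (if y.2 i < t then 1 else 0)
        - ∑ p ∈ D.support with p.OnEdge e, D p * (if p.pos < t then 1 else 0))) := by
  have h := ((hasGerm_affine_sub (y.1 (Γ.src e)) (δ.slope e) t).add
    (.sum (Finset.univ.filter fun i => δ.loc i = Sum.inr e)
      fun i _ => hasGerm_kink_sub (y.2 i) t)).sub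
    (.sum (D.support.filter fun p => p.OnEdge e)
      fun p _ => (hasGerm_kink_sub p.pos t).intCast_mul (D p))
  refine (congrArg (HasGerm _) ?_).mp h
  simp only [Finset.sum_neg_distrib, mul_neg]
  ring

theorem edgeFun_zero (hy : δ.InEdges Γ y) (e : E) : δ.edgeFun D y e 0 = y.1 (Γ.src e) := by
  classical
  rw [edgeFun, Finset.sum_eq_zero, Finset.sum_eq_zero]
  · simp
  · intro p hp
    rw [max_eq_left, mul_zero]
    linarith [(Finset.mem_filter.1 hp).2.pos_mem.1]
  · intro i hi
    exact max_eq_left (by linarith [(hy i e (Finset.mem_filter.1 hi).2).1])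

theorem edgeFun_len (hy : δ.InEdges Γ y) (e : E) :
    δ.edgeFun D y e (Γ.len e) = y.1 (Γ.tgt e) ↔
      y.1 (Γ.tgt e) = y.1 (Γ.src e) + δ.slope e * Γ.len e
        + (∑ i ∈ (by classical exact Finset.univ.filter fun i => δ.loc i = Sum.inr e),
            (Γ.len e - y.2 i))
        - ∑ p ∈ (by classical exact D.support.filter fun p => p.OnEdge e),
            (D p : ℝ) * (Γ.len e - p.pos) := by
  classical
  rw [eq_comm, edgeFun]
  refine Eq.congr rfl (congrArg₂ _ (congrArg₂ _ rfl ?_) ?_)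
  · exact Finset.sum_congr rfl fun i hi =>
      max_eq_right (by linarith [(hy i e (Finset.mem_filter.1 hi).2).2])
  · refine Finset.sum_congr rfl fun p hp => ?_
    rw [max_eq_right]
    linarith [(Finset.mem_filter.1 hp).2.pos_mem.2]

/-- All maxima in `edgeFun` are attained by the linear terms at the far end of the edge, so the
continuity equation is the gluing condition there. -/
theorem continuity_iff (hy : δ.InEdges Γ y) :
    δ.Continuity D y ↔ ∀ e, δ.edgeFun D y e (Γ.len e) = y.1 (Γ.tgt e) := by
  classical
  refine forall_congr' fun e => ?_
  rw [edgeFun_len hy]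

/-- The function `f` is given by the coordinates `y` of a cell. -/
def Represents (δ : CellDatum V E n) (D : Γ.Divisor) (f : Γ.Rat) (y : Coord V n) : Prop :=
  (∀ v, f.1 (.vertex v) = y.1 v) ∧
    ∀ e, ∀ t ∈ Icc 0 (Γ.len e), f.1 (Γ.edge e t) = δ.edgeFun D y e t

theorem _root_.TropicalCurve.Rat.ext_edge {f g : Γ.Rat}
    (h : ∀ v, f.1 (.vertex v) = g.1 (.vertex v))
    (h' : ∀ e, ∀ t ∈ Icc 0 (Γ.len e), f.1 (Γ.edge e t) = g.1 (Γ.edge e t)) : f = g := by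
  refine Subtype.ext (ContinuousMap.ext ?_)
  rintro (v | ⟨e, t, ht⟩)
  · exact h v
  · rw [← edge_of_mem ht]
    exact h' e t ⟨ht.1.le, ht.2.le⟩

theorem Represents.unique {f g : Γ.Rat} (hf : δ.Represents D f y) (hg : δ.Represents D g y) :
    f = g :=
  Rat.ext_edge (fun v => (hf.1 v).trans (hg.1 v).symm)
    fun e t ht => (hf.2 e t ht).trans (hg.2 e t ht).symm

/-- The formulas on the edges have the right values at the start because no kink lies before `0`,
and at the end by `Continuity`; so they glue. -/
theorem exists_represents (hy : δ.InEdges Γ y) (hc : δ.Continuity D y) :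
    ∃ f : Γ.Rat, δ.Represents D f y := by
  have h0 : ∀ e, δ.edgeFun D y e 0 = y.1 (Γ.src e) := edgeFun_zero hy
  have h1 := (continuity_iff hy).1 hc
  refine ⟨⟨⟨glue y.1 (δ.edgeFun D y), continuous_glue h0 h1 fun e => continuous_edgeFun e⟩,
    fun e => ?_⟩, fun v => rfl, fun e t ht => glue_edge h0 h1 e ht⟩
  exact (isPiecewiseIntegralAffine_edgeFun _ e).congr fun t ht => glue_edge h0 h1 e ht

variable {f : Γ.Rat}

-- On the boundary of a cell the actual slope differs from the datum: points that have reached the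
-- start of the edge have already bent the function. The support of `D` inside the edge stays away
-- from both ends.
open Classical in
theorem Represents.startSlope_eq (h : δ.Represents D f y) (e : E) :
    startSlope f e = δ.slope e + ∑ i with δ.loc i = Sum.inr e, (if y.2 i ≤ 0 then 1 else 0) := by
  refine HasGerm.eq ?_
  have h1 := hasGerm_edgeFun_add (δ := δ) (D := D) (y := y) e 0
  rw [Finset.sum_eq_zero (s := D.support.filter _), sub_zero] at h1
  · refine h1.congr ?_ ?_
    · simp only [add_zero]
      exact h.2 e 0 ⟨le_rfl, (Γ.len_pos e).le⟩
    · filter_upwards [Ioo_mem_nhdsGT (Γ.len_pos e)] with t ht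
      rw [zero_add, h.2 e t ⟨ht.1.le, ht.2.le⟩]
  · intro p hp
    rw [if_neg, mul_zero]
    exact not_le.2 (Finset.mem_filter.1 hp).2.pos_mem.1

open Classical in
theorem Represents.endSlope_eq (h : δ.Represents D f y) (e : E) :
    endSlope f e = -(δ.slope e
      + ∑ i with δ.loc i = Sum.inr e, (if y.2 i < Γ.len e then 1 else 0)
      - ∑ p ∈ D.support with p.OnEdge e, D p) := by
  refine HasGerm.eq ?_
  have h1 := hasGerm_edgeFun_sub (δ := δ) (D := D) (y := y) e (Γ.len e)
  rw [Finset.sum_congr (s₁ := D.support.filter _) rfl (g := fun p => D p)] at h1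
  · refine h1.congr ?_ ?_
    · simp only [sub_zero]
      exact h.2 e _ ⟨(Γ.len_pos e).le, le_rfl⟩
    · filter_upwards [Ioo_mem_nhdsGT (Γ.len_pos e)] with t ht
      rw [h.2 e _ ⟨by linarith [ht.2], by linarith [ht.1]⟩]
  · intro p hp
    rw [if_pos, mul_one]
    exact (Finset.mem_filter.1 hp).2.pos_mem.2

theorem hasGerm_edge_add {f : Γ.Rat} (h : δ.Represents D f y) {e : E} {t : ℝ}
    (ht : t ∈ Ioo 0 (Γ.len e)) {m : ℤ} (hm : HasGerm (fun s => δ.edgeFun D y e (t + s)) m) :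
    HasGerm (fun s => f.1 (Γ.edge e (t + s))) m := by
  refine hm.congr ?_ ?_
  · simp only [add_zero]
    exact h.2 e t ⟨ht.1.le, ht.2.le⟩
  · filter_upwards [Ioo_mem_nhdsGT (sub_pos.2 ht.2)] with s hs
    rw [h.2 e _ ⟨by linarith [ht.1, hs.1], by linarith [hs.2]⟩]

theorem hasGerm_edge_sub {f : Γ.Rat} (h : δ.Represents D f y) {e : E} {t : ℝ}
    (ht : t ∈ Ioo 0 (Γ.len e)) {m : ℤ} (hm : HasGerm (fun s => δ.edgeFun D y e (t - s)) m) :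
    HasGerm (fun s => f.1 (Γ.edge e (t - s))) m := by
  refine hm.congr ?_ ?_
  · simp only [sub_zero]
    exact h.2 e t ⟨ht.1.le, ht.2.le⟩
  · filter_upwards [Ioo_mem_nhdsGT ht.1] with s hs
    rw [h.2 e _ ⟨by linarith [hs.2], by linarith [ht.2, hs.1]⟩]

theorem sum_onEdge_eq (D : Γ.Divisor) {e : E} {t : ℝ} (ht : t ∈ Ioo 0 (Γ.len e)) :
    (∑ p ∈ (by classical exact D.support.filter fun p => p.OnEdge e),
      D p * (if p.pos = t then 1 else 0)) = D (.inner e t ht) := by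
  classical
  rw [Finset.sum_eq_single (Pt.inner e t ht)]
  · simp [Pt.pos]
  · intro p hp hne
    rw [if_neg, mul_zero]
    rintro rfl
    obtain ⟨s, hs, rfl⟩ := (Finset.mem_filter.1 hp).2
    exact hne rfl
  · intro h
    have : D (Pt.inner e t ht) = 0 := by
      by_contra h'
      exact h (Finset.mem_filter.2 ⟨Finsupp.mem_support_iff.2 h', t, ht, rfl⟩)
    rw [this, zero_mul]

theorem ite_le_sub_ite_lt (x t : ℝ) :
    ((if x ≤ t then 1 else 0) - (if x < t then 1 else 0) : ℤ) = if x = t then 1 else 0 := by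
  rcases lt_trichotomy x t with h | h | h
  · simp [h, h.le, h.ne]
  · simp [h]
  · simp [h.not_ge, h.not_gt, h.ne']

open Classical in
/-- The sum of the outgoing slopes of `edgeFun` at an interior point of the edge. -/
theorem edgeFun_slopes_add {e : E} {t : ℝ} (ht : t ∈ Ioo 0 (Γ.len e)) {m k : ℤ}
    (hm : HasGerm (fun s => δ.edgeFun D y e (t + s)) m)
    (hk : HasGerm (fun s => δ.edgeFun D y e (t - s)) k) :
    m + k = (∑ i with δ.loc i = Sum.inr e, if y.2 i = t then 1 else 0) - D (.inner e t ht) := by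
  rw [hm.unique (hasGerm_edgeFun_add e t), hk.unique (hasGerm_edgeFun_sub e t),
    ← sum_onEdge_eq D ht]
  simp only [← ite_le_sub_ite_lt, mul_sub, Finset.sum_sub_distrib]
  ring

theorem Represents.ordAt_inner [Fintype E] (h : δ.Represents D f y) {e : E} {t : ℝ}
    (ht : t ∈ Ioo 0 (Γ.len e)) :
    ordAt f (.inner e t ht) =
      (∑ i ∈ (by classical exact Finset.univ.filter fun i => δ.loc i = Sum.inr e),
        if y.2 i = t then 1 else 0) - D (.inner e t ht) := by
  classical
  have h1 := hasGerm_edge_add h ht (hasGerm_edgeFun_add e t)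
  have h2 := hasGerm_edge_sub h ht (hasGerm_edgeFun_sub e t)
  rw [ordAt, h1.eq, h2.eq, edgeFun_slopes_add ht (hasGerm_edgeFun_add e t)
    (hasGerm_edgeFun_sub e t)]

theorem edge_eq_inner_iff {e e' : E} {s t : ℝ} (hs : s ∈ Icc 0 (Γ.len e'))
    (ht : t ∈ Ioo 0 (Γ.len e)) : Γ.edge e' s = .inner e t ht ↔ e' = e ∧ s = t := by
  rcases hs.1.eq_or_lt with rfl | h
  · rw [edge_zero]
    refine ⟨fun h => (by cases h), ?_⟩
    rintro ⟨_, rfl⟩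
    exact absurd ht.1 (lt_irrefl _)
  rcases hs.2.eq_or_lt with rfl | h'
  · rw [edge_len]
    refine ⟨fun h => (by cases h), ?_⟩
    rintro ⟨rfl, rfl⟩
    exact absurd ht.2 (lt_irrefl _)
  rw [edge_of_mem (show s ∈ Ioo 0 (Γ.len e') from ⟨h, h'⟩)]
  exact Pt.inner_inj

-- The two ends are recorded by separate summands, so that loops need no special treatment.
open Classical in
theorem edge_eq_vertex_indicator {e : E} {s : ℝ} (hs : s ∈ Icc 0 (Γ.len e)) (v : V) :
    (if Γ.edge e s = .vertex v then 1 else 0 : ℤ) =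
      (if Γ.src e = v then (if s ≤ 0 then 1 else 0) else 0) +
      (if Γ.tgt e = v then 1 - (if s < Γ.len e then 1 else 0) else 0) := by
  rcases hs.1.eq_or_lt with rfl | h
  · simp [edge_zero, Γ.len_pos e]
  rcases hs.2.eq_or_lt with rfl | h'
  · simp [edge_len, Γ.len_pos e]
  · simp [edge_of_mem ⟨h, h'⟩, h.not_ge, h']

-- At `v` lie the points assigned to `v` and, on the boundary of a cell, the points of edges that
-- have moved to the start or to the end of their edge.
open Classical in
theorem sum_single_point_vertex [Fintype E] (hy : δ.InEdges Γ y) (v : V) :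
    ((∑ i, Finsupp.single (δ.point Γ y i) (1 : ℤ) : Γ.Divisor) (.vertex v)) =
      (Finset.univ.filter fun i => δ.loc i = Sum.inl v).card +
      (∑ e with Γ.src e = v, ∑ i with δ.loc i = Sum.inr e, (if y.2 i ≤ 0 then 1 else 0) : ℤ) +
      (∑ e with Γ.tgt e = v, ∑ i with δ.loc i = Sum.inr e,
        (1 - (if y.2 i < Γ.len e then 1 else 0)) : ℤ) := by
  rw [Finsupp.finsetSum_apply, Finset.card_filter]
  simp only [Finset.sum_filter, Finsupp.single_apply]
  have h1 : ∀ (P : E → Prop) [DecidablePred P] (c : E → Fin n → ℤ),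
      (∑ e, if P e then ∑ i, (if δ.loc i = Sum.inr e then c e i else 0) else 0) =
        ∑ i, ∑ e, if δ.loc i = Sum.inr e then (if P e then c e i else 0) else 0 := by
    intro P _ c
    rw [Finset.sum_comm]
    refine Finset.sum_congr rfl fun e _ => ?_
    split_ifs with h
    · rfl
    · simp
  rw [h1, h1]
  push_cast
  rw [← Finset.sum_add_distrib, ← Finset.sum_add_distrib]
  refine Finset.sum_congr rfl fun i _ => ?_
  rcases hl : δ.loc i with w | e
  · rw [point_of_inl hl]
    simp
  · rw [point_of_inr hl]
    simp only [Sum.inr.injEq, reduceCtorEq, if_false, zero_add, Finset.sum_ite_eq, Finset.mem_univ,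
      if_true]
    exact edge_eq_vertex_indicator (hy i e hl) v

open Classical in
theorem sum_single_point_inner (hy : δ.InEdges Γ y) {e : E} {t : ℝ} (ht : t ∈ Ioo 0 (Γ.len e)) :
    ((∑ i, Finsupp.single (δ.point Γ y i) (1 : ℤ) : Γ.Divisor) (.inner e t ht)) =
      ∑ i with δ.loc i = Sum.inr e, if y.2 i = t then 1 else 0 := by
  rw [Finsupp.finsetSum_apply]
  simp only [Finset.sum_filter, Finsupp.single_apply]
  refine Finset.sum_congr rfl fun i _ => ?_
  rcases hl : δ.loc i with w | e'
  · rw [point_of_inl hl]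
    simp
  · rw [point_of_inr hl, edge_eq_inner_iff (hy i e' hl) ht]
    by_cases h : e' = e <;> simp [h]

variable [Fintype E] [Fintype V]

theorem principal_apply (f : Γ.Rat) (p : Γ.Pt) : principal f p = ordAt f p := rfl

/-- For a function with the kinks prescribed by `D` and the points, the balancing condition says
that the divisor of the function is the expected one. -/
theorem Represents.divisor_iff (h : δ.Represents D f y) (hy : δ.InEdges Γ y) :
    D + principal f = ∑ i, Finsupp.single (δ.point Γ y i) 1 ↔ δ.IsBalanced D := by
  classical
  have hv : ∀ v, (D + principal f) (.vertex v)
      = ((∑ i, Finsupp.single (δ.point Γ y i) (1 : ℤ) : Γ.Divisor) (.vertex v)) ↔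
      ((Finset.univ.filter fun i => δ.loc i = Sum.inl v).card : ℤ) =
        D (Pt.vertex v) + ∑ e with Γ.src e = v, δ.slope e +
          ∑ e with Γ.tgt e = v,
            -(((Finset.univ.filter fun i => δ.loc i = Sum.inr e).card : ℤ) + δ.slope e
              - ∑ p ∈ D.support with p.OnEdge e, D p) := by
    intro v
    -- Points that have reached an end of their edge enter the order of `f` and the number of points
    -- at `v` alike. After cancellation only the data of the cell remain, whether or not `y` is in
    -- the open cell.
    rw [sum_single_point_vertex hy, Finsupp.add_apply, principal_apply, ordAt]
    simp only [h.startSlope_eq, h.endSlope_eq, Finset.sum_add_distrib, Finset.sum_sub_distrib,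
      Finset.sum_neg_distrib, Finset.sum_const, nsmul_eq_mul, mul_one]
    constructor <;> intro h' <;> linarith
  constructor
  · intro h' v
    exact (hv v).1 (by rw [h'])
  · intro h'
    ext (v | ⟨e, t, ht⟩)
    · exact (hv v).2 (h' v)
    · rw [sum_single_point_inner hy, Finsupp.add_apply, principal_apply, h.ordAt_inner]
      ring

end CellDatum

end TropicalCurve

namespace TropicalCurve

variable {V E : Type*} {Γ : TropicalCurve V E} {n : ℕ}

/-! ### The discrete data of a point of `S(D)` -/

/-- The vertex or edge that contains the point. -/
def Pt.loc : Γ.Pt → V ⊕ E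
  | .vertex v => .inl v
  | .inner e _ _ => .inr e

theorem Pt.loc_eq_inl {p : Γ.Pt} {v : V} : p.loc = .inl v ↔ p = .vertex v := by
  rcases p with w | ⟨e, t, ht⟩ <;> simp [Pt.loc]

theorem Pt.loc_eq_inr {p : Γ.Pt} {e : E} : p.loc = .inr e ↔ p.OnEdge e := by
  rcases p with w | ⟨e', t, ht⟩
  · simp [Pt.loc, Pt.onEdge_vertex]
  · rw [Pt.onEdge_inner]
    simp [Pt.loc]

/-- The discrete data of a function and a family of points. -/
noncomputable def datum (f : Γ.Rat) (p : Fin n → Γ.Pt) : CellDatum V E n where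
  loc i := (p i).loc
  le i j := ∃ e, (p i).OnEdge e ∧ (p j).OnEdge e ∧ (p i).pos ≤ (p j).pos
  slope := startSlope f
  le_edge := by
    rintro i j ⟨e, h1, h2, -⟩
    exact ⟨e, Pt.loc_eq_inr.2 h1, Pt.loc_eq_inr.2 h2⟩
  le_total := by
    intro i j e hi hj
    rw [Pt.loc_eq_inr] at hi hj
    rcases _root_.le_total (p i).pos (p j).pos with h | h
    · exact Or.inl ⟨e, hi, hj, h⟩
    · exact Or.inr ⟨e, hj, hi, h⟩
  le_trans := by
    rintro i j k ⟨e, h1, h2, h3⟩ ⟨e', h4, h5, h6⟩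
    cases h2.unique h4
    exact ⟨e, h1, h5, h3.trans h6⟩

/-- The coordinates of a function and a family of points. -/
noncomputable def coord (f : Γ.Rat) (p : Fin n → Γ.Pt) : Coord V n :=
  (fun v => f.1 (.vertex v), fun i => (p i).pos)

theorem inEdges_coord (f : Γ.Rat) (p : Fin n → Γ.Pt) : (datum f p).InEdges Γ (coord f p) :=
  fun _ _ h => Ioo_subset_Icc_self (Pt.loc_eq_inr.1 h).pos_mem

theorem point_datum (f : Γ.Rat) (p : Fin n → Γ.Pt) (i : Fin n) :
    (datum f p).point Γ (coord f p) i = p i := by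
  rcases h : (p i).loc with v | e
  · rw [CellDatum.point_of_inl h, Pt.loc_eq_inl.1 h]
  · rw [CellDatum.point_of_inr h]
    exact (Pt.loc_eq_inr.1 h).edge_pos

theorem continuous_comp_edge (f : Γ.Rat) (e : E) : Continuous fun t => f.1 (Γ.edge e t) :=
  f.1.continuous.comp (continuous_edge e)

namespace CellDatum

variable {δ : CellDatum V E n} {y : Coord V n} {D : Γ.Divisor}

theorem openCell_subset_closedCell : δ.openCell D ⊆ δ.closedCell D := by
  rintro y ⟨h1, h2, h3, h4⟩
  refine ⟨h1, fun i e hi => ⟨(h2 i e hi).1.le, (h2 i e hi).2.le⟩, fun i j hij => ?_, h4⟩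
  obtain ⟨e, hi, hj⟩ := δ.le_edge i j hij
  exact (h3 i j e hi hj).1 hij

theorem inEdges_of_mem (hy : y ∈ δ.closedCell D) : δ.InEdges Γ y := fun i e hi => hy.2.1 i e hi

end CellDatum

/-- Points in closed cells with the same discrete type of function: the function determines the
coordinates. -/
theorem coord_eq_of_represents {D : Γ.Divisor} {δ : CellDatum V E n} {f : Γ.Rat} {y y' : Coord V n}
    (hy : y ∈ δ.closedCell D) (hy' : y' ∈ δ.closedCell D) (hf : δ.Represents D f y)
    (hf' : δ.Represents D f y') : y = y' := by
  classical
  have h1 : y.1 = y'.1 := funext fun v => (hf.1 v).symm.trans (hf'.1 v)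
  -- the number of points up to a given position on an edge is the same
  have hcount : ∀ e, ∀ t ∈ Ico 0 (Γ.len e),
      (Finset.univ.filter fun i => δ.loc i = Sum.inr e ∧ y.2 i ≤ t).card =
        (Finset.univ.filter fun i => δ.loc i = Sum.inr e ∧ y'.2 i ≤ t).card := by
    intro e t ht
    have h2 := CellDatum.hasGerm_edgeFun_add (δ := δ) (D := D) (y := y) e t
    have h3 := CellDatum.hasGerm_edgeFun_add (δ := δ) (D := D) (y := y') e t
    have h4 : ∀ s ∈ Icc 0 (Γ.len e), δ.edgeFun D y e s = δ.edgeFun D y' e s := fun s hs =>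
      (hf.2 e s hs).symm.trans (hf'.2 e s hs)
    have h5 := (h2.congr (h := fun s => δ.edgeFun D y' e (t + s))
      (by simpa using (h4 t ⟨ht.1, ht.2.le⟩).symm) (by
        filter_upwards [Ioo_mem_nhdsGT (sub_pos.2 ht.2)] with s hs
        exact (h4 _ ⟨by linarith [ht.1, hs.1], by linarith [hs.2]⟩).symm)).unique h3
    simp only [sub_left_inj, add_right_inj] at h5
    simp only [← Finset.filter_filter, Finset.card_filter]
    exact_mod_cast h5
  -- If `z i < z' i`, take `t = z i`. As both vectors obey the same order, every point with `z' j ≤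
  -- t` precedes `i` and has `z j ≤ t`, while `i` itself is counted only for `z`; the counts would
  -- differ.
  have key : ∀ z z' : Coord V n, z ∈ δ.closedCell D → z' ∈ δ.closedCell D →
      (∀ e, ∀ t ∈ Ico 0 (Γ.len e),
      (Finset.univ.filter fun i => δ.loc i = Sum.inr e ∧ z.2 i ≤ t).card =
        (Finset.univ.filter fun i => δ.loc i = Sum.inr e ∧ z'.2 i ≤ t).card) →
      ∀ i e, δ.loc i = Sum.inr e → z'.2 i ≤ z.2 i := by
    intro z z' hz hz' hc i e hi
    by_contra! hlt
    have h2 := hc e (z.2 i) ⟨(hz.2.1 i e hi).1, hlt.trans_le (hz'.2.1 i e hi).2⟩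
    refine absurd h2 (ne_of_gt (Finset.card_lt_card ?_))
    rw [Finset.ssubset_iff_of_subset]
    · exact ⟨i, by simp [hi], by simp [hlt]⟩
    · intro j hj
      simp only [Finset.mem_filter, Finset.mem_univ, true_and] at hj ⊢
      refine ⟨hj.1, ?_⟩
      rcases δ.le_total i j e hi hj.1 with h | h
      · exact absurd (hz'.2.2.1 i j h) (not_le.2 (hj.2.trans_lt hlt))
      · exact hz.2.2.1 j i h
  refine Prod.ext h1 (funext fun i => ?_)
  rcases hi : δ.loc i with v | e
  · rw [hy.1 i v hi, hy'.1 i v hi]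
  · exact le_antisymm (key y' y hy' hy (fun e t ht => (hcount e t ht).symm) i e hi)
      (key y y' hy hy' hcount i e hi)

variable [Fintype V] [Fintype E] {D : Γ.Divisor}

/-- Both functions have the same initial value and initial slope, and the equation `D + (f) = ∑ pᵢ`
says that they have the same kinks inside the edge. Hence `eq_of_hasGerm_zero` applies to their
difference. -/
theorem represents_datum {f : Γ.Rat} {p : Fin n → Γ.Pt}
    (h : D + principal f = ∑ i, Finsupp.single (p i) 1) :
    (datum f p).Represents D f (coord f p) := by
  classical
  refine ⟨fun v => rfl, fun e t ht => sub_eq_zero.1 ?_⟩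
  have hy := inEdges_coord f p
  have h0 : f.1 (Γ.edge e 0) = (datum f p).edgeFun D (coord f p) e 0 := by
    rw [CellDatum.edgeFun_zero hy, edge_zero]; rfl
  refine (eq_of_hasGerm_zero (l := Γ.len e)
    (h := fun t => f.1 (Γ.edge e t) - (datum f p).edgeFun D (coord f p) e t)
    ((continuous_comp_edge f e).sub (CellDatum.continuous_edgeFun e)).continuousOn ?_ ?_ t ht).trans
    (sub_eq_zero.2 h0)
  · obtain ⟨m, hm⟩ := (f.2 e).exists_hasGerm_add (t := 0) ⟨le_rfl, Γ.len_pos e⟩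
    have h1 := CellDatum.hasGerm_edgeFun_add (δ := datum f p) (D := D) (y := coord f p) e 0
    simp only [zero_add] at hm h1
    have h2 : startSlope f e = m := hm.eq
    convert hm.sub h1 using 1
    rw [Finset.sum_eq_zero, Finset.sum_eq_zero]
    · rw [← h2]
      simp [datum]
    · intro p hp
      rw [if_neg, mul_zero]
      exact not_le.2 (Finset.mem_filter.1 hp).2.pos_mem.1
    · intro i hi
      rw [if_neg]
      exact not_le.2 (Pt.loc_eq_inr.1 (Finset.mem_filter.1 hi).2).pos_mem.1
  · intro t ht
    obtain ⟨m, hm⟩ := (f.2 e).exists_hasGerm_add (t := t) ⟨ht.1.le, ht.2⟩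
    obtain ⟨k, hk⟩ := (f.2 e).exists_hasGerm_sub (t := t) ⟨ht.1, ht.2.le⟩
    have h1 := CellDatum.hasGerm_edgeFun_add (δ := datum f p) (D := D) (y := coord f p) e t
    have h2 := CellDatum.hasGerm_edgeFun_sub (δ := datum f p) (D := D) (y := coord f p) e t
    have h3 := CellDatum.edgeFun_slopes_add ht h1 h2
    have h4 : m + k = ordAt f (.inner e t ht) := by rw [ordAt, hm.eq, hk.eq]
    have h5 := CellDatum.sum_single_point_inner hy ht
    simp only [point_datum] at h5
    rw [← h, Finsupp.add_apply, CellDatum.principal_apply, ← h4] at h5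
    refine ⟨_, hm.sub h1, ?_⟩
    convert hk.sub h2 using 1
    linarith

theorem isBalanced_datum {f : Γ.Rat} {p : Fin n → Γ.Pt}
    (h : D + principal f = ∑ i, Finsupp.single (p i) 1) : (datum f p).IsBalanced D := by
  refine ((represents_datum h).divisor_iff (inEdges_coord f p)).1 ?_
  simp only [point_datum]
  exact h

theorem continuity_datum {f : Γ.Rat} {p : Fin n → Γ.Pt}
    (h : D + principal f = ∑ i, Finsupp.single (p i) 1) :
    (datum f p).Continuity D (coord f p) := by
  refine (CellDatum.continuity_iff (inEdges_coord f p)).2 fun e => ?_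
  rw [← (represents_datum h).2 e _ ⟨(Γ.len_pos e).le, le_rfl⟩, edge_len]
  rfl

theorem coord_mem_openCell {f : Γ.Rat} {p : Fin n → Γ.Pt}
    (h : D + principal f = ∑ i, Finsupp.single (p i) 1) :
    coord f p ∈ (datum f p).openCell D := by
  refine ⟨fun i v hi => ?_, fun i e hi => (Pt.loc_eq_inr.1 hi).pos_mem, fun i j e hi hj => ?_,
    continuity_datum h⟩
  · simp [coord, Pt.loc_eq_inl.1 hi, Pt.pos]
  · rw [show (datum f p).loc i = (p i).loc from rfl, Pt.loc_eq_inr] at hi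
    rw [show (datum f p).loc j = (p j).loc from rfl, Pt.loc_eq_inr] at hj
    constructor
    · rintro ⟨e', -, -, h3⟩
      exact h3
    · intro h3
      exact ⟨e, hi, hj, h3⟩

/-- The discrete data can be read off from the point, so different strata are disjoint. -/
theorem mem_stratum_iff {δ : CellDatum V E n} {x : S D n} :
    x ∈ stratum D δ ↔ δ = datum x.1.1 x.1.2 := by
  constructor
  · rintro ⟨h1, h2, h3, h4⟩
    refine CellDatum.ext ?_ ?_ (funext h4)
    · funext i
      change δ.loc i = (x.1.2 i).loc
      rcases h : (x.1.2 i).loc with v | e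
      · exact (h1 i v).2 (Pt.loc_eq_inl.1 h)
      · exact (h2 i e).2 (Pt.loc_eq_inr.1 h)
    · funext i j
      exact propext (h3 i j)
  · rintro rfl
    exact ⟨fun i v => Pt.loc_eq_inl, fun i e => Pt.loc_eq_inr, fun i j => Iff.rfl, fun e => rfl⟩

namespace CellDatum

variable {δ : CellDatum V E n} {y : Coord V n}

/-- Balancing suffices on the whole closed cell, by `Represents.divisor_iff`; therefore the charts
extend to the boundary. -/
theorem exists_mem_S (hb : δ.IsBalanced D) (hy : y ∈ δ.closedCell D) :
    ∃ x : S D n, δ.Represents D x.1.1 y ∧ x.1.2 = δ.point Γ y := by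
  have hE := inEdges_of_mem hy
  obtain ⟨f, hf⟩ := exists_represents hE hy.2.2.2
  exact ⟨⟨(f, δ.point Γ y), (hf.divisor_iff hE).2 hb⟩, hf, rfl⟩

/-- A point of `S(D)` with coordinates in an open cell lies in the corresponding stratum. -/
theorem mem_stratum_of_mem_openCell (hy : y ∈ δ.openCell D) {x : S D n}
    (hx : δ.Represents D x.1.1 y) (hp : x.1.2 = δ.point Γ y) : x ∈ stratum D δ := by
  classical
  obtain ⟨h1, h2, h3, h4⟩ := hy
  have hv : ∀ i v, δ.loc i = Sum.inl v → x.1.2 i = .vertex v := fun i v hi => by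
    rw [hp, point_of_inl hi]
  have he : ∀ i e, (hi : δ.loc i = Sum.inr e) → x.1.2 i = .inner e (y.2 i) (h2 i e hi) :=
    fun i e hi => by rw [hp, point_of_inr hi, edge_of_mem (show y.2 i ∈ Ioo 0 (Γ.len e) from h2 i e hi)]
  have he' : ∀ i e, δ.loc i = Sum.inr e ↔ (x.1.2 i).OnEdge e := by
    intro i e
    refine ⟨fun hi => ⟨_, _, he i e hi⟩, fun h => ?_⟩
    rcases hl : δ.loc i with v | e'
    · rw [hv i v hl] at h
      exact absurd h Pt.onEdge_vertex
    · rw [he i e' hl] at h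
      rw [Pt.onEdge_inner.1 h]
  have hpos : ∀ i e, δ.loc i = Sum.inr e → (x.1.2 i).pos = y.2 i := fun i e hi => by
    rw [he i e hi]; rfl
  refine ⟨fun i v => ⟨hv i v, fun h => ?_⟩, he', fun i j => ⟨fun hij => ?_, ?_⟩, fun e => ?_⟩
  · rcases hl : δ.loc i with w | e
    · rw [hv i w hl] at h
      cases h
      rfl
    · rw [he i e hl] at h
      cases h
  · obtain ⟨e, hi, hj⟩ := δ.le_edge i j hij
    refine ⟨e, (he' i e).1 hi, (he' j e).1 hj, ?_⟩
    rw [hpos i e hi, hpos j e hj]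
    exact (h3 i j e hi hj).1 hij
  · rintro ⟨e, hi, hj, hij⟩
    rw [← he'] at hi hj
    rw [hpos i e hi, hpos j e hj] at hij
    exact (h3 i j e hi hj).2 hij
  · rw [hx.startSlope_eq, Finset.sum_eq_zero, add_zero]
    intro i hi
    rw [if_neg]
    exact not_le.2 (h2 i e (Finset.mem_filter.1 hi).2).1

theorem stratum_nonempty_iff :
    (stratum D δ).Nonempty ↔ δ.IsBalanced D ∧ (δ.openCell D).Nonempty := by
  constructor
  · rintro ⟨x, hx⟩
    rw [mem_stratum_iff] at hx
    subst hx
    exact ⟨isBalanced_datum x.2, _, coord_mem_openCell x.2⟩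
  · rintro ⟨hb, y, hy⟩
    obtain ⟨x, hx, hp⟩ := exists_mem_S hb (openCell_subset_closedCell hy)
    exact ⟨x, mem_stratum_of_mem_openCell hy hx hp⟩

end CellDatum

/-- The cell that contains a point of `S(D)` in its relative interior. -/
noncomputable def cellOf (x : S D n) : CellIndex D n :=
  ⟨datum x.1.1 x.1.2, isBalanced_datum x.2, _, coord_mem_openCell x.2⟩

/-! ### The charts -/

open Classical in
/-- The chart of a cell, with arbitrary values outside the closed cell. -/
noncomputable def chart (c : CellIndex D n) (y : Coord V n) : S D n :=
  if h : y ∈ c.1.closedCell D then (CellDatum.exists_mem_S c.2.1 h).choose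
  else (CellDatum.stratum_nonempty_iff.2 c.2).some

variable {c : CellIndex D n} {y : Coord V n}

theorem represents_chart (h : y ∈ c.1.closedCell D) : c.1.Represents D (chart c y).1.1 y := by
  rw [chart, dif_pos h]
  exact (CellDatum.exists_mem_S c.2.1 h).choose_spec.1

theorem chart_points (h : y ∈ c.1.closedCell D) : (chart c y).1.2 = c.1.point Γ y := by
  rw [chart, dif_pos h]
  exact (CellDatum.exists_mem_S c.2.1 h).choose_spec.2

theorem chart_eq (h : y ∈ c.1.closedCell D) {x : S D n} (hx : c.1.Represents D x.1.1 y)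
    (hp : x.1.2 = c.1.point Γ y) : chart c y = x :=
  Subtype.ext (Prod.ext ((represents_chart h).unique hx) ((chart_points h).trans hp.symm))

theorem hasCoord_chart (h : y ∈ c.1.closedCell D) : c.1.HasCoord (chart c y) y := by
  refine ⟨(represents_chart h).1, fun i v hi => ?_, fun i e hi => ?_⟩
  · rw [chart_points h, CellDatum.point_of_inl hi]
  · rw [chart_points h, CellDatum.point_of_inr hi]

theorem chart_cellOf (x : S D n) : chart (cellOf x) (coord x.1.1 x.1.2) = x :=
  chart_eq (CellDatum.openCell_subset_closedCell (coord_mem_openCell x.2)) (represents_datum x.2)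
    (funext fun i => (point_datum _ _ i).symm)

theorem chart_mem_stratum (hy : y ∈ c.1.openCell D) : chart c y ∈ stratum D c.1 :=
  CellDatum.mem_stratum_of_mem_openCell hy
    (represents_chart (CellDatum.openCell_subset_closedCell hy))
    (chart_points (CellDatum.openCell_subset_closedCell hy))

theorem mem_stratum_iff_cellOf {x : S D n} : x ∈ stratum D c.1 ↔ c = cellOf x := by
  rw [mem_stratum_iff, Subtype.ext_iff]
  rfl

theorem chart_image_openCell (c : CellIndex D n) :
    chart c '' c.1.openCell D = stratum D c.1 := by
  apply Subset.antisymm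
  · rintro _ ⟨y, hy, rfl⟩
    exact chart_mem_stratum hy
  · intro x hx
    rw [mem_stratum_iff_cellOf] at hx
    subst hx
    exact ⟨_, coord_mem_openCell x.2, chart_cellOf x⟩

theorem existsUnique_mem_chart_image (x : S D n) : ∃! c, x ∈ chart c '' c.1.openCell D := by
  refine ⟨cellOf x, ⟨_, coord_mem_openCell x.2, chart_cellOf x⟩, fun c hc => ?_⟩
  beta_reduce at hc
  rwa [chart_image_openCell, mem_stratum_iff_cellOf] at hc

/-- Already the function determines the coordinates within a cell. This gives injectivity both for
the charts of `S(D)` and for those of `R(D)`. -/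
theorem injOn_forget_chart (c : CellIndex D n) :
    InjOn (fun y => forget D n (chart c y)) (c.1.closedCell D) := by
  intro y hy y' hy' h
  have h1 : (chart c y).1.1 = (chart c y').1.1 := congrArg Subtype.val h
  exact coord_eq_of_represents hy hy' (represents_chart hy) (h1 ▸ represents_chart hy')

end TropicalCurve

/-! ### Polyhedra -/

namespace IsPolyhedron

variable {W : Type*} [AddCommGroup W] [Module ℝ W]

theorem of_finite {κ : Type*} [Finite κ] (a : κ → W →ₗ[ℝ] ℝ) (b : κ → ℝ) :
    IsPolyhedron {y | ∀ i, a i y ≤ b i} := by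
  obtain ⟨k, ⟨e⟩⟩ := Finite.exists_equiv_fin κ
  refine ⟨k, fun i => a (e.symm i), fun i => b (e.symm i), ?_⟩
  ext y
  exact e.symm.forall_congr_right.symm

theorem le (a : W →ₗ[ℝ] ℝ) (b : ℝ) : IsPolyhedron {y | a y ≤ b} := by
  simpa using of_finite (κ := Unit) (fun _ => a) fun _ => b

theorem all {κ : Type*} [Finite κ] {p : κ → W → Prop} (h : ∀ i, IsPolyhedron {y | p i y}) :
    IsPolyhedron {y | ∀ i, p i y} := by
  choose k a b h using h
  convert of_finite (κ := Σ i, Fin (k i)) (fun j => a j.1 j.2) (fun j => b j.1 j.2) using 1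
  ext y
  simp only [mem_ofPred_eq, Sigma.forall]
  exact forall_congr' fun i => Set.ext_iff.1 (h i) y

theorem and {p q : W → Prop} (hp : IsPolyhedron {y | p y}) (hq : IsPolyhedron {y | q y}) :
    IsPolyhedron {y | p y ∧ q y} := by
  have := IsPolyhedron.all (κ := Bool) (p := fun b y => cond b (p y) (q y))
    (by rintro (_ | _) <;> simpa)
  simpa [and_comm] using this

theorem imp {r : Prop} {p : W → Prop} (hp : r → IsPolyhedron {y | p y}) :
    IsPolyhedron {y | r → p y} := by
  by_cases h : r
  · simpa [h] using hp h
  · simpa [h] using of_finite (W := W) (κ := Empty) (fun i => i.elim) fun i => i.elim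

theorem eq (a : W →ₗ[ℝ] ℝ) (b : ℝ) : IsPolyhedron {y | a y = b} := by
  have := (le a b).and (le (-a) (-b))
  simpa [le_antisymm_iff] using this

theorem convex {P : Set W} (h : IsPolyhedron P) : Convex ℝ P := by
  obtain ⟨k, a, b, rfl⟩ := h
  rw [show {y | ∀ i, a i y ≤ b i} = ⋂ i, {y | a i y ≤ b i} by ext; simp]
  exact convex_iInter fun i => convex_halfSpace_le (a i).isLinear (b i)

theorem isClosed {W : Type*} [NormedAddCommGroup W] [NormedSpace ℝ W] [FiniteDimensional ℝ W]
    {P : Set W} (h : IsPolyhedron P) : IsClosed P := by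
  obtain ⟨k, a, b, rfl⟩ := h
  rw [show {y | ∀ i, a i y ≤ b i} = ⋂ i, {y | a i y ≤ b i} by ext; simp]
  exact isClosed_iInter fun i =>
    isClosed_le (a i).continuous_of_finiteDimensional continuous_const

end IsPolyhedron

/-! ### Relative interiors and exposed faces -/

section IntrinsicInterior

variable {W : Type*} [NormedAddCommGroup W] [NormedSpace ℝ W]

/-- The line through `y` and `z` stays in the affine span, where `P` is a neighbourhood of `y`; so
the segment from `z` can be prolonged beyond `y`. -/
theorem exists_pos_of_mem_intrinsicInterior {P : Set W} {y z : W}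
    (hy : y ∈ intrinsicInterior ℝ P) (hz : z ∈ P) : ∃ ε > (0 : ℝ), y + ε • (y - z) ∈ P := by
  obtain ⟨y', hy', rfl⟩ := mem_intrinsicInterior.1 hy
  have hz' : z ∈ affineSpan ℝ P := subset_affineSpan ℝ P hz
  let γ : ℝ → affineSpan ℝ P := fun ε =>
    ⟨AffineMap.lineMap (y' : W) z (-ε), AffineMap.lineMap_mem _ y'.2 hz'⟩
  have hγ : Continuous γ :=
    Continuous.subtype_mk (AffineMap.lineMap_continuous.comp continuous_neg) _
  have h0 : γ 0 = y' := Subtype.ext (by simp [γ])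
  have h1 : ∀ᶠ ε in 𝓝[>] (0 : ℝ), γ ε ∈ interior ((↑) ⁻¹' P) :=
    (hγ.continuousAt.eventually (by rw [h0]; exact isOpen_interior.mem_nhds hy')).filter_mono
      nhdsWithin_le_nhds
  obtain ⟨ε, hε, hpos⟩ := (h1.and self_mem_nhdsWithin).exists
  refine ⟨ε, hpos, ?_⟩
  have h2 := interior_subset hε
  have h3 : (γ ε : W) = y' + ε • ((y' : W) - z) := by
    simp only [γ, AffineMap.lineMap_apply, vsub_eq_sub, vadd_eq_add, smul_sub, neg_smul]
    abel
  rwa [mem_preimage, h3] at h2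

/-- By `h1`, points of `O` are relatively interior. Conversely, a segment from a point of `O` to a
relatively interior point can be prolonged, so `h2` applies. -/
theorem intrinsicInterior_eq {P O : Set W} (hO : O ⊆ P) (hne : O.Nonempty)
    (h1 : ∀ y ∈ O, ∀ᶠ z in 𝓝 y, z ∈ affineSpan ℝ P → z ∈ P)
    (h2 : ∀ y ∈ P, ∀ z ∈ O, ∀ ε > (0 : ℝ), y + ε • (y - z) ∈ P → y ∈ O) :
    intrinsicInterior ℝ P = O := by
  apply Subset.antisymm
  · intro y hy
    obtain ⟨z, hz⟩ := hne
    obtain ⟨ε, hε, h⟩ := exists_pos_of_mem_intrinsicInterior hy (hO hz)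
    exact h2 y (intrinsicInterior_subset hy) z hz ε hε h
  · intro y hy
    refine mem_intrinsicInterior.2 ⟨⟨y, subset_affineSpan ℝ P (hO hy)⟩, ?_, rfl⟩
    rw [mem_interior_iff_mem_nhds]
    filter_upwards [continuous_subtype_val.continuousAt.eventually (h1 y hy)] with z hz
    exact hz z.2

theorem eq_of_mem_affineSpan {P : Set W} {a : W →ₗ[ℝ] ℝ} {b : ℝ} (h : ∀ y ∈ P, a y = b) {z : W}
    (hz : z ∈ affineSpan ℝ P) : a z = b := by
  refine affineSpan_induction hz h fun c u v w hu hv hw => ?_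
  simp [hu, hv, hw]

/-- A non-empty exposed face contains a point such that the face consists of the points `y` from
which the segment to that point can be continued. -/
theorem IsExposed.exists_mem_iff [FiniteDimensional ℝ W] {P F : Set W} (hF : IsExposed ℝ P F)
    (hP : Convex ℝ P) (hne : F.Nonempty) :
    ∃ y₀ ∈ F, ∀ y ∈ P, y ∈ F ↔ ∃ ε > (0 : ℝ), y₀ + ε • (y₀ - y) ∈ P := by
  -- Any relatively interior point of the face serves. If a segment from `y` continues beyond it,
  -- the exposing form, being maximal at `y₀`, cannot be smaller at `y`.
  obtain ⟨y₀, hy₀⟩ := hne.intrinsicInterior (hF.convex hP)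
  have hy₀F := intrinsicInterior_subset hy₀
  refine ⟨y₀, hy₀F, fun y hy => ⟨fun hyF => ?_, ?_⟩⟩
  · obtain ⟨ε, hε, h⟩ := exists_pos_of_mem_intrinsicInterior hy₀ hyF
    exact ⟨ε, hε, hF.subset h⟩
  · rintro ⟨ε, hε, h⟩
    obtain ⟨l, hl⟩ := hF hne
    rw [hl] at hy₀F ⊢
    refine ⟨hy, fun z hz => ?_⟩
    have h1 := hy₀F.2 _ h
    have h2 := hy₀F.2 z hz
    simp only [map_add, map_smul, map_sub, smul_eq_mul] at h1
    have h3 : l y₀ ≤ l y := by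
      by_contra! h4
      linarith [mul_pos hε (sub_pos.2 h4)]
    exact h2.trans h3

end IntrinsicInterior

namespace TropicalCurve

variable {V E : Type*} {Γ : TropicalCurve V E} {n : ℕ} {D : Γ.Divisor}

/-! ### Closed cells are polyhedra -/

namespace CellDatum

variable {δ δ' : CellDatum V E n} {y z : Coord V n}

/-- The coordinate `x i` as a linear form. -/
noncomputable def posForm (V : Type*) {n : ℕ} (i : Fin n) : Coord V n →ₗ[ℝ] ℝ :=
  (LinearMap.proj i).comp (LinearMap.snd ℝ (V → ℝ) (Fin n → ℝ))

/-- The value at the vertex `v` as a linear form. -/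
noncomputable def valueForm (n : ℕ) (v : V) : Coord V n →ₗ[ℝ] ℝ :=
  (LinearMap.proj v).comp (LinearMap.fst ℝ (V → ℝ) (Fin n → ℝ))

@[simp] theorem posForm_apply (i : Fin n) (y : Coord V n) : posForm V i y = y.2 i := rfl

@[simp] theorem valueForm_apply (v : V) (y : Coord V n) : valueForm n v y = y.1 v := rfl

open Classical in
/-- The linear part of the continuity condition. -/
noncomputable def continuityForm (Γ : TropicalCurve V E) (δ : CellDatum V E n) (e : E) :
    Coord V n →ₗ[ℝ] ℝ :=
  valueForm n (Γ.tgt e) - valueForm n (Γ.src e) + ∑ i with δ.loc i = Sum.inr e, posForm V i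

open Classical in
/-- The constant part of the continuity condition. -/
noncomputable def continuityConst (δ : CellDatum V E n) (D : Γ.Divisor) (e : E) : ℝ :=
  δ.slope e * Γ.len e + (∑ i with δ.loc i = Sum.inr e, Γ.len e)
    - ∑ p ∈ D.support with p.OnEdge e, (D p : ℝ) * (Γ.len e - p.pos)

open Classical in
theorem continuityForm_apply (e : E) (y : Coord V n) :
    continuityForm Γ δ e y =
      y.1 (Γ.tgt e) - y.1 (Γ.src e) + ∑ i with δ.loc i = Sum.inr e, y.2 i := by
  simp [continuityForm]

theorem continuity_iff_form :
    δ.Continuity D y ↔ ∀ e, continuityForm Γ δ e y = δ.continuityConst D e := by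
  classical
  refine forall_congr' fun e => ?_
  rw [continuityForm_apply, continuityConst, Finset.sum_sub_distrib]
  constructor <;> intro h <;> linarith

theorem Continuity.congr (hl : δ'.loc = δ.loc) (hs : δ'.slope = δ.slope) (h : δ.Continuity D y) :
    δ'.Continuity D y := by
  unfold Continuity at h ⊢
  rwa [hl, hs]

theorem IsBalanced.congr [Fintype V] [Fintype E] (hl : δ'.loc = δ.loc) (hs : δ'.slope = δ.slope)
    (h : δ.IsBalanced D) : δ'.IsBalanced D := by
  unfold IsBalanced at h ⊢
  rwa [hl, hs]

theorem Represents.congr (hl : δ'.loc = δ.loc) (hs : δ'.slope = δ.slope) {f : Γ.Rat}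
    (h : δ.Represents D f y) : δ'.Represents D f y := by
  unfold Represents edgeFun at h ⊢
  rwa [hl, hs]

theorem point_congr (hl : δ'.loc = δ.loc) : δ'.point Γ y = δ.point Γ y := by
  unfold point
  rw [hl]

theorem isPolyhedron_closedCell [Finite V] [Finite E] (δ : CellDatum V E n) (D : Γ.Divisor) :
    IsPolyhedron (δ.closedCell D) := by
  refine .and (.all fun i => .all fun v => .imp fun _ => ?_)
    (.and (.all fun i => .all fun e => .imp fun _ => ?_)
      (.and (.all fun i => .all fun j => .imp fun _ => ?_) ?_))
  · exact .eq (posForm V i) 0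
  · refine .and ?_ (.le (posForm V i) _)
    simpa using IsPolyhedron.le (-posForm V i) 0
  · simpa using IsPolyhedron.le (posForm V i - posForm V j) 0
  · simp only [continuity_iff_form]
    exact .all fun e => .eq _ _

/-- The inequalities that are strict at `y` persist nearby. The others are equations on the whole
closed cell (ties, points at vertices, continuity), hence also on its affine span. -/
theorem mem_closedCell_of_mem_affineSpan [Fintype V] [Finite E] (hy : y ∈ δ.openCell D) :
    ∀ᶠ z in 𝓝 y, z ∈ affineSpan ℝ (δ.closedCell D) → z ∈ δ.closedCell D := by
  have hi : ∀ᶠ z : Coord V n in 𝓝 y, ∀ i e, δ.loc i = Sum.inr e → 0 ≤ z.2 i ∧ z.2 i ≤ Γ.len e := by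
    simp only [eventually_all]
    intro i e h
    have hc : ContinuousAt (fun z : Coord V n => z.2 i) y := by fun_prop
    filter_upwards [hc.eventually (Ioo_mem_nhds (hy.2.1 i e h).1 (hy.2.1 i e h).2)] with z hz
    exact ⟨hz.1.le, hz.2.le⟩
  have hij : ∀ᶠ z : Coord V n in 𝓝 y, ∀ i j, δ.le i j → ¬ δ.le j i → z.2 i ≤ z.2 j := by
    simp only [eventually_all]
    intro i j h h'
    obtain ⟨e, he, he'⟩ := δ.le_edge i j h
    have hc : ContinuousAt (fun z : Coord V n => z.2 j - z.2 i) y := by fun_prop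
    have : 0 < y.2 j - y.2 i := sub_pos.2 (not_le.1 fun h3 => h' ((hy.2.2.1 j i e he' he).2 h3))
    filter_upwards [hc.eventually (Ioi_mem_nhds this)] with z hz
    exact (sub_pos.1 hz).le
  filter_upwards [hi, hij] with z h1 h2 hz
  refine ⟨fun i v h => ?_, h1, fun i j h => ?_, continuity_iff_form.2 fun e => ?_⟩
  · exact eq_of_mem_affineSpan (a := posForm V i) (fun w hw => hw.1 i v h) hz
  · by_cases h' : δ.le j i
    · have := eq_of_mem_affineSpan (a := posForm V i - posForm V j) (b := 0)
        (fun w hw => by simpa using sub_eq_zero.2 (le_antisymm (hw.2.2.1 i j h) (hw.2.2.1 j i h')))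
        hz
      exact (sub_eq_zero.1 this).le
    · exact h2 i j h h'
  · exact eq_of_mem_affineSpan (fun w hw => continuity_iff_form.1 hw.2.2.2 e) hz

/-- An inequality that is strict at `z` and an equality at `y` would be violated just beyond `y`. -/
theorem mem_openCell_of_extend (hy : y ∈ δ.closedCell D) (hz : z ∈ δ.openCell D) {ε : ℝ}
    (hε : 0 < ε) (h : y + ε • (y - z) ∈ δ.closedCell D) : y ∈ δ.openCell D := by
  refine ⟨hy.1, fun i e hi => ?_, fun i j e hi hj => ⟨fun hij => hy.2.2.1 i j hij, fun hij => ?_⟩,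
    hy.2.2.2⟩
  · have h1 := h.2.1 i e hi
    have h2 := hz.2.1 i e hi
    simp only [Prod.snd_add, Prod.smul_snd, Prod.snd_sub, Pi.add_apply, Pi.smul_apply,
      Pi.sub_apply, smul_eq_mul] at h1
    constructor <;> by_contra! h3
    · linarith [mul_pos hε (show 0 < z.2 i - y.2 i by linarith)]
    · linarith [mul_pos hε (show 0 < y.2 i - z.2 i by linarith)]
  · by_contra hn
    have hji := (δ.le_total i j e hi hj).resolve_left hn
    have h1 := h.2.2.1 j i hji
    have h2 := hy.2.2.1 j i hji
    have h3 : z.2 j < z.2 i := not_le.1 fun h4 => hn ((hz.2.2.1 i j e hi hj).2 h4)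
    simp only [Prod.snd_add, Prod.smul_snd, Prod.snd_sub, Pi.add_apply, Pi.smul_apply,
      Pi.sub_apply, smul_eq_mul, le_antisymm hij h2] at h1
    linarith [mul_pos hε (sub_pos.2 h3)]

theorem intrinsicInterior_closedCell [Fintype V] [Finite E] (h : (δ.openCell D).Nonempty) :
    intrinsicInterior ℝ (δ.closedCell D) = δ.openCell D :=
  intrinsicInterior_eq openCell_subset_closedCell h
    (fun _ hy => mem_closedCell_of_mem_affineSpan hy)
    fun _ hy _ hz _ hε h => mem_openCell_of_extend hy hz hε h

/-! ### Cells without ties -/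

/-- The points `i` and `j` coincide. -/
def Tied (δ : CellDatum V E n) (i j : Fin n) : Prop := δ.le i j ∧ δ.le j i

theorem Tied.symm {i j : Fin n} (h : δ.Tied i j) : δ.Tied j i := ⟨h.2, h.1⟩

theorem Tied.trans {i j k : Fin n} (h : δ.Tied i j) (h' : δ.Tied j k) : δ.Tied i k :=
  ⟨δ.le_trans _ _ _ h.1 h'.1, δ.le_trans _ _ _ h'.2 h.2⟩

/-- The discrete data in which ties are broken by the order of the labels. -/
def breakTies (δ : CellDatum V E n) : CellDatum V E n where
  loc := δ.loc
  le i j := δ.le i j ∧ (δ.le j i → i ≤ j)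
  slope := δ.slope
  le_edge i j h := δ.le_edge i j h.1
  le_total i j e hi hj := by
    by_cases h1 : δ.le i j <;> by_cases h2 : δ.le j i
    · rcases _root_.le_total i j with h | h
      · exact Or.inl ⟨h1, fun _ => h⟩
      · exact Or.inr ⟨h2, fun _ => h⟩
    · exact Or.inl ⟨h1, fun h => absurd h h2⟩
    · exact Or.inr ⟨h2, fun h => absurd h h1⟩
    · exact absurd (δ.le_total i j e hi hj) (by simp [h1, h2])
  le_trans i j k h h' :=
    ⟨δ.le_trans i j k h.1 h'.1, fun hki =>
      (h.2 (δ.le_trans j k i h'.1 hki)).trans (h'.2 (δ.le_trans k i j hki h.1))⟩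

theorem isTotalOrder_breakTies (δ : CellDatum V E n) : δ.breakTies.IsTotalOrder :=
  fun _ _ h h' => le_antisymm (h.2 h'.1) (h'.2 h.1)

open Classical in
/-- The directions in which tied points are moved apart. -/
noncomputable def spread (δ : CellDatum V E n) (i : Fin n) : ℝ :=
  ∑ j with δ.Tied i j, ((i : ℝ) - (j : ℝ))

theorem spread_of_inl {i : Fin n} {v : V} (h : δ.loc i = Sum.inl v) : δ.spread i = 0 := by
  classical
  refine Finset.sum_eq_zero fun j hj => ?_
  obtain ⟨e, he, -⟩ := δ.le_edge i j (Finset.mem_filter.1 hj).2.1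
  rw [h] at he
  cases he

-- The summands are antisymmetric in `i` and `j`. As only the sum of the positions on an edge enters
-- the continuity equations, moving points along `spread` preserves them.
open Classical in
theorem sum_spread (δ : CellDatum V E n) (e : E) : ∑ i with δ.loc i = Sum.inr e, δ.spread i = 0 := by
  have h1 : ∑ i with δ.loc i = Sum.inr e, δ.spread i =
      ∑ i, ∑ j, if δ.loc i = Sum.inr e ∧ δ.Tied i j then ((i : ℝ) - (j : ℝ)) else 0 := by
    simp only [spread, Finset.sum_filter, ite_and]
    refine Finset.sum_congr rfl fun i _ => ?_
    split_ifs <;> simp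
  have h2 : ∑ i, ∑ j, (if δ.loc i = Sum.inr e ∧ δ.Tied i j then ((i : ℝ) - (j : ℝ)) else 0) =
      -∑ i, ∑ j, if δ.loc i = Sum.inr e ∧ δ.Tied i j then ((i : ℝ) - (j : ℝ)) else 0 := by
    conv_lhs => rw [Finset.sum_comm]
    simp only [← Finset.sum_neg_distrib]
    refine Finset.sum_congr rfl fun j _ => Finset.sum_congr rfl fun i _ => ?_
    have : (δ.loc i = Sum.inr e ∧ δ.Tied i j) ↔ (δ.loc j = Sum.inr e ∧ δ.Tied j i) := by
      have key : ∀ i j, (δ.loc i = Sum.inr e ∧ δ.Tied i j) → (δ.loc j = Sum.inr e ∧ δ.Tied j i) := by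
        rintro i j ⟨h, h'⟩
        obtain ⟨e', hi, hj⟩ := δ.le_edge i j h'.1
        rw [hj, ← hi]
        exact ⟨h, h'.symm⟩
      exact ⟨key i j, key j i⟩
    simp only [this]
    split_ifs <;> ring
  rw [h1]
  linarith

/-- Tied points have the same tie class, so both sums have the same index set and differ by `j - i`
in each term. -/
theorem spread_lt {i j : Fin n} (h : δ.Tied i j) (hij : i < j) : δ.spread i < δ.spread j := by
  classical
  have h1 : (Finset.univ.filter fun k => δ.Tied j k) = Finset.univ.filter fun k => δ.Tied i k := by
    ext k
    simp only [Finset.mem_filter, Finset.mem_univ, true_and]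
    exact ⟨fun h' => h.trans h', fun h' => h.symm.trans h'⟩
  rw [spread, spread, h1]
  refine Finset.sum_lt_sum_of_nonempty ⟨j, by simpa using h⟩ fun k _ => ?_
  have : (i : ℝ) < j := by exact_mod_cast hij
  linarith

/-- A small displacement along `spread` separates ties in the order of the labels, keeps all strict
inequalities, and respects continuity by `sum_spread`. -/
theorem openCell_breakTies_nonempty (h : (δ.openCell D).Nonempty) :
    (δ.breakTies.openCell D).Nonempty := by
  classical
  obtain ⟨y, hy⟩ := h
  let g : ℝ → Coord V n := fun ε => (y.1, fun i => y.2 i + ε * δ.spread i)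
  have hg : ∀ i, Tendsto (fun ε => (g ε).2 i) (𝓝[>] 0) (𝓝 (y.2 i)) := fun i => by
    have : Continuous fun ε => (g ε).2 i := by simp only [g]; fun_prop
    simpa [g] using this.continuousAt.tendsto.mono_left (nhdsWithin_le_nhds (a := (0 : ℝ)))
  have h1 : ∀ᶠ ε in 𝓝[>] (0 : ℝ), ∀ i j, y.2 i < y.2 j → (g ε).2 i < (g ε).2 j := by
    simp only [eventually_all]
    exact fun i j hij => (hg i).eventually_lt (hg j) hij
  have h2 : ∀ᶠ ε in 𝓝[>] (0 : ℝ), ∀ i, 0 < y.2 i → 0 < (g ε).2 i := by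
    simp only [eventually_all]
    exact fun i hi => (hg i).eventually (Ioi_mem_nhds hi)
  have h3 : ∀ᶠ ε in 𝓝[>] (0 : ℝ), ∀ i, ∀ e, δ.loc i = Sum.inr e → (g ε).2 i < Γ.len e := by
    simp only [eventually_all]
    intro i
    rcases hl : δ.loc i with v | e
    · simp
    · filter_upwards [(hg i).eventually (Iio_mem_nhds (hy.2.1 i e hl).2)] with ε hε e' he'
      cases he'
      exact hε
  obtain ⟨ε, ⟨⟨h1, h2⟩, h3⟩, hε⟩ := (((h1.and h2).and h3).and self_mem_nhdsWithin).exists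
  have hε : 0 < ε := hε
  refine ⟨g ε, fun i v hi => ?_, fun i e hi => ⟨h2 i (hy.2.1 i e hi).1, h3 i e hi⟩,
    fun i j e hi hj => ?_, ?_⟩
  · simp [g, hy.1 i v hi, spread_of_inl (δ := δ) hi]
  · have hle : δ.le i j ↔ y.2 i ≤ y.2 j := hy.2.2.1 i j e hi hj
    have hle' : δ.le j i ↔ y.2 j ≤ y.2 i := hy.2.2.1 j i e hj hi
    change δ.le i j ∧ (δ.le j i → i ≤ j) ↔ _
    rcases lt_trichotomy (y.2 i) (y.2 j) with h | h | h
    · exact iff_of_true ⟨hle.2 h.le, fun h' => absurd (hle'.1 h') h.not_ge⟩ (h1 i j h).le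
    · have ht : δ.Tied i j := ⟨hle.2 h.le, hle'.2 h.ge⟩
      have hmono : ∀ i j, y.2 i = y.2 j → δ.Tied i j → i < j → (g ε).2 i < (g ε).2 j := by
        intro i j h ht hij
        simp only [g, h]
        linarith [mul_lt_mul_of_pos_left (spread_lt ht hij) hε]
      rcases lt_trichotomy i j with hij | rfl | hij
      · exact iff_of_true ⟨ht.1, fun _ => hij.le⟩ (hmono i j h ht hij).le
      · exact iff_of_true ⟨ht.1, fun _ => le_rfl⟩ le_rfl
      · exact iff_of_false (fun h' => (h'.2 ht.2).not_gt hij)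
          (hmono j i h.symm ht.symm hij).not_ge
    · exact iff_of_false (fun h' => (hle.1 h'.1).not_gt h) (h1 j i h).not_ge
  · refine Continuity.congr (δ := δ) rfl rfl (continuity_iff_form.2 fun e => ?_)
    rw [← continuity_iff_form.1 hy.2.2.2 e, continuityForm_apply, continuityForm_apply]
    simp only [g, Finset.sum_add_distrib, ← Finset.mul_sum, sum_spread]
    simp

theorem closedCell_subset_breakTies : δ.closedCell D ⊆ δ.breakTies.closedCell D :=
  fun _ hy => ⟨hy.1, hy.2.1, fun i j h => hy.2.2.1 i j h.1, hy.2.2.2.congr rfl rfl⟩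

/-- The exposing form sums `x i - x j` over tied pairs with `i ≤ j`. On the larger cell each summand
is at most zero, and the total vanishes exactly when all ties hold. -/
theorem isExposed_breakTies : IsExposed ℝ (δ.breakTies.closedCell D) (δ.closedCell D) := by
  classical
  rintro ⟨y₀, hy₀⟩
  let x : Fin n → StrongDual ℝ (Coord V n) := fun i =>
    (ContinuousLinearMap.proj i).comp (ContinuousLinearMap.snd ℝ (V → ℝ) (Fin n → ℝ))
  let l : StrongDual ℝ (Coord V n) :=
    ∑ q : Fin n × Fin n, if δ.Tied q.1 q.2 ∧ q.1 ≤ q.2 then x q.1 - x q.2 else 0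
  have hl : ∀ y : Coord V n,
      l y = ∑ q : Fin n × Fin n, if δ.Tied q.1 q.2 ∧ q.1 ≤ q.2 then y.2 q.1 - y.2 q.2 else 0 := by
    intro y
    simp only [l, sum_apply]
    refine Finset.sum_congr rfl fun q _ => ?_
    split_ifs <;> rfl
  have hnonpos : ∀ y ∈ δ.breakTies.closedCell D, ∀ q ∈ (Finset.univ : Finset (Fin n × Fin n)),
      (if δ.Tied q.1 q.2 ∧ q.1 ≤ q.2 then y.2 q.1 - y.2 q.2 else 0) ≤ 0 := by
    intro y hy q _
    split_ifs with h
    · exact sub_nonpos.2 (hy.2.2.1 q.1 q.2 ⟨h.1.1, fun _ => h.2⟩)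
    · exact le_rfl
  have hzero : ∀ y ∈ δ.closedCell D, l y = 0 := by
    intro y hy
    rw [hl]
    refine Finset.sum_eq_zero fun q _ => ?_
    split_ifs with h
    · exact sub_eq_zero.2 (le_antisymm (hy.2.2.1 _ _ h.1.1) (hy.2.2.1 _ _ h.1.2))
    · rfl
  refine ⟨l, Subset.antisymm (fun y hy => ⟨closedCell_subset_breakTies hy, fun z hz => ?_⟩) ?_⟩
  · rw [hzero y hy, hl]
    exact Finset.sum_nonpos (hnonpos z hz)
  · rintro y ⟨hy, hmax⟩
    have h1 := hmax y₀ (closedCell_subset_breakTies hy₀)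
    rw [hzero y₀ hy₀, hl] at h1
    have h2 := (Finset.sum_eq_zero_iff_of_nonpos (hnonpos y hy)).1
      (le_antisymm (Finset.sum_nonpos (hnonpos y hy)) h1)
    have h3 : ∀ i j, δ.Tied i j → i ≤ j → y.2 i = y.2 j := fun i j h h' => by
      have := h2 (i, j) (Finset.mem_univ _)
      rw [if_pos ⟨h, h'⟩] at this
      exact sub_eq_zero.1 this
    refine ⟨hy.1, hy.2.1, fun i j hij => ?_, hy.2.2.2.congr rfl rfl⟩
    by_cases hji : δ.le j i
    · rcases _root_.le_total i j with h | h
      · exact (h3 i j ⟨hij, hji⟩ h).le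
      · exact (h3 j i ⟨hji, hij⟩ h).ge
    · exact hy.2.2.1 i j ⟨hij, fun h => absurd h hji⟩

end CellDatum

theorem exists_isTotalOrder [Fintype V] [Fintype E] (c : CellIndex D n) :
    ∃ c' : CellIndex D n, c'.1.IsTotalOrder ∧ c'.1.loc = c.1.loc ∧
      c'.1.slope = c.1.slope ∧ (∀ i j, c'.1.le i j → c.1.le i j) ∧
      IsExposed ℝ (c'.1.closedCell D) (c.1.closedCell D) ∧
      ∀ y ∈ c.1.closedCell D, chart c' y = chart c y := by
  let c' : CellIndex D n := ⟨c.1.breakTies, c.2.1.congr rfl rfl,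
    CellDatum.openCell_breakTies_nonempty c.2.2⟩
  refine ⟨c', c.1.isTotalOrder_breakTies, rfl, rfl, fun i j h => h.1,
    CellDatum.isExposed_breakTies, fun y hy => ?_⟩
  refine chart_eq (c := c') (CellDatum.closedCell_subset_breakTies hy)
    ((represents_chart hy).congr rfl rfl) ?_
  rw [chart_points hy]
  exact (CellDatum.point_congr rfl).symm

end TropicalCurve

namespace TropicalCurve

variable {V E : Type*} {Γ : TropicalCurve V E} {n : ℕ} {D : Γ.Divisor}

/-! ### There are only finitely many cells -/

namespace CellDatum

variable {δ : CellDatum V E n} {y : Coord V n}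

/-- A bound for the numbers of points and the coefficients of `D`. -/
noncomputable def totalMass (D : Γ.Divisor) (n : ℕ) [Fintype V] : ℝ :=
  n + ∑ p ∈ D.support, |(D p : ℝ)| + ∑ v, |(D (.vertex v) : ℝ)|

open Classical in
/-- The expected outgoing slope at the end point of `e`. -/
noncomputable def lastSlope (δ : CellDatum V E n) (D : Γ.Divisor) (e : E) : ℤ :=
  -(((Finset.univ.filter fun i => δ.loc i = Sum.inr e).card : ℤ) + δ.slope e
    - ∑ p ∈ D.support with p.OnEdge e, D p)

/-- The increment differs from that of the affine function with slope `m_e` only through kinks, each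
contributing at most its multiplicity times the length of the edge. This is independent of the
slopes. -/
theorem abs_increment_sub_le [Fintype V] (hy : δ.closedCell D y) (e : E) :
    |y.1 (Γ.tgt e) - y.1 (Γ.src e) - δ.slope e * Γ.len e| ≤ totalMass D n * Γ.len e := by
  classical
  have hl := Γ.len_pos e
  rw [show y.1 (Γ.tgt e) - y.1 (Γ.src e) - δ.slope e * Γ.len e =
    (∑ i with δ.loc i = Sum.inr e, (Γ.len e - y.2 i))
    - ∑ p ∈ D.support with p.OnEdge e, (D p : ℝ) * (Γ.len e - p.pos) by
      rw [hy.2.2.2 e]; ring]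
  have h1 : |∑ i with δ.loc i = Sum.inr e, (Γ.len e - y.2 i)| ≤ n * Γ.len e := by
    refine (Finset.abs_sum_le_sum_abs _ _).trans ?_
    refine (Finset.sum_le_card_nsmul _ _ (Γ.len e) fun i hi => ?_).trans ?_
    · have := hy.2.1 i e (Finset.mem_filter.1 hi).2
      rw [abs_of_nonneg (by linarith)]
      linarith
    · rw [nsmul_eq_mul]
      refine mul_le_mul_of_nonneg_right ?_ hl.le
      exact_mod_cast (Finset.card_le_univ _).trans (Fintype.card_fin n).le
  have h2 : |∑ p ∈ D.support with p.OnEdge e, (D p : ℝ) * (Γ.len e - p.pos)| ≤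
      (∑ p ∈ D.support, |(D p : ℝ)|) * Γ.len e := by
    refine (Finset.abs_sum_le_sum_abs _ _).trans ?_
    rw [Finset.sum_mul]
    refine (Finset.sum_le_sum fun p hp => ?_).trans
      (Finset.sum_le_sum_of_subset_of_nonneg (Finset.filter_subset _ _) fun p _ _ => by positivity)
    have := (Finset.mem_filter.1 hp).2.pos_mem
    rw [abs_mul]
    refine mul_le_mul_of_nonneg_left ?_ (abs_nonneg _)
    rw [abs_of_nonneg (by linarith [this.2])]
    linarith [this.1]
  refine (abs_sub _ _).trans ((add_le_add h1 h2).trans ?_)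
  rw [← add_mul, totalMass]
  refine mul_le_mul_of_nonneg_right ?_ hl.le
  have : 0 ≤ ∑ v, |(D (.vertex v) : ℝ)| := by positivity
  linarith

theorem abs_lastSlope_add_le [Fintype V] (e : E) :
    |(δ.lastSlope D e + δ.slope e : ℝ)| ≤ totalMass D n := by
  classical
  rw [lastSlope]
  push_cast
  rw [show (-(((Finset.univ.filter fun i => δ.loc i = Sum.inr e).card : ℝ) + δ.slope e
    - ∑ p ∈ D.support with p.OnEdge e, (D p : ℝ)) + δ.slope e : ℝ) =
    (∑ p ∈ D.support with p.OnEdge e, (D p : ℝ)) -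
      ((Finset.univ.filter fun i => δ.loc i = Sum.inr e).card : ℝ) by ring]
  have h1 : |((Finset.univ.filter fun i => δ.loc i = Sum.inr e).card : ℝ)| ≤ n := by
    rw [Nat.abs_cast]
    exact_mod_cast (Finset.card_le_univ _).trans (Fintype.card_fin n).le
  have h2 : |∑ p ∈ D.support with p.OnEdge e, (D p : ℝ)| ≤ ∑ p ∈ D.support, |(D p : ℝ)| :=
    (Finset.abs_sum_le_sum_abs _ _).trans
      (Finset.sum_le_sum_of_subset_of_nonneg (Finset.filter_subset _ _) fun p _ _ => abs_nonneg _)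
  refine (abs_sub _ _).trans ((add_le_add h2 h1).trans ?_)
  have : 0 ≤ ∑ v, |(D (.vertex v) : ℝ)| := by positivity
  rw [totalMass]
  linarith

theorem totalMass_nonneg [Fintype V] : 0 ≤ totalMass D n := by
  unfold totalMass
  positivity

theorem isBalanced_iff [Fintype E] : δ.IsBalanced D ↔ ∀ v : V,
    ((by classical exact Finset.univ.filter fun i => δ.loc i = Sum.inl v : Finset (Fin n)).card : ℤ)
      = D (.vertex v) +
      ((∑ e, by classical exact if Γ.src e = v then δ.slope e else 0) +
        ∑ e, by classical exact if Γ.tgt e = v then δ.lastSlope D e else 0) := by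
  classical
  refine forall_congr' fun v => ?_
  simp only [Finset.sum_filter, lastSlope, add_assoc]

variable [Fintype V] [Fintype E]

/-- The sum of the balancing conditions over a set of vertices. -/
theorem IsBalanced.neg_totalMass_le (h : δ.IsBalanced D) (U : Set V) :
    -totalMass D n ≤ ∑ e, ((by classical exact if Γ.src e ∈ U then (δ.slope e : ℝ) else 0) +
      (by classical exact if Γ.tgt e ∈ U then (δ.lastSlope D e : ℝ) else 0)) := by
  classical
  have h1 : ∀ (s : E → V) (m : E → ℝ), ∑ e, (if s e ∈ U then m e else 0) =
      ∑ v with v ∈ U, ∑ e, if s e = v then m e else 0 := by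
    intro s m
    rw [Finset.sum_comm]
    refine Finset.sum_congr rfl fun e _ => ?_
    simp
  have h2 : ∀ v, -|(D (.vertex v) : ℝ)| ≤ (∑ e, if Γ.src e = v then (δ.slope e : ℝ) else 0) +
      ∑ e, if Γ.tgt e = v then (δ.lastSlope D e : ℝ) else 0 := by
    intro v
    have h3 := isBalanced_iff.1 h v
    have h4 : (((Finset.univ.filter fun i => δ.loc i = Sum.inl v).card : ℤ) : ℝ) =
      ((D (.vertex v) + ((∑ e, if Γ.src e = v then δ.slope e else 0) +
        ∑ e, if Γ.tgt e = v then δ.lastSlope D e else 0) : ℤ) : ℝ) := by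
      rw [← h3]
    push_cast at h4
    have h5 := le_abs_self (D (.vertex v) : ℝ)
    have h6 : (0 : ℝ) ≤ (Finset.univ.filter fun i => δ.loc i = Sum.inl v).card := by positivity
    linarith
  rw [Finset.sum_add_distrib, h1, h1, ← Finset.sum_add_distrib]
  refine _root_.le_trans ?_ (Finset.sum_le_sum fun v _ => h2 v)
  rw [Finset.sum_neg_distrib, neg_le_neg_iff]
  refine (Finset.sum_le_sum_of_subset_of_nonneg (Finset.filter_subset _ _)
    fun v _ _ => abs_nonneg _).trans ?_
  rw [totalMass]
  have : 0 ≤ ∑ p ∈ D.support, |(D p : ℝ)| := by positivity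
  linarith [Nat.cast_nonneg (α := ℝ) n]

/-- A steep edge `e₀` crosses the boundary of the superlevel set `U` of the larger value at its
ends. Outgoing slopes from `U` across its boundary are bounded above, since the function decreases
there, and their balanced total is bounded below. Hence no single one can be very negative. -/
theorem abs_slope_le (h : δ.IsBalanced D) (hy : δ.closedCell D y) (e₀ : E) :
    |(δ.slope e₀ : ℝ)| ≤ 4 * totalMass D n + 2 * totalMass D n * Fintype.card E := by
  classical
  set B := totalMass D n with hB
  have hB0 : 0 ≤ B := totalMass_nonneg
  have hBE : 0 ≤ B * Fintype.card E := by positivity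
  -- slopes in the direction in which the function decreases are bounded from above
  have hm : ∀ e, y.1 (Γ.tgt e) ≤ y.1 (Γ.src e) → (δ.slope e : ℝ) ≤ B := fun e he => by
    have h1 := (abs_le.1 (abs_increment_sub_le hy e)).1
    have h2 : (δ.slope e : ℝ) * Γ.len e ≤ B * Γ.len e := by linarith
    exact le_of_mul_le_mul_right h2 (Γ.len_pos e)
  have hm' : ∀ e, y.1 (Γ.src e) ≤ y.1 (Γ.tgt e) → -B ≤ (δ.slope e : ℝ) := fun e he => by
    have h1 := (abs_le.1 (abs_increment_sub_le hy e)).2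
    have h2 : -B * Γ.len e ≤ (δ.slope e : ℝ) * Γ.len e := by linarith
    exact le_of_mul_le_mul_right h2 (Γ.len_pos e)
  have hw : ∀ e, |(δ.lastSlope D e + δ.slope e : ℝ)| ≤ B := fun e => abs_lastSlope_add_le e
  rcases eq_or_ne (y.1 (Γ.src e₀)) (y.1 (Γ.tgt e₀)) with heq | hne
  · exact abs_le.2 ⟨by linarith [hm' e₀ heq.le], by linarith [hm e₀ heq.ge]⟩
  let U : Set V := {v | max (y.1 (Γ.src e₀)) (y.1 (Γ.tgt e₀)) ≤ y.1 v}
  -- `T e` is the part of the balancing sum over `U` due to `e`.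
  let T : E → ℝ := fun e => (if Γ.src e ∈ U then (δ.slope e : ℝ) else 0) +
      (if Γ.tgt e ∈ U then (δ.lastSlope D e : ℝ) else 0)
  -- The worst case is an edge with only its end point in `U`: the slope there is bounded by minus
  -- the initial slope, up to `B`, and the initial slope is at least `-B`.
  have hT : ∀ e, T e ≤ 2 * B := by
    intro e
    have h1 := abs_le.1 (hw e)
    by_cases hs : Γ.src e ∈ U <;> by_cases ht : Γ.tgt e ∈ U
    · simp only [T, hs, ht, if_true]
      linarith
    · simp only [T, hs, ht, if_true, if_false]
      linarith [hm e ((not_le.1 ht).le.trans hs)]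
    · simp only [T, hs, ht, if_true, if_false]
      linarith [hm' e ((not_le.1 hs).le.trans ht)]
    · simp only [T, hs, ht, if_false]
      linarith
  have hsum : -B ≤ ∑ e, T e := h.neg_totalMass_le U
  have hT₀ : -B - 2 * B * Fintype.card E ≤ T e₀ := by
    have h1 := Finset.single_le_sum (f := fun e => 2 * B - T e)
      (fun e _ => sub_nonneg.2 (hT e)) (Finset.mem_univ e₀)
    simp only [Finset.sum_sub_distrib, Finset.sum_const, Finset.card_univ, nsmul_eq_mul] at h1
    linarith
  have h1 := abs_le.1 (hw e₀)
  rcases hne.lt_or_gt with hlt | hlt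
  · have hs : Γ.src e₀ ∉ U := not_le.2 (lt_max_of_lt_right hlt)
    have ht : Γ.tgt e₀ ∈ U := max_le hlt.le le_rfl
    simp only [T, hs, ht, if_true, if_false] at hT₀
    have := hm' e₀ hlt.le
    exact abs_le.2 ⟨by linarith, by linarith⟩
  · have ht : Γ.tgt e₀ ∉ U := not_le.2 (lt_max_of_lt_left hlt)
    have hs : Γ.src e₀ ∈ U := max_le le_rfl hlt.le
    simp only [T, hs, ht, if_true, if_false] at hT₀
    have := hm e₀ hlt.le
    exact abs_le.2 ⟨by linarith, by linarith⟩

end CellDatum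

/-- There are finitely many locations and preorders, and the slopes are integers bounded uniformly
by `abs_slope_le`. -/
theorem finite_cellIndex [Fintype V] [Fintype E] : Finite (CellIndex D n) := by
  obtain ⟨K, hK⟩ := exists_nat_ge (4 * CellDatum.totalMass D n +
    2 * CellDatum.totalMass D n * Fintype.card E)
  have hs : ∀ (c : CellIndex D n) e, c.1.slope e ∈ Icc (-(K : ℤ)) K := by
    intro c e
    obtain ⟨y, hy⟩ := c.2.2
    have := (CellDatum.abs_slope_le c.2.1 (CellDatum.openCell_subset_closedCell hy) e).trans hK
    exact abs_le.1 (by exact_mod_cast this)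
  have : Finite (Icc (-(K : ℤ)) K) := (finite_Icc _ _).to_subtype
  refine Finite.of_injective (β := (Fin n → V ⊕ E) × (Fin n → Fin n → Prop) ×
    (E → Icc (-(K : ℤ)) K)) (fun c => (c.1.loc, c.1.le, fun e => ⟨c.1.slope e, hs c e⟩)) ?_
  intro c c' h
  simp only [Prod.mk.injEq, funext_iff, Subtype.mk.injEq] at h
  refine Subtype.ext (CellDatum.ext (funext h.1) ?_ (funext h.2.2))
  exact funext fun i => funext fun j => h.2.1 i j

/-! ### Faces -/

namespace CellDatum

variable {δ δ' : CellDatum V E n} {y₀ y : Coord V n}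

/-- The point `y` satisfies all equations among the weak inequalities of the closed cell
that hold at `y₀`. -/
structure SameFace (Γ : TropicalCurve V E) (δ : CellDatum V E n) (y₀ y : Coord V n) : Prop where
  zero : ∀ i e, δ.loc i = Sum.inr e → y₀.2 i = 0 → y.2 i = 0
  len : ∀ i e, δ.loc i = Sum.inr e → y₀.2 i = Γ.len e → y.2 i = Γ.len e
  eq : ∀ i j, δ.le i j → y₀.2 i = y₀.2 j → y.2 i = y.2 j

theorem sameFace_of_extend (hy : y ∈ δ.closedCell D) {ε : ℝ} (hε : 0 < ε)
    (h : y₀ + ε • (y₀ - y) ∈ δ.closedCell D) : δ.SameFace Γ y₀ y where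
  zero i e hi h0 := by
    have h1 := (h.2.1 i e hi).1
    simp only [Prod.snd_add, Prod.smul_snd, Prod.snd_sub, Pi.add_apply, Pi.smul_apply,
      Pi.sub_apply, smul_eq_mul, h0, zero_add, zero_sub] at h1
    refine le_antisymm ?_ (hy.2.1 i e hi).1
    by_contra! h2
    linarith [mul_pos hε h2]
  len i e hi h0 := by
    have h1 := (h.2.1 i e hi).2
    simp only [Prod.snd_add, Prod.smul_snd, Prod.snd_sub, Pi.add_apply, Pi.smul_apply,
      Pi.sub_apply, smul_eq_mul, h0] at h1
    refine le_antisymm (hy.2.1 i e hi).2 ?_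
    by_contra! h2
    linarith [mul_pos hε (sub_pos.2 h2)]
  eq i j hij h0 := by
    have h1 := h.2.2.1 i j hij
    simp only [Prod.snd_add, Prod.smul_snd, Prod.snd_sub, Pi.add_apply, Pi.smul_apply,
      Pi.sub_apply, smul_eq_mul, h0] at h1
    refine le_antisymm (hy.2.2.1 i j hij) ?_
    by_contra! h2
    linarith [mul_pos hε (sub_pos.2 h2)]

/-- Inequalities strict at `y₀` survive a small step; those that are equalities at `y₀` are
equalities at `y`, hence along the whole line. -/
theorem SameFace.exists_extend [Finite E] (h : δ.SameFace Γ y₀ y) (hy₀ : y₀ ∈ δ.closedCell D)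
    (hy : y ∈ δ.closedCell D) : ∃ ε > (0 : ℝ), y₀ + ε • (y₀ - y) ∈ δ.closedCell D := by
  have hlim : ∀ i, Tendsto (fun ε : ℝ => y₀.2 i + ε * (y₀.2 i - y.2 i)) (𝓝[>] 0)
      (𝓝 (y₀.2 i)) := fun i => by
    have : Continuous fun ε : ℝ => y₀.2 i + ε * (y₀.2 i - y.2 i) := by fun_prop
    simpa using this.continuousAt.tendsto.mono_left (nhdsWithin_le_nhds (a := (0 : ℝ)))
  have h1 : ∀ᶠ ε : ℝ in 𝓝[>] 0, ∀ i e, δ.loc i = Sum.inr e →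
      0 ≤ y₀.2 i + ε * (y₀.2 i - y.2 i) := by
    simp only [eventually_all]
    intro i e hi
    rcases (hy₀.2.1 i e hi).1.eq_or_lt with h0 | h0
    · filter_upwards with ε
      rw [h.zero i e hi h0.symm, ← h0]
      simp
    · filter_upwards [(hlim i).eventually (Ioi_mem_nhds h0)] with ε hε using le_of_lt hε
  have h2 : ∀ᶠ ε : ℝ in 𝓝[>] 0, ∀ i e, δ.loc i = Sum.inr e →
      y₀.2 i + ε * (y₀.2 i - y.2 i) ≤ Γ.len e := by
    simp only [eventually_all]
    intro i e hi
    rcases (hy₀.2.1 i e hi).2.eq_or_lt with h0 | h0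
    · filter_upwards with ε
      rw [h.len i e hi h0, h0]
      simp
    · filter_upwards [(hlim i).eventually (Iio_mem_nhds h0)] with ε hε using le_of_lt hε
  have h3 : ∀ᶠ ε : ℝ in 𝓝[>] 0, ∀ i j, δ.le i j →
      y₀.2 i + ε * (y₀.2 i - y.2 i) ≤ y₀.2 j + ε * (y₀.2 j - y.2 j) := by
    simp only [eventually_all]
    intro i j hij
    rcases (hy₀.2.2.1 i j hij).eq_or_lt with h0 | h0
    · filter_upwards with ε
      rw [h.eq i j hij h0, h0]
    · filter_upwards [(hlim i).eventually_lt (hlim j) h0] with ε hε using hε.le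
  obtain ⟨ε, ⟨⟨h1, h2⟩, h3⟩, hε⟩ := (((h1.and h2).and h3).and self_mem_nhdsWithin).exists
  refine ⟨ε, hε, fun i v hi => ?_, fun i e hi => ⟨h1 i e hi, h2 i e hi⟩, h3,
    continuity_iff_form.2 fun e => ?_⟩
  · simp [hy.1 i v hi, hy₀.1 i v hi]
  · simp only [map_add, map_smul, map_sub, continuity_iff_form.1 hy.2.2.2 e,
      continuity_iff_form.1 hy₀.2.2.2 e, sub_self, smul_zero, add_zero]

open Classical in
/-- The discrete data `δ'` of the point of the closed cell `δ` with coordinates `y₀`. -/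
structure IsFaceDatum (Γ : TropicalCurve V E) (δ δ' : CellDatum V E n) (y₀ : Coord V n) : Prop where
  loc_inr : ∀ i e, δ'.loc i = Sum.inr e ↔ δ.loc i = Sum.inr e ∧ 0 < y₀.2 i ∧ y₀.2 i < Γ.len e
  loc_of_inl : ∀ i v, δ.loc i = Sum.inl v → δ'.loc i = Sum.inl v
  loc_of_zero : ∀ i e, δ.loc i = Sum.inr e → y₀.2 i = 0 → δ'.loc i = Sum.inl (Γ.src e)
  loc_of_len : ∀ i e, δ.loc i = Sum.inr e → y₀.2 i = Γ.len e → δ'.loc i = Sum.inl (Γ.tgt e)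
  le_iff : ∀ i j, δ'.le i j ↔
    ∃ e, δ'.loc i = Sum.inr e ∧ δ'.loc j = Sum.inr e ∧ y₀.2 i ≤ y₀.2 j
  slope_eq : ∀ e, δ'.slope e = δ.slope e +
    ∑ i with δ.loc i = Sum.inr e, (if y₀.2 i ≤ 0 then 1 else 0)

theorem isFaceDatum_datum {f : Γ.Rat} (hy₀ : y₀ ∈ δ.closedCell D) (hf : δ.Represents D f y₀) :
    IsFaceDatum Γ δ (datum f (δ.point Γ y₀)) y₀ := by
  have hinl : ∀ i v, δ.loc i = Sum.inl v → (δ.point Γ y₀ i).loc = Sum.inl v := fun i v hi => by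
    rw [point_of_inl hi]; rfl
  have hzero : ∀ i e, δ.loc i = Sum.inr e → y₀.2 i = 0 →
      (δ.point Γ y₀ i).loc = Sum.inl (Γ.src e) := fun i e hi h0 => by
    rw [point_of_inr hi, h0, edge_zero]; rfl
  have hlen : ∀ i e, δ.loc i = Sum.inr e → y₀.2 i = Γ.len e →
      (δ.point Γ y₀ i).loc = Sum.inl (Γ.tgt e) := fun i e hi h0 => by
    rw [point_of_inr hi, h0, edge_len]; rfl
  have hinner : ∀ i e, δ.loc i = Sum.inr e → (h : y₀.2 i ∈ Ioo 0 (Γ.len e)) →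
      δ.point Γ y₀ i = .inner e (y₀.2 i) h := fun i e hi h => by
    rw [point_of_inr hi, edge_of_mem h]
  have hinr : ∀ i e, (δ.point Γ y₀ i).loc = Sum.inr e ↔
      δ.loc i = Sum.inr e ∧ 0 < y₀.2 i ∧ y₀.2 i < Γ.len e := by
    intro i e
    constructor
    · intro h
      rcases hl : δ.loc i with v | e'
      · rw [hinl i v hl] at h
        cases h
      · rcases (hy₀.2.1 i e' hl).1.eq_or_lt with h0 | h0
        · rw [hzero i e' hl h0.symm] at h
          cases h
        rcases (hy₀.2.1 i e' hl).2.eq_or_lt with h1 | h1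
        · rw [hlen i e' hl h1] at h
          cases h
        rw [hinner i e' hl ⟨h0, h1⟩] at h
        cases h
        exact ⟨rfl, h0, h1⟩
    · rintro ⟨hi, h⟩
      rw [hinner i e hi h]
      rfl
  refine ⟨hinr, hinl, hzero, hlen, fun i j => exists_congr fun e => ?_, fun e => hf.startSlope_eq e⟩
  rw [← Pt.loc_eq_inr, ← Pt.loc_eq_inr]
  refine and_congr_right fun hi => and_congr_right fun hj => ?_
  obtain ⟨hi, hi'⟩ := (hinr i e).1 hi
  obtain ⟨hj, hj'⟩ := (hinr j e).1 hj
  rw [hinner i e hi hi', hinner j e hj hj']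
  rfl

namespace IsFaceDatum

/-- On `[0, l(e)]`, a kink at `0` contributes `t`, which is the change of the initial slope, and a
kink at `l(e)` contributes nothing. The other points are common to both data. -/
theorem edgeFun_eq (h : IsFaceDatum Γ δ δ' y₀) (hy₀ : y₀ ∈ δ.closedCell D)
    (hzero : ∀ i e, δ.loc i = Sum.inr e → y₀.2 i = 0 → y.2 i = 0)
    (hlen : ∀ i e, δ.loc i = Sum.inr e → y₀.2 i = Γ.len e → y.2 i = Γ.len e)
    {z : Coord V n} (hz₁ : z.1 = y.1) (hz₂ : ∀ i e, δ'.loc i = Sum.inr e → z.2 i = y.2 i)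
    {e : E} {t : ℝ} (ht : t ∈ Icc 0 (Γ.len e)) :
    δ'.edgeFun D z e t = δ.edgeFun D y e t := by
  classical
  have key : (∑ i with δ.loc i = Sum.inr e, max 0 (t - y.2 i)) =
      (∑ i with δ.loc i = Sum.inr e, if y₀.2 i ≤ 0 then (1 : ℝ) else 0) * t +
        ∑ i with δ'.loc i = Sum.inr e, max 0 (t - z.2 i) := by
    rw [Finset.sum_mul]
    simp only [Finset.sum_filter]
    rw [← Finset.sum_add_distrib]
    refine Finset.sum_congr rfl fun i _ => ?_
    by_cases hi : δ.loc i = Sum.inr e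
    · rcases (hy₀.2.1 i e hi).1.eq_or_lt with h0 | h0
      · simp [hi, h.loc_of_zero i e hi h0.symm, hzero i e hi h0.symm, ← h0, ht.1]
      rcases (hy₀.2.1 i e hi).2.eq_or_lt with h1 | h1
      · simp [hi, h.loc_of_len i e hi h1, hlen i e hi h1, h1, ht.2, (Γ.len_pos e).not_ge]
      · have h2 := (h.loc_inr i e).2 ⟨hi, h0, h1⟩
        simp [hi, h2, h0.not_ge, hz₂ i e h2]
    · have h2 : δ'.loc i ≠ Sum.inr e := fun h2 => hi ((h.loc_inr i e).1 h2).1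
      simp [hi, h2]
  rw [edgeFun, edgeFun, key, hz₁, h.slope_eq]
  push_cast
  ring

theorem point_eq (h : IsFaceDatum Γ δ δ' y₀) (hy₀ : y₀ ∈ δ.closedCell D)
    (hzero : ∀ i e, δ.loc i = Sum.inr e → y₀.2 i = 0 → y.2 i = 0)
    (hlen : ∀ i e, δ.loc i = Sum.inr e → y₀.2 i = Γ.len e → y.2 i = Γ.len e)
    {z : Coord V n} (hz₂ : ∀ i e, δ'.loc i = Sum.inr e → z.2 i = y.2 i) :
    δ.point Γ y = δ'.point Γ z := by
  funext i
  rcases hl : δ.loc i with v | e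
  · rw [point_of_inl hl, point_of_inl (h.loc_of_inl i v hl)]
  · rw [point_of_inr hl]
    rcases (hy₀.2.1 i e hl).1.eq_or_lt with h0 | h0
    · rw [point_of_inl (h.loc_of_zero i e hl h0.symm), hzero i e hl h0.symm, edge_zero]
    rcases (hy₀.2.1 i e hl).2.eq_or_lt with h1 | h1
    · rw [point_of_inl (h.loc_of_len i e hl h1), hlen i e hl h1, edge_len]
    · have h2 := (h.loc_inr i e).2 ⟨hl, h0, h1⟩
      rw [point_of_inr h2, hz₂ i e h2]

end IsFaceDatum

open Classical in
/-- The projection of coordinates to the face with discrete data `δ'`. -/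
noncomputable def faceProj (δ' : CellDatum V E n) : Coord V n →ₗ[ℝ] Coord V n where
  toFun y := (y.1, fun i => if ∃ e, δ'.loc i = Sum.inr e then y.2 i else 0)
  map_add' y z := by
    refine Prod.ext rfl (funext fun i => ?_)
    by_cases h : ∃ e, δ'.loc i = Sum.inr e <;> simp [h]
  map_smul' a y := by
    refine Prod.ext rfl (funext fun i => ?_)
    by_cases h : ∃ e, δ'.loc i = Sum.inr e <;> simp [h]

theorem faceProj_of_inr {i : Fin n} {e : E} (h : δ'.loc i = Sum.inr e) (y : Coord V n) :
    (faceProj δ' y).2 i = y.2 i :=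
  if_pos ⟨e, h⟩

theorem faceProj_of_inl {i : Fin n} {v : V} (h : δ'.loc i = Sum.inl v) (y : Coord V n) :
    (faceProj δ' y).2 i = 0 := by
  refine if_neg ?_
  rw [h]
  rintro ⟨e, he⟩
  cases he

namespace IsFaceDatum

theorem faceProj_mem (h : IsFaceDatum Γ δ δ' y₀) (hy₀ : y₀ ∈ δ.closedCell D)
    (hy : y ∈ δ.closedCell D) (hF : δ.SameFace Γ y₀ y) :
    faceProj δ' y ∈ δ'.closedCell D := by
  have hE : ∀ i e, δ'.loc i = Sum.inr e → 0 ≤ (faceProj δ' y).2 i ∧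
      (faceProj δ' y).2 i ≤ Γ.len e := fun i e hi => by
    rw [faceProj_of_inr hi]
    exact hy.2.1 i e ((h.loc_inr i e).1 hi).1
  refine ⟨fun i v hi => faceProj_of_inl hi y, hE, fun i j hij => ?_,
    (continuity_iff hE).2 fun e => ?_⟩
  · obtain ⟨e, hi, hj, hle⟩ := (h.le_iff i j).1 hij
    rw [faceProj_of_inr hi, faceProj_of_inr hj]
    -- If `δ` orders the two points the other way, they coincide at `y₀`, hence at every `y` in the
    -- same face.
    rcases δ.le_total i j e ((h.loc_inr i e).1 hi).1 ((h.loc_inr j e).1 hj).1 with h1 | h1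
    · exact hy.2.2.1 i j h1
    · exact (hF.eq j i h1 (le_antisymm (hy₀.2.2.1 j i h1) hle)).ge
  · rw [h.edgeFun_eq (z := faceProj δ' y) hy₀ hF.zero hF.len rfl (fun i e hi => faceProj_of_inr hi y)
      ⟨(Γ.len_pos e).le, le_rfl⟩]
    exact (continuity_iff (inEdges_of_mem hy)).1 hy.2.2.2 e

theorem exists_faceProj_eq (h : IsFaceDatum Γ δ δ' y₀) (hy₀ : y₀ ∈ δ.closedCell D)
    {z : Coord V n} (hz : z ∈ δ'.closedCell D) :
    ∃ y ∈ δ.closedCell D, δ.SameFace Γ y₀ y ∧ faceProj δ' y = z := by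
  classical
  -- The missing coordinates belong to points at vertices; those that came from an edge stay at the
  -- end where `y₀` has them.
  let y : Coord V n := (z.1, fun i => if ∃ e, δ'.loc i = Sum.inr e then z.2 i else y₀.2 i)
  have hinr : ∀ {i e}, δ'.loc i = Sum.inr e → y.2 i = z.2 i := fun hi => if_pos ⟨_, hi⟩
  have hinl : ∀ {i v}, δ'.loc i = Sum.inl v → y.2 i = y₀.2 i := fun {i v} hi => by
    refine if_neg ?_
    rw [hi]
    rintro ⟨e, he⟩
    cases he
  have hloc : ∀ {i e}, δ.loc i = Sum.inr e →
      (y₀.2 i = 0 ∧ y.2 i = 0) ∨ (y₀.2 i = Γ.len e ∧ y.2 i = Γ.len e) ∨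
        (δ'.loc i = Sum.inr e ∧ y.2 i = z.2 i ∧ 0 < y₀.2 i ∧ y₀.2 i < Γ.len e) := by
    intro i e hi
    rcases (hy₀.2.1 i e hi).1.eq_or_lt with h0 | h0
    · exact Or.inl ⟨h0.symm, (hinl (h.loc_of_zero i e hi h0.symm)).trans h0.symm⟩
    rcases (hy₀.2.1 i e hi).2.eq_or_lt with h1 | h1
    · exact Or.inr (Or.inl ⟨h1, (hinl (h.loc_of_len i e hi h1)).trans h1⟩)
    · have h2 := (h.loc_inr i e).2 ⟨hi, h0, h1⟩
      exact Or.inr (Or.inr ⟨h2, hinr h2, h0, h1⟩)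
  have hE : ∀ i e, δ.loc i = Sum.inr e → 0 ≤ y.2 i ∧ y.2 i ≤ Γ.len e := by
    intro i e hi
    have hl := Γ.len_pos e
    rcases hloc hi with ⟨-, h1⟩ | ⟨-, h1⟩ | ⟨h2, h1, -⟩
    · rw [h1]; exact ⟨le_rfl, hl.le⟩
    · rw [h1]; exact ⟨hl.le, le_rfl⟩
    · rw [h1]; exact hz.2.1 i e h2
  have hzero : ∀ i e, δ.loc i = Sum.inr e → y₀.2 i = 0 → y.2 i = 0 := by
    intro i e hi h0
    rcases hloc hi with ⟨-, h1⟩ | ⟨h1, -⟩ | ⟨-, -, h1, -⟩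
    · exact h1
    · linarith [Γ.len_pos e]
    · linarith
  have hlen : ∀ i e, δ.loc i = Sum.inr e → y₀.2 i = Γ.len e → y.2 i = Γ.len e := by
    intro i e hi h0
    rcases hloc hi with ⟨h1, -⟩ | ⟨-, h1⟩ | ⟨-, -, -, h1⟩
    · linarith [Γ.len_pos e]
    · exact h1
    · linarith
  have hle : ∀ i j, δ.le i j → y.2 i ≤ y.2 j := by
    intro i j hij
    obtain ⟨e, hi, hj⟩ := δ.le_edge i j hij
    have h0 := hy₀.2.2.1 i j hij
    rcases hloc hi with ⟨-, h1⟩ | ⟨h1, -⟩ | ⟨h1, h2, h3, -⟩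
    · rw [h1]; exact (hE j e hj).1
    · rw [hlen j e hj (le_antisymm (hy₀.2.1 j e hj).2 (h1 ▸ h0))]; exact (hE i e hi).2
    · rcases hloc hj with ⟨k1, -⟩ | ⟨-, k1⟩ | ⟨k1, k2, -⟩
      · linarith
      · rw [k1]; exact (hE i e hi).2
      · rw [h2, k2]
        exact hz.2.2.1 i j ((h.le_iff i j).2 ⟨e, h1, k1, h0⟩)
  have heq : ∀ i j, δ.le i j → y₀.2 i = y₀.2 j → y.2 i = y.2 j := by
    intro i j hij h0
    obtain ⟨e, hi, hj⟩ := δ.le_edge i j hij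
    rcases hloc hi with ⟨h2, h1⟩ | ⟨h2, h1⟩ | ⟨h1, h2, h3, h4⟩
    · rw [h1, hzero j e hj (h0 ▸ h2)]
    · rw [h1, hlen j e hj (h0 ▸ h2)]
    · have hj' := (h.loc_inr j e).2 ⟨hj, h0 ▸ h3, h0 ▸ h4⟩
      rw [h2, hinr hj']
      exact le_antisymm (hz.2.2.1 i j ((h.le_iff i j).2 ⟨e, h1, hj', h0.le⟩))
        (hz.2.2.1 j i ((h.le_iff j i).2 ⟨e, hj', h1, h0.ge⟩))
  refine ⟨y, ⟨fun i v hi => ?_, hE, hle, (continuity_iff hE).2 fun e => ?_⟩, ⟨hzero, hlen, heq⟩, ?_⟩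
  · rw [hinl (h.loc_of_inl i v hi), hy₀.1 i v hi]
  · rw [← h.edgeFun_eq (z := z) hy₀ hzero hlen rfl (fun i e hi => (hinr hi).symm)
      ⟨(Γ.len_pos e).le, le_rfl⟩]
    exact (continuity_iff (inEdges_of_mem hz)).1 hz.2.2.2 e
  · refine Prod.ext rfl (funext fun i => ?_)
    rcases hl : δ'.loc i with v | e
    · rw [faceProj_of_inl hl, hz.1 i v hl]
    · rw [faceProj_of_inr hl, hinr hl]

end IsFaceDatum

end CellDatum

/-- A relatively interior point `y₀` of `F` determines the target cell, and `F` consists of the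
points that satisfy the equations holding at `y₀`. The affine map forgets the positions of points
that have reached vertices; it loses nothing on `F`, where they are constant. -/
theorem exists_face_chart [Fintype V] [Fintype E] (c : CellIndex D n) {F : Set (Coord V n)}
    (hF : IsExposed ℝ (c.1.closedCell D) F) (hne : F.Nonempty) :
    ∃ (c' : CellIndex D n) (A : Coord V n →ᵃ[ℝ] Coord V n), A '' F = c'.1.closedCell D ∧
      ∀ y ∈ F, chart c' (A y) = chart c y := by
  obtain ⟨y₀, hy₀F, hiff⟩ :=
    hF.exists_mem_iff (CellDatum.isPolyhedron_closedCell c.1 D).convex hne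
  have hy₀ := hF.subset hy₀F
  have hface : CellDatum.IsFaceDatum Γ c.1 (cellOf (chart c y₀)).1 y₀ := by
    have := CellDatum.isFaceDatum_datum hy₀ (represents_chart hy₀)
    rwa [← chart_points hy₀] at this
  have hmem : ∀ y ∈ c.1.closedCell D, y ∈ F ↔ c.1.SameFace Γ y₀ y := by
    intro y hy
    rw [hiff y hy]
    constructor
    · rintro ⟨ε, hε, h⟩
      exact CellDatum.sameFace_of_extend hy hε h
    · intro h
      exact h.exists_extend hy₀ hy
  refine ⟨cellOf (chart c y₀), (CellDatum.faceProj (cellOf (chart c y₀)).1).toAffineMap,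
    Subset.antisymm ?_ ?_, ?_⟩
  · rintro _ ⟨y, hy, rfl⟩
    exact hface.faceProj_mem hy₀ (hF.subset hy) ((hmem y (hF.subset hy)).1 hy)
  · intro z hz
    obtain ⟨y, hy, hy', rfl⟩ := hface.exists_faceProj_eq hy₀ hz
    exact ⟨y, (hmem y hy).2 hy', rfl⟩
  · intro y hyF
    have hy := hF.subset hyF
    have hS := (hmem y hy).1 hyF
    refine chart_eq (hface.faceProj_mem hy₀ hy hS) ⟨(represents_chart hy).1, fun e t ht => ?_⟩ ?_
    · rw [(represents_chart hy).2 e t ht]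
      exact (hface.edgeFun_eq (z := CellDatum.faceProj _ y) hy₀ hS.zero hS.len rfl
        (fun i e hi => CellDatum.faceProj_of_inr hi y) ht).symm
    · rw [chart_points hy]
      exact hface.point_eq hy₀ hS.zero hS.len fun i e hi => CellDatum.faceProj_of_inr hi y

end TropicalCurve

/-! ### Polyhedral structures on quotients -/

/-- The exposing form of `F`, composed with the linear part of `A`, exposes the preimage. -/
theorem IsExposed.preimage_affineMap {W W' : Type*} [NormedAddCommGroup W] [NormedSpace ℝ W]
    [FiniteDimensional ℝ W] [NormedAddCommGroup W'] [NormedSpace ℝ W'] {P : Set W} {P' F : Set W'}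
    (A : W →ᵃ[ℝ] W') (hA : A '' P = P') (hF : IsExposed ℝ P' F) (hne : F.Nonempty) :
    IsExposed ℝ P (P ∩ A ⁻¹' F) := by
  intro _
  obtain ⟨l, hl⟩ := hF hne
  have hlin : ∀ x y, l (A x) ≤ l (A y) ↔ l (A.linear x) ≤ l (A.linear y) := by
    intro x y
    rw [A.decomp]
    simp
  refine ⟨l.comp A.linear.toContinuousLinearMap, ?_⟩
  ext x
  simp only [hl, mem_inter_iff, mem_preimage, mem_ofPred_eq, ContinuousLinearMap.comp_apply,
    LinearMap.coe_toContinuousLinearMap', ← hlin]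
  refine and_congr_right fun hx => ?_
  rw [and_iff_right (hA ▸ mem_image_of_mem A hx), ← hA, forall_mem_image]

/-- A polyhedral complex descends along a quotient map that is affine in the charts. -/
theorem IsPolyhedralComplex.descend {ι κ W W' X Y : Type*} [NormedAddCommGroup W]
    [NormedSpace ℝ W] [FiniteDimensional ℝ W] [NormedAddCommGroup W'] [NormedSpace ℝ W']
    [FiniteDimensional ℝ W'] [TopologicalSpace X] [TopologicalSpace Y]
    {P : ι → Set W} {φ : ι → W → X} {P' : κ → Set W'} {ψ : κ → W' → Y}
    (hX : IsPolyhedralComplex P φ) {q : X → Y} (hq : IsQuotientMap q) {r : ι → κ}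
    (A : ι → W →ᵃ[ℝ] W') (hP' : ∀ k, IsPolyhedron (P' k)) (hA : ∀ i, A i '' P i = P' (r i))
    (hψ : ∀ i, ∀ y ∈ P i, ψ (r i) (A i y) = q (φ i y))
    (hri : ∀ i, A i '' intrinsicInterior ℝ (P i) = intrinsicInterior ℝ (P' (r i)))
    (hs : ∀ k, ∃ i, r i = k ∧ ∃ s : W' →ᵃ[ℝ] W, MapsTo s (P' k) (P i) ∧ ∀ z ∈ P' k, A i (s z) = z)
    (hinj : ∀ k, InjOn (ψ k) (P' k))
    (hsep : ∀ i i' y y', y ∈ intrinsicInterior ℝ (P i) → y' ∈ intrinsicInterior ℝ (P i') →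
      q (φ i y) = q (φ i' y') → r i = r i') :
    IsPolyhedralComplex P' ψ where
  finite := by
    have := hX.finite
    exact Finite.of_surjective r fun k => (hs k).imp fun i hi => hi.1
  isPolyhedron := hP'
  nonempty k := by
    obtain ⟨i, rfl, -⟩ := hs k
    rw [← hA]
    exact (hX.nonempty i).image _
  continuousOn k := by
    obtain ⟨i, rfl, s, hs, hs'⟩ := hs k
    -- The affine section `s` expresses the chart downstairs as `q ∘ φ ∘ s`.
    have h1 : ContinuousOn (fun z => q (φ i (s z))) (P' (r i)) :=
      hq.continuous.comp_continuousOn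
        ((hX.continuousOn i).comp s.continuous_of_finiteDimensional.continuousOn hs)
    refine h1.congr fun z hz => ?_
    beta_reduce
    rw [← hψ i _ (hs hz), hs' z hz]
  injOn := hinj
  partition y := by
    obtain ⟨x, rfl⟩ := hq.surjective y
    obtain ⟨i, ⟨z, hz, rfl⟩, -⟩ := hX.partition x
    refine ⟨r i, ⟨A i z, hri i ▸ mem_image_of_mem _ hz, hψ i z (intrinsicInterior_subset hz)⟩, ?_⟩
    rintro k ⟨w, hw, hwz⟩
    obtain ⟨j, rfl, -⟩ := hs k
    rw [← hri] at hw
    obtain ⟨u, hu, rfl⟩ := hw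
    rw [hψ j u (intrinsicInterior_subset hu)] at hwz
    exact hsep j i u z hu hz hwz
  face k F hF hne := by
    obtain ⟨i, rfl, s, hs, hs'⟩ := hs k
    -- The face `F` is pulled back to a face of `P i`, identified there with a cell of `X`, and
    -- pushed down again.
    have hne' : (P i ∩ A i ⁻¹' F).Nonempty := by
      obtain ⟨z, hz⟩ := hne
      refine ⟨s z, hs (hF.subset hz), ?_⟩
      rwa [mem_preimage, hs' z (hF.subset hz)]
    obtain ⟨j, B, hB, hB'⟩ := hX.face i _ (hF.preimage_affineMap (A i) (hA i) hne) hne'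
    have hsF : ∀ z ∈ F, s z ∈ P i ∩ A i ⁻¹' F := fun z hz =>
      ⟨hs (hF.subset hz), by rwa [mem_preimage, hs' z (hF.subset hz)]⟩
    have hBP : ∀ z ∈ P i ∩ A i ⁻¹' F, B z ∈ P j := fun z hz => hB ▸ mem_image_of_mem B hz
    have hval : ∀ z ∈ P i ∩ A i ⁻¹' F, ψ (r j) (A j (B z)) = ψ (r i) (A i z) := fun z hz => by
      rw [hψ j _ (hBP z hz), hB' z hz, hψ i z hz.1]
    have hmaps : ∀ z ∈ P i ∩ A i ⁻¹' F, A j (B z) ∈ P' (r j) := fun z hz =>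
      hA j ▸ mem_image_of_mem _ (hBP z hz)
    refine ⟨r j, ((A j).comp B).comp s, Subset.antisymm ?_ ?_, fun z hz => ?_⟩
    · rintro _ ⟨z, hz, rfl⟩
      exact hmaps _ (hsF z hz)
    · intro w hw
      rw [← hA, ← hB] at hw
      obtain ⟨_, ⟨u, hu, rfl⟩, rfl⟩ := hw
      -- The points `s (A i u)` and `u` may differ, but their images in `Y` agree, so injectivity of
      -- the chart of `Y` identifies the resulting coordinates.
      refine ⟨A i u, hu.2, hinj (r j) (hmaps _ (hsF _ hu.2)) (hmaps u hu) ?_⟩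
      rw [hval _ (hsF _ hu.2), hval u hu, hs' _ (hF.subset hu.2)]
    · change ψ (r j) (A j (B (s z))) = _
      rw [hval _ (hsF z hz), hs' z (hF.subset hz)]
  isClosed C hC := by
    rw [← hq.isClosed_preimage]
    refine hX.isClosed _ fun i => ?_
    have hPi := (hX.isPolyhedron i).isClosed
    have : P i ∩ φ i ⁻¹' (q ⁻¹' C) = P i ∩ A i ⁻¹' (P' (r i) ∩ ψ (r i) ⁻¹' C) := by
      ext y
      simp only [mem_inter_iff, mem_preimage]
      refine and_congr_right fun hy => ?_
      rw [hψ i y hy, and_iff_right (hA i ▸ mem_image_of_mem _ hy)]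
    rw [this]
    exact hPi.inter ((hC (r i)).preimage (A i).continuous_of_finiteDimensional)

namespace TropicalCurve

variable {V E : Type*} {Γ : TropicalCurve V E} {n : ℕ} {D : Γ.Divisor}

/-! ### Continuity and properness of the charts -/

theorem abs_pos_le [Fintype E] (δ : CellDatum V E n) {y : Coord V n} (hy : y ∈ δ.closedCell D) (i : Fin n) :
    |y.2 i| ≤ ∑ e, Γ.len e := by
  have h0 : ∀ e ∈ Finset.univ, 0 ≤ Γ.len e := fun e _ => (Γ.len_pos e).le
  rcases hl : δ.loc i with v | e
  · rw [hy.1 i v hl, abs_zero]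
    exact Finset.sum_nonneg h0
  · have := hy.2.1 i e hl
    rw [abs_of_nonneg this.1]
    exact this.2.trans (Finset.single_le_sum h0 (Finset.mem_univ e))

/-- Each kink depends on its position with Lipschitz constant one, there are at most `n` of them,
and the terms of `D` and of the slope cancel. -/
theorem CellDatum.abs_edgeFun_sub_le [Fintype V] (δ : CellDatum V E n) (D : Γ.Divisor)
    (y z : Coord V n) (e : E) (t : ℝ) :
    |δ.edgeFun D y e t - δ.edgeFun D z e t| ≤ (n + 1) * dist y z := by
  classical
  have h1 : |y.1 (Γ.src e) - z.1 (Γ.src e)| ≤ dist y z :=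
    (dist_le_pi_dist y.1 z.1 _).trans (le_max_left _ _)
  have h2 : ∀ i, |max 0 (t - y.2 i) - max 0 (t - z.2 i)| ≤ dist y z := fun i => by
    rw [max_comm 0, max_comm 0]
    refine (abs_max_sub_max_le_abs _ _ _).trans ?_
    rw [sub_sub_sub_cancel_left, abs_sub_comm]
    exact (dist_le_pi_dist y.2 z.2 i).trans (le_max_right _ _)
  have h3 : |∑ i with δ.loc i = Sum.inr e, (max 0 (t - y.2 i) - max 0 (t - z.2 i))| ≤
      n * dist y z := by
    refine (Finset.abs_sum_le_sum_abs _ _).trans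
      ((Finset.sum_le_card_nsmul _ _ _ fun i _ => h2 i).trans ?_)
    rw [nsmul_eq_mul]
    refine mul_le_mul_of_nonneg_right ?_ dist_nonneg
    exact_mod_cast (Finset.card_le_univ _).trans (Fintype.card_fin n).le
  have h4 : δ.edgeFun D y e t - δ.edgeFun D z e t = (y.1 (Γ.src e) - z.1 (Γ.src e)) +
      ∑ i with δ.loc i = Sum.inr e, (max 0 (t - y.2 i) - max 0 (t - z.2 i)) := by
    rw [edgeFun, edgeFun, Finset.sum_sub_distrib]
    ring
  rw [h4]
  refine (abs_add_le _ _).trans ((add_le_add h1 h3).trans (le_of_eq ?_))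
  ring

variable [Fintype V] [Fintype E]

theorem dist_chart_le (c : CellIndex D n) {y z : Coord V n} (hy : y ∈ c.1.closedCell D)
    (hz : z ∈ c.1.closedCell D) :
    dist (chart c y).1.1.1 (chart c z).1.1.1 ≤ (n + 1) * dist y z := by
  refine (ContinuousMap.dist_le (by positivity)).2 ?_
  have h1 : dist y z ≤ (n + 1) * dist y z := by
    have : 0 ≤ n * dist y z := by positivity
    linarith
  rintro (v | ⟨e, t, ht⟩)
  · rw [(represents_chart hy).1, (represents_chart hz).1]
    exact ((dist_le_pi_dist y.1 z.1 v).trans (le_max_left _ _)).trans h1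
  · rw [← edge_of_mem ht, (represents_chart hy).2 e t ⟨ht.1.le, ht.2.le⟩,
      (represents_chart hz).2 e t ⟨ht.1.le, ht.2.le⟩]
    exact c.1.abs_edgeFun_sub_le D y z e t

theorem continuousOn_chart (c : CellIndex D n) : ContinuousOn (chart c) (c.1.closedCell D) := by
  rw [IsInducing.subtypeVal.continuousOn_iff]
  refine ContinuousOn.prodMk ?_ ?_
  · refine (IsInducing.induced Subtype.val).continuousOn_iff.2 ?_
    refine LipschitzOnWith.continuousOn (K := n + 1) (LipschitzOnWith.of_dist_le_mul ?_)
    intro y hy z hz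
    exact_mod_cast dist_chart_le c hy hz
  · refine continuousOn_pi.2 fun i => ?_
    rcases hl : c.1.loc i with v | e
    · refine (continuousOn_const (c := Pt.vertex v)).congr fun y hy => ?_
      simp only [chart_points hy, CellDatum.point_of_inl hl]
    · refine ((continuous_edge e).comp (f := fun y : Coord V n => y.2 i)
        (by fun_prop)).continuousOn.congr fun y hy => ?_
      simp only [Function.comp_apply, chart_points hy, CellDatum.point_of_inr hl]

/-- Near a limit point `x`, the values `ev` confine `y.1` to a ball, and `y.2` is bounded anyway. So
only a compact part of `K` matters, and its image is closed. -/
theorem isClosed_image_of_proper {X : Type*} [TopologicalSpace X] [T2Space X]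
    {P K : Set (Coord V n)} {g : Coord V n → X} (hg : ContinuousOn g P) {ev : X → V → ℝ}
    (hev : Continuous ev) (hgev : ∀ y ∈ P, ev (g y) = y.1) {B : ℝ} (hB : ∀ y ∈ P, ∀ i, |y.2 i| ≤ B)
    (hK : IsClosed K) (hKP : K ⊆ P) : IsClosed (g '' K) := by
  refine isClosed_of_closure_subset fun x hx => ?_
  let L : Set (Coord V n) := K ∩ Metric.closedBall (ev x) 1 ×ˢ Metric.closedBall 0 |B|
  have hL : IsCompact L := ((isCompact_closedBall _ _).prod (isCompact_closedBall _ _)).inter_left hK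
  have hgL : IsClosed (g '' L) :=
    (hL.image_of_continuousOn (hg.mono (inter_subset_left.trans hKP))).isClosed
  have hN : ev ⁻¹' Metric.closedBall (ev x) 1 ∈ 𝓝 x :=
    hev.continuousAt.preimage_mem_nhds (Metric.closedBall_mem_nhds _ one_pos)
  have hx' : x ∈ closure (g '' L) := by
    rw [mem_closure_iff_nhds] at hx ⊢
    intro U hU
    obtain ⟨_, ⟨hyU, hyN⟩, y, hyK, rfl⟩ := hx _ (inter_mem hU hN)
    refine ⟨g y, hyU, y, ⟨hyK, ?_, ?_⟩, rfl⟩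
    · rw [mem_preimage, hgev y (hKP hyK)] at hyN
      exact hyN
    · rw [mem_closedBall_zero_iff, pi_norm_le_iff_of_nonneg (abs_nonneg _)]
      exact fun i => (hB y (hKP hyK) i).trans (le_abs_self B)
  rw [hgL.closure_eq] at hx'
  exact image_mono inter_subset_left hx'

theorem continuous_eval_vertices :
    Continuous fun (f : R D) (v : V) => f.1.1 (Pt.vertex v) :=
  continuous_pi fun v =>
    (continuous_eval_const (Pt.vertex v)).comp
      (continuous_subtype_val.comp continuous_subtype_val)

theorem continuous_forget : Continuous (forget D n) :=
  Continuous.subtype_mk (continuous_fst.comp continuous_subtype_val) _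

theorem isClosed_chart_image (c : CellIndex D n) {K : Set (Coord V n)} (hK : IsClosed K)
    (hKP : K ⊆ c.1.closedCell D) : IsClosed (chart c '' K) :=
  isClosed_image_of_proper (continuousOn_chart c) (continuous_eval_vertices.comp continuous_forget)
    (fun _ hy => funext fun v => (represents_chart hy).1 v) (fun _ hy => abs_pos_le c.1 hy) hK hKP

theorem isClosed_forget_chart_image (c : CellIndex D n) {K : Set (Coord V n)} (hK : IsClosed K)
    (hKP : K ⊆ c.1.closedCell D) : IsClosed ((fun y => forget D n (chart c y)) '' K) :=
  isClosed_image_of_proper (continuous_forget.comp_continuousOn (continuousOn_chart c))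
    continuous_eval_vertices
    (fun _ hy => funext fun v => (represents_chart hy).1 v) (fun _ hy => abs_pos_le c.1 hy) hK hKP

/-- This reduces closedness in `S(D)`, and of images under `forget`, to the finitely many closed
cells. -/
theorem eq_iUnion_chart (C : Set (S D n)) :
    C = ⋃ c : CellIndex D n, chart c '' (c.1.closedCell D ∩ chart c ⁻¹' C) := by
  ext x
  simp only [mem_iUnion]
  constructor
  · intro hx
    refine ⟨cellOf x, coord x.1.1 x.1.2,
      ⟨CellDatum.openCell_subset_closedCell (coord_mem_openCell x.2), ?_⟩, chart_cellOf x⟩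
    rwa [mem_preimage, chart_cellOf]
  · rintro ⟨c, y, ⟨-, hy⟩, rfl⟩
    exact hy

theorem isPolyhedralComplex_chart :
    IsPolyhedralComplex (fun c : CellIndex D n => c.1.closedCell D) chart where
  finite := finite_cellIndex
  isPolyhedron c := CellDatum.isPolyhedron_closedCell c.1 D
  nonempty c := c.2.2.mono CellDatum.openCell_subset_closedCell
  continuousOn := continuousOn_chart
  injOn c y hy y' hy' h := injOn_forget_chart c hy hy' (congrArg (forget D n) h)
  partition x := by
    have := existsUnique_mem_chart_image x
    simpa only [fun c : CellIndex D n => CellDatum.intrinsicInterior_closedCell c.2.2] using this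
  face c F hF hne := exists_face_chart c hF hne
  isClosed C hC := by
    have := finite_cellIndex (D := D) (n := n)
    rw [eq_iUnion_chart C]
    exact isClosed_iUnion_of_finite fun c => isClosed_chart_image c (hC c) inter_subset_left

theorem isClosedMap_forget : IsClosedMap (forget D n) := by
  intro C hC
  have := finite_cellIndex (D := D) (n := n)
  rw [eq_iUnion_chart C, image_iUnion]
  refine isClosed_iUnion_of_finite fun c => ?_
  rw [← image_comp]
  exact isClosed_forget_chart_image c ((continuousOn_chart c).preimage_isClosed_of_isClosed
    (CellDatum.isPolyhedron_closedCell c.1 D).isClosed hC) inter_subset_left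

end TropicalCurve

/-! ### Effective divisors as sums of points -/

theorem exists_perm_of_sum_single_eq {α : Type*} {n : ℕ} {p q : Fin n → α}
    (h : ∑ i, Finsupp.single (p i) (1 : ℤ) = ∑ i, Finsupp.single (q i) (1 : ℤ)) :
    ∃ σ : Equiv.Perm (Fin n), ∀ i, q i = p (σ i) := by
  classical
  -- The coefficient at `a` is the number of indices mapped to `a`, so corresponding fibres can be
  -- matched bijectively.
  have hc : ∀ a, Fintype.card {i // q i = a} = Fintype.card {i // p i = a} := by
    intro a
    have h1 := DFunLike.congr_fun h a
    simp only [Finsupp.finsetSum_apply, Finsupp.single_apply] at h1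
    rw [Fintype.card_subtype, Fintype.card_subtype, Finset.card_filter, Finset.card_filter]
    exact_mod_cast h1.symm
  exact ⟨Equiv.ofFiberEquiv fun a => Fintype.equivOfCardEq (hc a),
    fun i => (Equiv.ofFiberEquiv_map _ i).symm⟩

/-- Every point is listed as often as its coefficient says. The number of points is left open here;
later the degree determines it. -/
theorem exists_eq_sum_single {α : Type*} {D : α →₀ ℤ} (hD : 0 ≤ D) :
    ∃ (N : ℕ) (p : Fin N → α), D = ∑ i, Finsupp.single (p i) 1 := by
  classical
  let T := Σ a : D.support, Fin (D a).toNat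
  refine ⟨Fintype.card T, fun i => ((Fintype.equivFin T).symm i).1, ?_⟩
  rw [(Fintype.equivFin T).symm.sum_comp (fun t : T => Finsupp.single (t.1 : α) (1 : ℤ)),
    Fintype.sum_sigma]
  simp only [Finset.sum_const, Finset.card_univ, Fintype.card_fin, Finsupp.smul_single, nsmul_eq_mul,
    mul_one]
  conv_lhs => rw [← D.sum_single]
  rw [Finsupp.sum, ← Finset.sum_coe_sort]
  refine Finset.sum_congr rfl fun a _ => ?_
  rw [Int.toNat_of_nonneg (hD a)]

namespace TropicalCurve

variable {V E : Type*} {Γ : TropicalCurve V E} {n : ℕ} {D : Γ.Divisor}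

/-! ### The symmetric group -/

namespace CellDatum

variable {δ δ' : CellDatum V E n} {y : Coord V n} {σ : Equiv.Perm (Fin n)}

/-- The data `δ'` arise from `δ` by the permutation `σ`. -/
structure PermBy (σ : Equiv.Perm (Fin n)) (δ' δ : CellDatum V E n) : Prop where
  loc : ∀ i, δ'.loc i = δ.loc (σ i)
  le : ∀ i j, δ'.le i j ↔ δ.le (σ i) (σ j)
  slope : δ'.slope = δ.slope

theorem isPermOf_iff : δ'.IsPermOf δ ↔ ∃ σ, PermBy σ δ' δ :=
  exists_congr fun _ => ⟨fun h => ⟨h.1, h.2.1, h.2.2⟩, fun h => ⟨h.1, h.2, h.3⟩⟩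

theorem PermBy.symm (h : PermBy σ δ' δ) : PermBy σ⁻¹ δ δ' :=
  ⟨fun i => by simp [h.loc], fun i j => by simp [h.le], h.slope.symm⟩

/-- Permutation of the coordinates of the points. -/
noncomputable def permCoord (V : Type*) (σ : Equiv.Perm (Fin n)) : Coord V n →ₗ[ℝ] Coord V n :=
  LinearMap.prodMap LinearMap.id (LinearMap.funLeft ℝ ℝ σ)

theorem permCoord_fst (y : Coord V n) : (permCoord V σ y).1 = y.1 := rfl

theorem permCoord_snd (y : Coord V n) (i : Fin n) : (permCoord V σ y).2 i = y.2 (σ i) := rfl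

theorem permCoord_inv (y : Coord V n) : permCoord V σ (permCoord V σ⁻¹ y) = y :=
  Prod.ext rfl (funext fun i => by simp [permCoord_snd])

theorem PermBy.edgeFun_permCoord (h : PermBy σ δ' δ) (y : Coord V n) (e : E) (t : ℝ) :
    δ'.edgeFun D (permCoord V σ y) e t = δ.edgeFun D y e t := by
  classical
  have key : (∑ i with δ'.loc i = Sum.inr e, max 0 (t - (permCoord V σ y).2 i)) =
      ∑ i with δ.loc i = Sum.inr e, max 0 (t - y.2 i) := by
    simp only [Finset.sum_filter, h.loc, permCoord_snd]
    exact Equiv.sum_comp σ fun i => if δ.loc i = Sum.inr e then max 0 (t - y.2 i) else 0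
  rw [edgeFun, edgeFun, key, h.slope, permCoord_fst]

theorem PermBy.represents (h : PermBy σ δ' δ) {f : Γ.Rat} (hf : δ.Represents D f y) :
    δ'.Represents D f (permCoord V σ y) :=
  ⟨hf.1, fun e t ht => (hf.2 e t ht).trans (h.edgeFun_permCoord y e t).symm⟩

theorem PermBy.continuity (h : PermBy σ δ' δ) (hy : δ.InEdges Γ y) (hc : δ.Continuity D y) :
    δ'.Continuity D (permCoord V σ y) := by
  have hy' : δ'.InEdges Γ (permCoord V σ y) := fun i e hi => hy (σ i) e (h.loc i ▸ hi)
  refine (continuity_iff hy').2 fun e => ?_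
  rw [h.edgeFun_permCoord]
  exact (continuity_iff hy).1 hc e

theorem PermBy.permCoord_mem_closedCell (h : PermBy σ δ' δ) (hy : y ∈ δ.closedCell D) :
    permCoord V σ y ∈ δ'.closedCell D :=
  ⟨fun i v hi => hy.1 (σ i) v (h.loc i ▸ hi), fun i e hi => hy.2.1 (σ i) e (h.loc i ▸ hi),
    fun i j hij => hy.2.2.1 _ _ ((h.le i j).1 hij),
    h.continuity (inEdges_of_mem hy) hy.2.2.2⟩

theorem PermBy.permCoord_mem_openCell (h : PermBy σ δ' δ) (hy : y ∈ δ.openCell D) :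
    permCoord V σ y ∈ δ'.openCell D :=
  ⟨fun i v hi => hy.1 (σ i) v (h.loc i ▸ hi), fun i e hi => hy.2.1 (σ i) e (h.loc i ▸ hi),
    fun i j e hi hj => (h.le i j).trans (hy.2.2.1 _ _ e (h.loc i ▸ hi) (h.loc j ▸ hj)),
    h.continuity (inEdges_of_mem (openCell_subset_closedCell hy)) hy.2.2.2⟩

theorem PermBy.image_closedCell (h : PermBy σ δ' δ) :
    permCoord V σ '' δ.closedCell D = δ'.closedCell D := by
  refine Subset.antisymm (image_subset_iff.2 fun y hy => h.permCoord_mem_closedCell hy) ?_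
  exact fun z hz => ⟨_, h.symm.permCoord_mem_closedCell hz, permCoord_inv z⟩

theorem PermBy.image_openCell (h : PermBy σ δ' δ) :
    permCoord V σ '' δ.openCell D = δ'.openCell D := by
  refine Subset.antisymm (image_subset_iff.2 fun y hy => h.permCoord_mem_openCell hy) ?_
  exact fun z hz => ⟨_, h.symm.permCoord_mem_openCell hz, permCoord_inv z⟩

theorem isPermOf_of_sum_single_eq {f g : Γ.Rat} {p q : Fin n → Γ.Pt}
    (h : (∑ i, Finsupp.single (p i) (1 : ℤ)) = ∑ i, Finsupp.single (q i) (1 : ℤ))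
    (hs : startSlope f = startSlope g) : (datum f p).IsPermOf (datum g q) := by
  obtain ⟨σ, hσ⟩ := exists_perm_of_sum_single_eq h.symm
  refine ⟨σ, fun i => ?_, fun i j => ?_, hs⟩
  · exact congrArg Pt.loc (hσ i)
  · change (∃ e, _) ↔ ∃ e, _
    rw [hσ i, hσ j]

end CellDatum

/-! ### Functions with the same divisor -/

theorem germSlope_add_const (g : ℝ → ℝ) (a : ℝ) : germSlope (fun t => g t + a) = germSlope g := by
  have h : (fun m : ℤ => ∀ᶠ t in 𝓝[>] (0 : ℝ), g t + a = g 0 + a + m * t) =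
      fun m : ℤ => ∀ᶠ t in 𝓝[>] (0 : ℝ), g t = g 0 + m * t := by
    funext m
    refine propext (eventually_congr (Eventually.of_forall fun t => ?_))
    constructor <;> intro h <;> linarith
  -- Since `germSlope` is defined by choice, equality of the predicates is used; it also covers the
  -- default value.
  have key : ∀ P Q : ℤ → Prop, P = Q →
      (open Classical in if h : ∃ m, P m then h.choose else 0) =
        (open Classical in if h : ∃ m, Q m then h.choose else 0) := by
    rintro P _ rfl
    rfl
  exact key _ _ h

theorem ordAt_add_const [Fintype E] {f g : Γ.Rat} {a : ℝ} (h : ∀ p, g.1 p = f.1 p + a) (p : Γ.Pt) :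
    ordAt g p = ordAt f p := by
  rcases p with v | ⟨e, t, ht⟩ <;>
  simp only [ordAt, startSlope, endSlope, h, germSlope_add_const]

theorem CellDatum.edgeFun_sub {δ δ' : CellDatum V E n} {y y' : Coord V n} (hl : δ'.loc = δ.loc)
    (hy : y'.2 = y.2) (e : E) (t : ℝ) :
    δ'.edgeFun D y' e t - δ.edgeFun D y e t =
      (y'.1 (Γ.src e) - y.1 (Γ.src e)) + (δ'.slope e - δ.slope e : ℤ) * t := by
  rw [edgeFun, edgeFun, hl, hy]
  push_cast
  ring

/-- Subtracting the two balancing conditions cancels the points and `D`; the slope differences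
satisfy Kirchhoff's law. -/
theorem CellDatum.IsBalanced.sum_slope_sub [Fintype V] [Fintype E] {δ δ' : CellDatum V E n}
    (h : δ.IsBalanced D) (h' : δ'.IsBalanced D) (hl : δ'.loc = δ.loc) (v : V) :
    (∑ e, by classical exact if Γ.src e = v then δ'.slope e - δ.slope e else 0) =
      ∑ e, by classical exact if Γ.tgt e = v then δ'.slope e - δ.slope e else 0 := by
  classical
  have h1 := CellDatum.isBalanced_iff.1 h v
  have h2 := CellDatum.isBalanced_iff.1 h' v
  have h3 : ∀ e, δ'.lastSlope D e = δ.lastSlope D e - (δ'.slope e - δ.slope e) := fun e => by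
    rw [CellDatum.lastSlope, CellDatum.lastSlope, hl]
    ring
  have h4 : ∀ (s : E → V) (a b : E → ℤ), (∑ e, if s e = v then a e - b e else 0) =
      (∑ e, if s e = v then a e else 0) - ∑ e, if s e = v then b e else 0 := by
    intro s a b
    rw [← Finset.sum_sub_distrib]
    exact Finset.sum_congr rfl fun e _ => by split_ifs <;> simp
  rw [hl, h1] at h2
  simp only [h3, h4] at h2 ⊢
  linarith

variable [Fintype V] [Fintype E]

theorem forget_eq_iff (x y : S D n) : forget D n x = forget D n y ↔
    ∃ σ : Equiv.Perm (Fin n), y.1 = (x.1.1, fun i => x.1.2 (σ i)) := by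
  constructor
  · intro h
    have h1 : x.1.1 = y.1.1 := congrArg Subtype.val h
    have hx : D + principal x.1.1 = ∑ i, Finsupp.single (x.1.2 i) 1 := x.2
    have hy : D + principal y.1.1 = ∑ i, Finsupp.single (y.1.2 i) 1 := y.2
    obtain ⟨σ, hσ⟩ := exists_perm_of_sum_single_eq ((h1 ▸ hx).symm.trans hy)
    exact ⟨σ, Prod.ext h1.symm (funext hσ)⟩
  · rintro ⟨σ, h⟩
    exact Subtype.ext (congrArg Prod.fst h).symm

/-! ### The degree of an effective divisor -/

theorem degree_eq (D : Γ.Divisor) : degree D = (∑ v, D (.vertex v)) +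
    ∑ e, ∑ p ∈ (by classical exact D.support.filter fun p => p.OnEdge e), D p := by
  classical
  rw [degree, Finsupp.sum, ← Finset.sum_fiberwise D.support Pt.loc D, Fintype.sum_sum_type]
  simp only [Pt.loc_eq_inl, Pt.loc_eq_inr]
  congr 1
  refine Finset.sum_congr rfl fun v _ => ?_
  by_cases h : D (.vertex v) = 0
  · rw [h]
    refine Finset.sum_eq_zero fun p hp => ?_
    rw [(Finset.mem_filter.1 hp).2, h]
  · rw [Finset.sum_eq_single (Pt.vertex v)]
    · exact fun p hp hne => absurd (Finset.mem_filter.1 hp).2 hne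
    · exact fun h' => absurd h' (by simp [h])

/-- In the sum of the balancing conditions over all vertices, every slope occurs once with each
sign. -/
theorem CellDatum.IsBalanced.degree_eq {δ : CellDatum V E n} (h : δ.IsBalanced D) :
    degree D = n := by
  classical
  have h1 : ∀ (s : E → V) (m : E → ℤ), ∑ v, ∑ e, (if s e = v then m e else 0) = ∑ e, m e := by
    intro s m
    rw [Finset.sum_comm]
    simp
  have h2 := Finset.sum_congr (rfl : (Finset.univ : Finset V) = _)
    fun v _ => CellDatum.isBalanced_iff.1 h v
  rw [Finset.sum_add_distrib, Finset.sum_add_distrib, h1, h1] at h2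
  have h3 : (n : ℤ) = (∑ v, ((Finset.univ.filter fun i => δ.loc i = Sum.inl v).card : ℤ)) +
      ∑ e, ((Finset.univ.filter fun i => δ.loc i = Sum.inr e).card : ℤ) := by
    have := Finset.card_eq_sum_card_fiberwise (s := Finset.univ) (t := Finset.univ)
      (f := δ.loc) (by simp)
    rw [Fintype.sum_sum_type, Finset.card_univ, Fintype.card_fin] at this
    exact_mod_cast this
  rw [TropicalCurve.degree_eq, h3, h2]
  simp only [CellDatum.lastSlope, Finset.sum_neg_distrib, Finset.sum_add_distrib,
    Finset.sum_sub_distrib]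
  ring

theorem exists_points (f : R D) : ∃ (N : ℕ) (p : Fin N → Γ.Pt),
    D + principal f.1 = ∑ i, Finsupp.single (p i) 1 :=
  exists_eq_sum_single f.2

/-- The effective divisor `D + (f)` is a sum of some number of points, and this number is the degree
of `D` by balancing. -/
theorem surjective_forget (hD : degree D = n) : Function.Surjective (forget D n) := by
  intro f
  obtain ⟨N, p, hp⟩ := exists_points f
  have h := (isBalanced_datum hp).degree_eq
  obtain rfl : N = n := by exact_mod_cast h.symm.trans hD
  exact ⟨⟨(f.1, p), hp⟩, rfl⟩

theorem isQuotientMap_forget (hD : degree D = n) : IsQuotientMap (forget D n) :=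
  isClosedMap_forget.isQuotientMap continuous_forget (surjective_forget hD)

theorem isQuotientMap_toDivisor : IsQuotientMap (toDivisor D) where
  eq_coinduced := rfl
  surjective := by
    rintro ⟨D', h, f, rfl⟩
    exact ⟨⟨f, h⟩, rfl⟩

/-! ### The fibres of `R(D) → |D|` -/

/-- A function on the vertices with integral slopes along the edges that is harmonic has
slope zero. -/
theorem slope_eq_zero_of_harmonic (h : V → ℝ) (m : E → ℝ)
    (hm : ∀ e, h (Γ.tgt e) = h (Γ.src e) + m e * Γ.len e)
    (hb : ∀ v, (∑ e, by classical exact if Γ.src e = v then m e else 0) =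
      ∑ e, by classical exact if Γ.tgt e = v then m e else 0) (e : E) : m e = 0 := by
  classical
  have h1 : ∀ s : E → V, ∑ v, h v * ∑ e, (if s e = v then m e else 0) = ∑ e, h (s e) * m e := by
    intro s
    simp only [Finset.mul_sum]
    rw [Finset.sum_comm]
    simp
  have h2 : ∑ e, h (Γ.src e) * m e = ∑ e, h (Γ.tgt e) * m e := by
    rw [← h1, ← h1]
    exact Finset.sum_congr rfl fun v _ => by rw [hb]
  -- The energy is the sum of `m e` times the increment of `h`, which vanishes by summation by
  -- parts.
  have h3 : ∑ e, m e ^ 2 * Γ.len e = 0 := by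
    rw [← sub_eq_zero.2 h2.symm, ← Finset.sum_sub_distrib]
    refine Finset.sum_congr rfl fun e _ => ?_
    rw [hm]
    ring
  have h4 := (Finset.sum_eq_zero_iff_of_nonneg fun e _ =>
    mul_nonneg (sq_nonneg (m e)) (Γ.len_pos e).le).1 h3 e (Finset.mem_univ e)
  exact pow_eq_zero_iff two_ne_zero |>.1 ((mul_eq_zero.1 h4).resolve_right (Γ.len_pos e).ne')

/-- The two functions have the same kinks, so they differ on every edge by an affine function. Its
slopes are balanced and vanish by `slope_eq_zero_of_harmonic`; connectedness makes the constant
global. -/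
theorem exists_const_of_principal_eq {f g : Γ.Rat} {p : Fin n → Γ.Pt}
    (hf : D + principal f = ∑ i, Finsupp.single (p i) 1)
    (hg : D + principal g = ∑ i, Finsupp.single (p i) 1) :
    ∃ a : ℝ, ∀ q, g.1 q = f.1 q + a := by
  classical
  let m : E → ℝ := fun e => (startSlope g e - startSlope f e : ℤ)
  let h : V → ℝ := fun v => g.1 (.vertex v) - f.1 (.vertex v)
  have hdiff : ∀ e, ∀ t ∈ Icc 0 (Γ.len e),
      g.1 (Γ.edge e t) - f.1 (Γ.edge e t) = h (Γ.src e) + m e * t := by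
    intro e t ht
    rw [(represents_datum hg).2 e t ht, (represents_datum hf).2 e t ht]
    exact CellDatum.edgeFun_sub (δ := datum f p) (δ' := datum g p) (y := coord f p)
      (y' := coord g p) rfl rfl e t
  have hm : ∀ e, h (Γ.tgt e) = h (Γ.src e) + m e * Γ.len e := by
    intro e
    rw [← hdiff e _ ⟨(Γ.len_pos e).le, le_rfl⟩, edge_len]
  have hb : ∀ v, (∑ e, if Γ.src e = v then m e else 0) = ∑ e, if Γ.tgt e = v then m e else 0 := by
    intro v
    have h1 : (∑ e, if Γ.src e = v then startSlope g e - startSlope f e else 0) =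
        ∑ e, if Γ.tgt e = v then startSlope g e - startSlope f e else 0 :=
      (isBalanced_datum hf).sum_slope_sub (isBalanced_datum hg) rfl v
    have h2 := congrArg (Int.cast : ℤ → ℝ) h1
    push_cast at h2
    simpa [m] using h2
  have hm0 := slope_eq_zero_of_harmonic h m hm hb
  have hconst : ∀ u v, h u = h v := by
    intro u v
    induction Γ.connected u v with
    | rel u v huv =>
      obtain ⟨e, rfl, rfl⟩ := huv
      rw [hm, hm0, zero_mul, add_zero]
    | refl => rfl
    | symm _ _ _ ih => exact ih.symm
    | trans _ _ _ _ _ ih ih' => exact ih.trans ih'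
  obtain ⟨v₀⟩ := Γ.nonempty
  refine ⟨h v₀, ?_⟩
  rintro (v | ⟨e, t, ht⟩)
  · linarith [hconst v v₀]
  · have := hdiff e t ⟨ht.1.le, ht.2.le⟩
    rw [edge_of_mem ht, hm0, hconst _ v₀] at this
    linarith

theorem toDivisor_eq_iff (f g : R D) :
    toDivisor D f = toDivisor D g ↔ ∃ a : ℝ, ∀ p, g.1.1 p = f.1.1 p + a := by
  constructor
  · intro h
    have h1 : D + principal f.1 = D + principal g.1 := congrArg Subtype.val h
    obtain ⟨N, p, hp⟩ := exists_points f
    exact exists_const_of_principal_eq hp (h1 ▸ hp)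
  · rintro ⟨a, ha⟩
    refine Subtype.ext ?_
    change D + principal f.1 = D + principal g.1
    congr 1
    exact DFunLike.ext _ _ fun p => (ordAt_add_const ha p).symm

end TropicalCurve

namespace TropicalCurve

variable {V E : Type*} {Γ : TropicalCurve V E} {n : ℕ} {D : Γ.Divisor}

/-! ### Normalization of functions by additive constants -/

namespace CellDatum

variable {δ : CellDatum V E n} {y : Coord V n} {v₀ : V}

/-- Subtraction of a constant from the values, such that the value at `v₀` becomes `0`. -/
noncomputable def normalize (n : ℕ) (v₀ : V) : Coord V n →ₗ[ℝ] Coord V n where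
  toFun y := (fun v => y.1 v - y.1 v₀, y.2)
  map_add' y z := Prod.ext (funext fun v => by simp; ring) rfl
  map_smul' a y := Prod.ext (funext fun v => by simp [mul_sub]) rfl

theorem normalize_apply (y : Coord V n) :
    normalize n v₀ y = (fun v => y.1 v - y.1 v₀, y.2) := rfl

theorem normalize_of_eq_zero (h : y.1 v₀ = 0) : normalize n v₀ y = y := by
  rw [normalize_apply, h]
  simp

theorem normalize_fst_self : (normalize n v₀ y).1 v₀ = 0 := sub_self _

theorem edgeFun_normalize (y : Coord V n) (e : E) (t : ℝ) :
    δ.edgeFun D (normalize n v₀ y) e t = δ.edgeFun D y e t - y.1 v₀ := by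
  have := edgeFun_sub (D := D) (δ := δ) (δ' := δ) (y := y) (y' := normalize n v₀ y) rfl rfl e t
  rw [sub_self, Int.cast_zero, zero_mul] at this
  have h : (normalize n v₀ y).1 (Γ.src e) = y.1 (Γ.src e) - y.1 v₀ := rfl
  linarith

theorem continuity_normalize (hy : δ.InEdges Γ y) (h : δ.Continuity D y) :
    δ.Continuity D (normalize n v₀ y) := by
  have hy' : δ.InEdges Γ (normalize n v₀ y) := hy
  refine (continuity_iff hy').2 fun e => ?_
  rw [edgeFun_normalize, (continuity_iff hy).1 h e]
  rfl

theorem normalize_mem_closedCell (hy : y ∈ δ.closedCell D) :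
    normalize n v₀ y ∈ δ.closedCell D :=
  ⟨hy.1, hy.2.1, hy.2.2.1, continuity_normalize (inEdges_of_mem hy) hy.2.2.2⟩

theorem normalize_mem_openCell (hy : y ∈ δ.openCell D) : normalize n v₀ y ∈ δ.openCell D :=
  ⟨hy.1, hy.2.1, hy.2.2.1,
    continuity_normalize (inEdges_of_mem (openCell_subset_closedCell hy)) hy.2.2.2⟩

theorem image_normalize_closedCell :
    normalize n v₀ '' δ.closedCell D = {y | y ∈ δ.closedCell D ∧ y.1 v₀ = 0} := by
  apply Subset.antisymm
  · rintro _ ⟨y, hy, rfl⟩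
    exact ⟨normalize_mem_closedCell hy, normalize_fst_self⟩
  · exact fun y hy => ⟨y, hy.1, normalize_of_eq_zero hy.2⟩

theorem image_normalize_openCell :
    normalize n v₀ '' δ.openCell D = {y | y ∈ δ.openCell D ∧ y.1 v₀ = 0} := by
  apply Subset.antisymm
  · rintro _ ⟨y, hy, rfl⟩
    exact ⟨normalize_mem_openCell hy, normalize_fst_self⟩
  · exact fun y hy => ⟨y, hy.1, normalize_of_eq_zero hy.2⟩

/-- The slice satisfies the same criterion `intrinsicInterior_eq`; translating the values by a
constant shows that it meets the open cell. -/
theorem intrinsicInterior_normalized [Fintype V] [Finite E] (h : (δ.openCell D).Nonempty) :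
    intrinsicInterior ℝ {y | y ∈ δ.closedCell D ∧ y.1 v₀ = 0} =
      {y | y ∈ δ.openCell D ∧ y.1 v₀ = 0} := by
  refine intrinsicInterior_eq (fun y hy => ⟨openCell_subset_closedCell hy.1, hy.2⟩) ?_
    (fun y hy => ?_) fun y hy z hz ε hε hw => ⟨mem_openCell_of_extend hy.1 hz.1 hε hw.1, hy.2⟩
  · obtain ⟨y, hy⟩ := h
    exact ⟨_, normalize_mem_openCell hy, normalize_fst_self (v₀ := v₀)⟩
  · filter_upwards [mem_closedCell_of_mem_affineSpan hy.1] with z hz hz'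
    exact ⟨hz (affineSpan_mono ℝ (fun w hw => hw.1) hz'),
      eq_of_mem_affineSpan (a := valueForm n v₀) (fun w hw => hw.2) hz'⟩

end CellDatum

/-! ### Descent to `R(D)` and `|D|` -/

theorem exists_permBy_out [Fintype E] (c : CellIndex D n) : ∃ σ : Equiv.Perm (Fin n),
    CellDatum.PermBy σ (Quotient.mk (cellSetoid D n) c).out.1 c.1 :=
  CellDatum.isPermOf_iff.1 (Quotient.mk_out (s := cellSetoid D n) c)

variable [Fintype V] [Fintype E]

theorem forget_chart_permCoord {c c' : CellIndex D n} {σ : Equiv.Perm (Fin n)}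
    (h : CellDatum.PermBy σ c'.1 c.1) {y : Coord V n} (hy : y ∈ c.1.closedCell D) :
    forget D n (chart c' (CellDatum.permCoord V σ y)) = forget D n (chart c y) :=
  Subtype.ext ((represents_chart (h.permCoord_mem_closedCell hy)).unique
    (h.represents (represents_chart hy)))

theorem toDivisor_forget_chart_normalize (v₀ : V) (c : CellIndex D n) {y : Coord V n}
    (hy : y ∈ c.1.closedCell D) :
    toDivisor D (forget D n (chart c (CellDatum.normalize n v₀ y))) =
      toDivisor D (forget D n (chart c y)) := by
  have hy' := CellDatum.normalize_mem_closedCell (v₀ := v₀) hy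
  refine (toDivisor_eq_iff _ _).2 ⟨y.1 v₀, ?_⟩
  rintro (v | ⟨e, t, ht⟩)
  · have h1 := (represents_chart hy).1 v
    have h2 := (represents_chart hy').1 v
    rw [CellDatum.normalize_apply] at h2
    change (chart c y).1.1.1 _ = (chart c (CellDatum.normalize n v₀ y)).1.1.1 _ + _
    rw [h1, CellDatum.normalize_apply, h2, sub_add_cancel]
  · have h1 := (represents_chart hy).2 e t ⟨ht.1.le, ht.2.le⟩
    have h2 := (represents_chart hy').2 e t ⟨ht.1.le, ht.2.le⟩
    rw [edge_of_mem ht] at h1 h2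
    change (chart c y).1.1.1 _ = (chart c (CellDatum.normalize n v₀ y)).1.1.1 _ + _
    rw [h1, h2, CellDatum.edgeFun_normalize, sub_add_cancel]

/-- Open cells of `S(D)` whose images in `|D|` meet differ by a permutation. -/
theorem mk_eq_of_toDivisor_eq {c c' : CellIndex D n} {y y' : Coord V n}
    (hy : y ∈ c.1.openCell D) (hy' : y' ∈ c'.1.openCell D)
    (h : toDivisor D (forget D n (chart c y)) = toDivisor D (forget D n (chart c' y'))) :
    Quotient.mk (cellSetoid D n) c = Quotient.mk (cellSetoid D n) c' := by
  refine Quotient.sound (s := cellSetoid D n) ?_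
  change c.1.IsPermOf c'.1
  have h1 := mem_stratum_iff.1 (chart_mem_stratum hy)
  have h2 := mem_stratum_iff.1 (chart_mem_stratum hy')
  rw [h1, h2]
  have hx : D + principal (chart c y).1.1 = ∑ i, Finsupp.single ((chart c y).1.2 i) 1 :=
    (chart c y).2
  have hx' : D + principal (chart c' y').1.1 = ∑ i, Finsupp.single ((chart c' y').1.2 i) 1 :=
    (chart c' y').2
  have h3 : D + principal (chart c y).1.1 = D + principal (chart c' y').1.1 :=
    congrArg Subtype.val h
  refine CellDatum.isPermOf_of_sum_single_eq ((hx.symm.trans h3).trans hx') ?_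
  -- Adding a constant does not change the initial slopes.
  obtain ⟨a, ha⟩ := (toDivisor_eq_iff _ _).1 h
  have ha : ∀ p, (chart c' y').1.1.1 p = (chart c y).1.1.1 p + a := ha
  funext e
  simp only [startSlope, ha, germSlope_add_const]

/-- Each orbit of cells is represented by one chosen cell. The transition maps are permutations of
coordinates for `R(D)` and, for `|D|`, the projection that normalizes the value at a base vertex to
zero; both have affine sections as required by `IsPolyhedralComplex.descend`. -/
theorem exists_descended_complexes (hD : degree D = n) :
    ∃ (P' P'' : Quotient (cellSetoid D n) → Set (Coord V n))
      (ψ : Quotient (cellSetoid D n) → Coord V n → R D)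
      (χ : Quotient (cellSetoid D n) → Coord V n → LinearSystem D),
      IsPolyhedralComplex P' ψ ∧
      DescendsAlong (forget D n) (Quotient.mk (cellSetoid D n))
        (fun c : CellIndex D n => c.1.closedCell D) chart P' ψ ∧
      IsPolyhedralComplex P'' χ ∧
      DescendsAlong (toDivisor D) id P' ψ P'' χ := by
  obtain ⟨v₀⟩ := Γ.nonempty
  choose σ hσ using exists_permBy_out (D := D) (n := n)
  let P' : Quotient (cellSetoid D n) → Set (Coord V n) := fun k => k.out.1.closedCell D
  let ψ : Quotient (cellSetoid D n) → Coord V n → R D := fun k y => forget D n (chart k.out y)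
  let P'' : Quotient (cellSetoid D n) → Set (Coord V n) := fun k =>
    {y | y ∈ k.out.1.closedCell D ∧ y.1 v₀ = 0}
  let χ : Quotient (cellSetoid D n) → Coord V n → LinearSystem D := fun k y => toDivisor D (ψ k y)
  have hri : ∀ c : CellIndex D n, intrinsicInterior ℝ (c.1.closedCell D) = c.1.openCell D :=
    fun c => CellDatum.intrinsicInterior_closedCell c.2.2
  have hR : IsPolyhedralComplex P' ψ := by
    refine isPolyhedralComplex_chart.descend (isQuotientMap_forget hD)
      (r := Quotient.mk (cellSetoid D n))
      (fun c => (CellDatum.permCoord V (σ c)).toAffineMap)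
      (fun k => CellDatum.isPolyhedron_closedCell _ _) (fun c => (hσ c).image_closedCell)
      (fun c y hy => forget_chart_permCoord (hσ c) hy) (fun c => ?_) (fun k => ?_)
      (fun k => injOn_forget_chart k.out) fun c c' y y' hy hy' h => ?_
    · rw [hri, hri]
      exact (hσ c).image_openCell
    · obtain ⟨c, rfl⟩ := Quotient.exists_rep k
      exact ⟨c, rfl, (CellDatum.permCoord V (σ c)⁻¹).toAffineMap,
        fun y hy => (hσ c).symm.permCoord_mem_closedCell hy, fun y _ => CellDatum.permCoord_inv y⟩
    · rw [hri] at hy hy'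
      exact mk_eq_of_toDivisor_eq hy hy' (congrArg (toDivisor D) h)
  refine ⟨P', P'', ψ, χ, hR, ⟨Quotient.mk_surjective, fun c =>
    ⟨(CellDatum.permCoord V (σ c)).toAffineMap, (hσ c).image_closedCell,
      fun y hy => forget_chart_permCoord (hσ c) hy⟩⟩, ?_, ⟨Function.surjective_id, fun k =>
    ⟨(CellDatum.normalize n v₀).toAffineMap, CellDatum.image_normalize_closedCell,
      fun y hy => toDivisor_forget_chart_normalize v₀ k.out hy⟩⟩⟩
  refine hR.descend isQuotientMap_toDivisor (r := id)
    (fun k => (CellDatum.normalize n v₀).toAffineMap)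
    (fun k => (CellDatum.isPolyhedron_closedCell _ _).and (.eq (CellDatum.valueForm n v₀) 0))
    (fun k => CellDatum.image_normalize_closedCell)
    (fun k y hy => toDivisor_forget_chart_normalize v₀ k.out hy) (fun k => ?_)
    (fun k => ⟨k, rfl, AffineMap.id ℝ _, fun y hy => hy.1,
      fun y hy => CellDatum.normalize_of_eq_zero hy.2⟩)
    (fun k y hy y' hy' h => ?_) fun k k' y y' hy hy' h => ?_
  · refine (congrArg _ (hri k.out)).trans ?_
    exact CellDatum.image_normalize_openCell.trans
      (CellDatum.intrinsicInterior_normalized k.out.2.2).symm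
  · obtain ⟨a, ha⟩ := (toDivisor_eq_iff _ _).1 h
    -- On the slice both functions vanish at `v₀`, so the only constant by which they can differ is
    -- zero.
    have ha0 : a = 0 := by
      have h1 := ha (.vertex v₀)
      have h2 : (ψ k y).1.1 (.vertex v₀) = 0 := ((represents_chart hy.1).1 v₀).trans hy.2
      have h3 : (ψ k y').1.1 (.vertex v₀) = 0 := ((represents_chart hy'.1).1 v₀).trans hy'.2
      rw [h2, h3] at h1
      linarith
    refine injOn_forget_chart k.out hy.1 hy'.1 (Subtype.ext (Subtype.ext (ContinuousMap.ext ?_)))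
    intro p
    have := ha p
    rw [ha0, add_zero] at this
    exact this.symm
  · have := mk_eq_of_toDivisor_eq (hri _ ▸ hy) (hri _ ▸ hy') h
    simpa using this

end TropicalCurve

/-! ### The main theorem -/

theorem mainTheorem6 {V E : Type*} [Fintype V] [Fintype E] (Γ : TropicalCurve V E) (n : ℕ)
    (D : Γ.Divisor) (hD : TropicalCurve.degree D = n) :
    -- the discrete data that occur in `S(D)`
    (∀ δ : TropicalCurve.CellDatum V E n, (TropicalCurve.stratum D δ).Nonempty ↔
      δ.IsBalanced D ∧ (δ.openCell D).Nonempty) ∧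
    -- the charts of the cells of `S(D)`
    ∃ φ : TropicalCurve.CellIndex D n → TropicalCurve.Coord V n → TropicalCurve.S D n,
      IsPolyhedralComplex (fun c : TropicalCurve.CellIndex D n => c.1.closedCell D) φ ∧
      (∀ c : TropicalCurve.CellIndex D n, ∀ y ∈ c.1.closedCell D, c.1.HasCoord (φ c y) y) ∧
      (∀ c : TropicalCurve.CellIndex D n, intrinsicInterior ℝ (c.1.closedCell D) = c.1.openCell D ∧
        φ c '' c.1.openCell D = TropicalCurve.stratum D c.1) ∧
      -- every cell is a face of a cell whose points are totally ordered without ties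
      (∀ c : TropicalCurve.CellIndex D n, ∃ c' : TropicalCurve.CellIndex D n, c'.1.IsTotalOrder ∧ c'.1.loc = c.1.loc ∧
        c'.1.slope = c.1.slope ∧ (∀ i j, c'.1.le i j → c.1.le i j) ∧
        IsExposed ℝ (c'.1.closedCell D) (c.1.closedCell D) ∧
        ∀ y ∈ c.1.closedCell D, φ c' y = φ c y) ∧
      -- `R(D)` is the quotient of `S(D)` by the symmetric group
      IsQuotientMap (TropicalCurve.forget D n) ∧
      (∀ x y : TropicalCurve.S D n, TropicalCurve.forget D n x = TropicalCurve.forget D n y ↔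
        ∃ σ : Equiv.Perm (Fin n), y.1 = (x.1.1, fun i => x.1.2 (σ i))) ∧
      -- `|D|` is the quotient of `R(D)` by the additive group of real numbers
      IsQuotientMap (TropicalCurve.toDivisor D) ∧
      (∀ f g : TropicalCurve.R D, TropicalCurve.toDivisor D f = TropicalCurve.toDivisor D g ↔
        ∃ a : ℝ, ∀ p, g.1.1 p = f.1.1 p + a) ∧
      -- the polyhedral structure descends to `R(D)`, and from there to `|D|`
      ∃ (P' P'' : Quotient (TropicalCurve.cellSetoid D n) → Set (TropicalCurve.Coord V n))
        (ψ : Quotient (TropicalCurve.cellSetoid D n) →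
          TropicalCurve.Coord V n → TropicalCurve.R D)
        (χ : Quotient (TropicalCurve.cellSetoid D n) →
          TropicalCurve.Coord V n → TropicalCurve.LinearSystem D),
        IsPolyhedralComplex P' ψ ∧
        DescendsAlong (TropicalCurve.forget D n) (Quotient.mk (TropicalCurve.cellSetoid D n))
          (fun c : TropicalCurve.CellIndex D n => c.1.closedCell D) φ P' ψ ∧
        IsPolyhedralComplex P'' χ ∧
        DescendsAlong (TropicalCurve.toDivisor D) id P' ψ P'' χ := by
  refine ⟨fun δ => TropicalCurve.CellDatum.stratum_nonempty_iff, TropicalCurve.chart,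
    TropicalCurve.isPolyhedralComplex_chart, fun c y hy => TropicalCurve.hasCoord_chart hy,
    fun c => ⟨TropicalCurve.CellDatum.intrinsicInterior_closedCell c.2.2,
      TropicalCurve.chart_image_openCell c⟩,
    TropicalCurve.exists_isTotalOrder, TropicalCurve.isQuotientMap_forget hD,
    TropicalCurve.forget_eq_iff, TropicalCurve.isQuotientMap_toDivisor,
    TropicalCurve.toDivisor_eq_iff, TropicalCurve.exists_descended_complexes hD⟩
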